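/- **Second Variation Formula.** Let $(M,g)$ and $(N,h)$ be smooth Riemannian manifolds (Hausdorff, second countable), $M$ possibly with boundary (or corners) and $N$ without boundary. For a smooth map $u:M\to N$ let $E(u)=\int_M e(u)\star 1$, $e(u)=\frac12|du|^2=\frac12\, g^{\alpha\beta}\,h_{ij}(u)\,\partial_\alpha u^i\,\partial_\beta u^j$, be its energy, where $\star 1$ is the Riemannian volume measure of $M$; let $\nabla$ be the pullback to $u^*TN$ of the Levi-Civita connection of $N$, $d_\nabla$ the induced exterior derivative, and $\tau(u)=-d_\nabla^\star du$ the tension field, i.e. $\tau(u)=\frac1{\sqrt{|g|}}\nabla_{\partial_\alpha}\big(\sqrt{|g|}\,g^{\alpha\beta}\,du(\partial_\beta)\big)$ in local coordinates, $|g|=\det(g_{\alpha\beta})$. Let $R^N(X,Y)Z=\nabla_X\nabla_YZ-\nabla_Y\nabla_XZ-\nabla_{[X,Y]}Z$. Let $\epsilon>0$ and let $f:M\times(-\epsilon,\epsilon)\to N$, $f_t(x)=f(x,t)$, be smooth. Assume that there is a compact set $K\subset M$ with $f_t=f_0$ outside $K$ for all $t$, and that $e(f_0)$ is integrable (both are automatic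 when $M$ is compact). Then $e(f_t)$ is integrable for every $t\in(-\epsilon,\epsilon)$ and $t\mapsto E(f_t)$ is differentiable on $(-\epsilon,\epsilon)$. Moreover, for every $t\in(-\epsilon,\epsilon)$ such that $\nabla_{\partial/\partial t}\frac{\partial f}{\partial t}=0$ on $\partial M$ at time $t$ (no condition if $\partial M=\emptyset$; satisfied if the maps $f_t$ all agree on $\partial M$), the second derivative of the energy exists at $t$, the three integrands below are integrable, and $$\frac{d^2}{dt^2}E(f_t)=\Big\|\nabla\frac{\partial f}{\partial t}\Big\|^2-\int_M\Big\langle R^N\Big(df,\frac{\partial f}{\partial t}\Big)\frac{\partial f}{\partial t},df\Big\rangle\star1-\int_M\Big\langle\nabla_{\partial/\partial t}\frac{\partial f}{\partial t},\tau(f_t)\Big\rangle\star1 ,$$ where $df=df_t$, $\|\nabla\frac{\partial f}{\partial t}\|^2=\int_M|\nabla\frac{\partial f}{\partial t}|^2\star1$, and the inner products on $T^*M\otimes f_t^*TN$ are those induced by $g$ and $h$. -/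

import Mathlib

open MeasureTheory Set
open scoped Manifold ContDiff Topology

noncomputable section

namespace SecondVariation

/-! Throughout, `X` is a smooth manifold (possibly with boundary or corners) modelled on
`EuclideanSpace ℝ (Fin d)`, and a Riemannian metric on it is a
`Bundle.ContMDiffRiemannianMetric I ∞`, i.e. a smooth family of inner products on tangent spaces. -/

/-- The derivative `dφ(w)` at `p` of a real-valued function `φ` along a tangent vector `w`. -/
def dirDeriv {E : Type*} [NormedAddCommGroup E] [NormedSpace ℝ E]
    {G : Type*} [TopologicalSpace G] (K : ModelWithCorners ℝ E G)
    {P : Type*} [TopologicalSpace P] [ChartedSpace G P]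
    (φ : P → ℝ) (p : P) (w : TangentSpace K p) : ℝ :=
  mfderiv K 𝓘(ℝ, ℝ) φ p w

section Coordinates

variable {d : ℕ} {H : Type*} [TopologicalSpace H]
  (I : ModelWithCorners ℝ (EuclideanSpace ℝ (Fin d)) H)
  {X : Type*} [TopologicalSpace X] [ChartedSpace H X] [IsManifold I ∞ X]

/-- The coordinate vector field `∂/∂xⁱ` of the chart of `X` at `x₀`, evaluated at a point `q` of the
domain of that chart. -/
def coordVec (x₀ q : X) (i : Fin d) : TangentSpace I q :=
  (trivializationAt (EuclideanSpace ℝ (Fin d)) (TangentSpace I : X → Type _) x₀).symm q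
    (EuclideanSpace.single i (1 : ℝ))

/-- The `i`-th component of a tangent vector `v` at `q`, in the frame `∂/∂xⁱ` of the chart
of `X` at `x₀`. -/
def coordComp (x₀ : X) {q : X} (v : TangentSpace I q) (i : Fin d) : ℝ :=
  ((trivializationAt (EuclideanSpace ℝ (Fin d)) (TangentSpace I : X → Type _) x₀) ⟨q, v⟩).2 i

/-- The partial derivative `∂φ/∂xⁱ` at `q` of a function `φ` on `X`, in the chart at `x₀`. -/
def partialDeriv (x₀ : X) (i : Fin d) (φ : X → ℝ) (q : X) : ℝ :=
  dirDeriv I φ q (coordVec I x₀ q i)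

end Coordinates

section Metric

variable {d : ℕ} {H : Type*} [TopologicalSpace H]
  {I : ModelWithCorners ℝ (EuclideanSpace ℝ (Fin d)) H}
  {X : Type*} [TopologicalSpace X] [ChartedSpace H X] [IsManifold I ∞ X]
  (g : Bundle.ContMDiffRiemannianMetric I ∞ (EuclideanSpace ℝ (Fin d))
    (fun x : X => TangentSpace I x))

/-- The matrix `(g_ij)` at `q` of the metric in the chart at `x₀`; the inverse matrix is
`(g^ij)`. -/
def metricMatrix (x₀ q : X) : Matrix (Fin d) (Fin d) ℝ :=
  Matrix.of fun i j => g.inner q (coordVec I x₀ q i) (coordVec I x₀ q j)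

/-- The Christoffel symbol `Γᵏ_ij` at `q` of the Levi-Civita connection, in the chart at `x₀`:
`Γᵏ_ij = ½ ∑ₗ gᵏˡ (∂ᵢ g_jl + ∂ⱼ g_il - ∂ₗ g_ij)`. -/
def christoffel (x₀ : X) (k i j : Fin d) (q : X) : ℝ :=
  (1 / 2) * ∑ l, (metricMatrix g x₀ q)⁻¹ k l *
    (partialDeriv I x₀ i (fun p => metricMatrix g x₀ p j l) q
      + partialDeriv I x₀ j (fun p => metricMatrix g x₀ p i l) q
      - partialDeriv I x₀ l (fun p => metricMatrix g x₀ p i j) q)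

/-- The `l`-th component of `R(∂ᵢ, ∂ⱼ)∂ₖ` at `q` in the chart at `x₀`, where
`R(X, Y)Z = ∇_X ∇_Y Z - ∇_Y ∇_X Z - ∇_[X,Y] Z`. -/
def curvatureComp (x₀ : X) (l i j k : Fin d) (q : X) : ℝ :=
  partialDeriv I x₀ i (christoffel g x₀ l j k) q - partialDeriv I x₀ j (christoffel g x₀ l i k) q
    + ∑ p, (christoffel g x₀ l i p q * christoffel g x₀ p j k q
      - christoffel g x₀ l j p q * christoffel g x₀ p i k q)

/-- The Riemann curvature tensor `R(u, v)w` at `q`. -/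
def curvature (q : X) (u v w : TangentSpace I q) : TangentSpace I q :=
  ∑ l, (∑ i, ∑ j, ∑ k, curvatureComp g q l i j k q *
    (coordComp I q u i * coordComp I q v j * coordComp I q w k)) • coordVec I q q l

/-- The measure `√(det g) dx¹ ⋯ dxᵈ` on the domain of the chart at `x₀`, extended by zero. -/
def chartVolume [MeasurableSpace X] (x₀ : X) : Measure X :=
  Measure.map (extChartAt I x₀).symm
    (((volume : Measure (EuclideanSpace ℝ (Fin d))).restrict (extChartAt I x₀).target).withDensity
      fun y => ENNReal.ofReal (Real.sqrt (metricMatrix g x₀ ((extChartAt I x₀).symm y)).det))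

/-- The Riemannian volume measure `⋆1`: the smallest measure on `X` that dominates
`√(det g) dx¹ ⋯ dxᵈ` in every chart. As these measures agree on overlaps of charts, it restricts to
each of them on the domain of the chart. -/
def riemannianVolume [MeasurableSpace X] : Measure X :=
  ⨆ x₀ : X, chartVolume g x₀

end Metric

section Maps

variable {n : ℕ} {H' : Type*} [TopologicalSpace H']
  {J : ModelWithCorners ℝ (EuclideanSpace ℝ (Fin n)) H'}
  {N : Type*} [TopologicalSpace N] [ChartedSpace H' N] [IsManifold J ∞ N]
  (h : Bundle.ContMDiffRiemannianMetric J ∞ (EuclideanSpace ℝ (Fin n))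
    (fun y : N => TangentSpace J y))

/-- The pullback to `u^*TN` of the Levi-Civita connection of `N`, for a map `u : P → N`: the
covariant derivative `∇_w V` at `p` of a section `V` of `u^*TN`, given in the chart of `N` at
`u p` by `(∇_w V)ᵏ = dVᵏ(w) + ∑ᵢⱼ Γᵏ_ij(u p) du(w)ⁱ Vʲ`. -/
def covDeriv {E : Type*} [NormedAddCommGroup E] [NormedSpace ℝ E]
    {G : Type*} [TopologicalSpace G] (K : ModelWithCorners ℝ E G)
    {P : Type*} [TopologicalSpace P] [ChartedSpace G P]
    (u : P → N) (V : ∀ p : P, TangentSpace J (u p)) (p : P) (w : TangentSpace K p) :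
    TangentSpace J (u p) :=
  ∑ k, (dirDeriv K (fun q => coordComp J (u p) (V q) k) p w
    + ∑ i, ∑ j, christoffel h (u p) k i j (u p) *
        (coordComp J (u p) (mfderiv K J u p w) i * coordComp J (u p) (V p) j))
    • coordVec J (u p) (u p) k

variable {m : ℕ} {H : Type*} [TopologicalSpace H]
  {I : ModelWithCorners ℝ (EuclideanSpace ℝ (Fin m)) H}
  {M : Type*} [TopologicalSpace M] [ChartedSpace H M] [IsManifold I ∞ M]
  (g : Bundle.ContMDiffRiemannianMetric I ∞ (EuclideanSpace ℝ (Fin m))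
    (fun x : M => TangentSpace I x))

/-- The inner product on `T*_x M ⊗ T_y N` induced by `g` and `h`:
`⟨A, B⟩ = ∑ g^{αβ} ⟨A(∂_α), B(∂_β)⟩` for linear maps `A, B : T_x M → T_y N`. -/
def homInner (x : M) (y : N) (A B : TangentSpace I x → TangentSpace J y) : ℝ :=
  ∑ α, ∑ β, (metricMatrix g x x)⁻¹ α β *
    h.inner y (A (coordVec I x x α)) (B (coordVec I x x β))

/-- The energy density `e(f) = ½ |df|²`. -/
def energyDensity (f : M → N) (x : M) : ℝ :=
  (1 / 2) * homInner h g x (f x) (mfderiv I J f x) (mfderiv I J f x)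

/-- The energy `E(f) = ∫_M e(f) ⋆1`. -/
def energy [MeasurableSpace M] (f : M → N) : ℝ :=
  ∫ x, energyDensity h g f x ∂(riemannianVolume g)

/-- The operator `-d_∇^* = ⋆ d_∇ ⋆` on `1`-forms `θ` with values in `f^*TN`. In the chart of `M`
at `x`, with `|g| = det (g_{αβ})`, this is
`(1/√|g|) ∑_α ∇_{∂_α} (∑_β √|g| g^{αβ} θ(∂_β))`, with `∇` the connection of `f^*TN`. -/
def negCodiff (f : M → N) (θ : ∀ x : M, TangentSpace I x → TangentSpace J (f x)) (x : M) :
    TangentSpace J (f x) :=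
  (Real.sqrt (metricMatrix g x x).det)⁻¹ •
    ∑ α, covDeriv h I f
      (fun q => ∑ β, (Real.sqrt (metricMatrix g x q).det * (metricMatrix g x q)⁻¹ α β) •
        θ q (coordVec I x q β))
      x (coordVec I x x α)

/-- The tension field `τ(f) = -d_∇^* df`. -/
def tension (f : M → N) (x : M) : TangentSpace J (f x) :=
  negCodiff h g f (fun x => mfderiv I J f x) x

/-- The variation field `∂f/∂t` of a family `f : M × ℝ → N`, at time `t` and at the point `x`. -/
def variationField (f : M × ℝ → N) (t : ℝ) (x : M) : TangentSpace J (f (x, t)) :=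
  mfderiv 𝓘(ℝ, ℝ) J (fun s : ℝ => f (x, s)) t (1 : ℝ)

/-- The `1`-form `∇ ∂f/∂t` on `M` with values in `f_t^*TN`. -/
def covVariation (f : M × ℝ → N) (t : ℝ) (x : M) (w : TangentSpace I x) :
    TangentSpace J (f (x, t)) :=
  covDeriv h I (fun z : M => f (z, t)) (fun z => variationField f t z) x w

/-- The acceleration `∇_{∂/∂t} ∂f/∂t` along `f`. -/
def acceleration (f : M × ℝ → N) (t : ℝ) (x : M) : TangentSpace J (f (x, t)) :=
  covDeriv h 𝓘(ℝ, ℝ) (fun s : ℝ => f (x, s)) (fun s => variationField f s x) t (1 : ℝ)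

/-- `|∇ ∂f/∂t|²`. -/
def normSqCovVariation (f : M × ℝ → N) (t : ℝ) (x : M) : ℝ :=
  homInner h g x (f (x, t)) (covVariation h f t x : TangentSpace I x → _) (covVariation h f t x)

/-- `⟨R^N(df, ∂f/∂t) ∂f/∂t, df⟩`. -/
def curvatureTerm (f : M × ℝ → N) (t : ℝ) (x : M) : ℝ :=
  homInner h g x (f (x, t))
    (fun v => curvature h (f (x, t)) (mfderiv I J (fun z : M => f (z, t)) x v)
      (variationField f t x) (variationField f t x))
    (mfderiv I J (fun z : M => f (z, t)) x)

/-- `⟨∇_{∂/∂t} ∂f/∂t, τ(f_t)⟩`. -/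
def tensionTerm (f : M × ℝ → N) (t : ℝ) (x : M) : ℝ :=
  h.inner (f (x, t)) (acceleration h f t x) (tension h g (fun z : M => f (z, t)) x)

end Maps

end SecondVariation

end

/-! Write `V = ∂f/∂t` and `A = ∇_{∂/∂t} V`. The formula combines a pointwise identity with one
integration by parts.

Pointwise: by metric compatibility and `∇_t ∂_a f = ∇_a V` (no torsion), the first time derivative
of `½|df|²` is `⟨∇V, df⟩`. Differentiating again gives `|∇V|² + ⟨∇_t ∇V, df⟩`, and exchanging `∇_t`
with `∇_a` turns the last term into `⟨∇A, df⟩ - ⟨R(df, V)V, df⟩`. The calculation takes place in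
charts (`IsLeviCivita.dir_dir_inner`) and becomes `deriv_deriv_energyDensity`.

Integration by parts: let `W` be the vector field on `M` dual to `⟨A, df⟩`. The Leibniz rule gives
`div W = ⟨∇A, df⟩ + ⟨A, τ⟩` (`divergence_accelerationField`). As `W` has compact support and
vanishes on `∂M` with `A`, its divergence integrates to zero (`integral_divergence_eq_zero`), so `∫
⟨∇A, df⟩ = -∫ ⟨A, τ⟩`. Differentiation under the integral is allowed because the time derivatives of
the density are jointly continuous and vanish off `K` (`hasDerivAt_integral_of_compact`).

The objects are defined pointwise, each in the chart at the point in question. To differentiate them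
they must be expressed in one fixed chart, and most of the file proves that this is possible:
`compMap_covDeriv` (from the transformation law of Christoffel symbols), `sum_inv_metricMatrix_mul`
for metric traces, `divergence_eq` for divergences, `riemannianVolume_restrict` for the measure.
Boundary and corners of `M` are handled by derivatives within the convex set `range I`; the
divergence theorem then needs no normal vector, because a function vanishing on the frontier extends
by zero to a Lipschitz function. -/

namespace SecondVariation

set_option linter.unusedSectionVars false

/-! ### Covariant calculus along a map into an open subset of a vector space. -/

noncomputable section LocalCalculus

variable {V : Type*} [NormedAddCommGroup V] [NormedSpace ℝ V]
  {A : Type*} [NormedAddCommGroup A] [NormedSpace ℝ A]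

/-- The metric `H` and the Christoffel symbols `Γ` of its Levi-Civita connection, on an open subset
of a vector space. -/
structure IsLeviCivita (U : Set V) (H : V → V →L[ℝ] V →L[ℝ] ℝ) (Γ : V → V →L[ℝ] V →L[ℝ] V) :
    Prop where
  isOpen : IsOpen U
  smooth_metric : ContDiffOn ℝ ∞ H U
  smooth_christoffel : ContDiffOn ℝ ∞ Γ U
  symm_metric : ∀ y ∈ U, ∀ u v, H y u v = H y v u
  pos : ∀ y ∈ U, ∀ u, u ≠ 0 → 0 < H y u u
  torsion_free : ∀ y ∈ U, ∀ u v, Γ y u v = Γ y v u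
  compat : ∀ y ∈ U, ∀ w u v, fderiv ℝ H y w u v = H y (Γ y w u) v + H y u (Γ y w v)

/-- The covariant derivative in direction `v` of a vector field `X` along `F`, in coordinates. -/
def covDir (Γ : V → V →L[ℝ] V →L[ℝ] V) (S : Set A) (F : A → V) (v : A) (X : A → V) (p : A) : V :=
  fderivWithin ℝ X S p v + Γ (F p) (fderivWithin ℝ F S p v) (X p)

/-- The curvature tensor in coordinates. -/
def localCurvature (Γ : V → V →L[ℝ] V →L[ℝ] V) (y u v w : V) : V :=
  fderiv ℝ Γ y u v w - fderiv ℝ Γ y v u w + (Γ y u (Γ y v w) - Γ y v (Γ y u w))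

variable {U : Set V} {H : V → V →L[ℝ] V →L[ℝ] ℝ} {Γ : V → V →L[ℝ] V →L[ℝ] V}
  {S : Set A} {F X Y : A → V}

theorem contDiffOn_dir {G : Type*} [NormedAddCommGroup G] [NormedSpace ℝ G] {φ : A → G}
    (hS : UniqueDiffOn ℝ S) (hφ : ContDiffOn ℝ ∞ φ S) (v : A) :
    ContDiffOn ℝ ∞ (fun p => fderivWithin ℝ φ S p v) S :=
  (hφ.fderivWithin hS (by simp)).clm_apply contDiffOn_const

/-- Symmetry of second derivatives passes from the interior of `S` to its limit points, hence the
hypothesis `hS'`. It holds for domains with boundary or corners. -/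
theorem dir_comm {G : Type*} [NormedAddCommGroup G] [NormedSpace ℝ G] {φ : A → G}
    (hS : UniqueDiffOn ℝ S) (hS' : S ⊆ closure (interior S)) (hφ : ContDiffOn ℝ ∞ φ S) (v w : A)
    {p : A} (hp : p ∈ S) :
    fderivWithin ℝ (fun q => fderivWithin ℝ φ S q w) S p v =
      fderivWithin ℝ (fun q => fderivWithin ℝ φ S q v) S p w := by
  have hd : DifferentiableWithinAt ℝ (fderivWithin ℝ φ S) S p :=
    (hφ.fderivWithin hS (m := ∞) (by simp)).differentiableOn (by simp) p hp
  have key : ∀ a b : A, fderivWithin ℝ (fun q => fderivWithin ℝ φ S q b) S p a =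
      fderivWithin ℝ (fderivWithin ℝ φ S) S p a b := fun a b => by
    rw [fderivWithin_clm_apply (hS p hp) hd (differentiableWithinAt_const b)]
    simp
  rw [key, key]
  exact ((hφ p hp).isSymmSndFDerivWithinAt (by simpa using ENat.LEInfty.out) hS (hS' hp) hp).eq _ _

theorem contDiffOn_covDir (hΓ : ContDiffOn ℝ ∞ Γ U) (hS : UniqueDiffOn ℝ S)
    (hF : ContDiffOn ℝ ∞ F S) (hFU : MapsTo F S U) (hX : ContDiffOn ℝ ∞ X S) (v : A) :
    ContDiffOn ℝ ∞ (covDir Γ S F v X) S :=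
  (contDiffOn_dir hS hX v).add
    (((hΓ.comp hF hFU).clm_apply (contDiffOn_dir hS hF v)).clm_apply hX)

/-- The product rule leaves the derivative of `H` along `F`; `compat` splits it into exactly the two
`Γ`-terms that complete the covariant derivatives. -/
theorem IsLeviCivita.dir_inner (h : IsLeviCivita U H Γ) {p : A} (hS : UniqueDiffWithinAt ℝ S p)
    (hF : DifferentiableWithinAt ℝ F S p) (hFU : F p ∈ U)
    (hX : DifferentiableWithinAt ℝ X S p) (hY : DifferentiableWithinAt ℝ Y S p) (v : A) :
    fderivWithin ℝ (fun q => H (F q) (X q) (Y q)) S p v =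
      H (F p) (covDir Γ S F v X p) (Y p) + H (F p) (X p) (covDir Γ S F v Y p) := by
  have hH : HasFDerivAt H (fderiv ℝ H (F p)) (F p) :=
    ((h.smooth_metric.contDiffAt (h.isOpen.mem_nhds hFU)).differentiableAt (by simp)).hasFDerivAt
  have h1 : HasFDerivWithinAt (fun q => H (F q)) _ S p :=
    HasFDerivAt.comp_hasFDerivWithinAt (g := H) (g' := fderiv ℝ H (F p)) p hH hF.hasFDerivWithinAt
  have h2 := (h1.clm_apply hX.hasFDerivWithinAt).clm_apply hY.hasFDerivWithinAt
  have h3 := congrArg (fun L => L v) (h2.fderivWithin hS)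
  rw [h3]
  simp [covDir, h.compat _ hFU]
  ring

theorem IsLeviCivita.covDir_comm (h : IsLeviCivita U H Γ) (hS : UniqueDiffOn ℝ S)
    (hS' : S ⊆ closure (interior S)) (hF : ContDiffOn ℝ ∞ F S) (hFU : MapsTo F S U) (v w : A)
    {p : A} (hp : p ∈ S) :
    covDir Γ S F v (fun q => fderivWithin ℝ F S q w) p =
      covDir Γ S F w (fun q => fderivWithin ℝ F S q v) p := by
  simp only [covDir]
  rw [dir_comm hS hS' hF v w hp, h.torsion_free _ (hFU hp)]

theorem fderivWithin_covDir (hU : IsOpen U) (hΓ : ContDiffOn ℝ ∞ Γ U) (hS : UniqueDiffOn ℝ S)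
    (hF : ContDiffOn ℝ ∞ F S) (hFU : MapsTo F S U) (hX : ContDiffOn ℝ ∞ X S) (v w : A)
    {p : A} (hp : p ∈ S) :
    fderivWithin ℝ (covDir Γ S F w X) S p v =
      fderivWithin ℝ (fun q => fderivWithin ℝ X S q w) S p v
      + (fderiv ℝ Γ (F p) (fderivWithin ℝ F S p v) (fderivWithin ℝ F S p w) (X p)
      + Γ (F p) (fderivWithin ℝ (fun q => fderivWithin ℝ F S q w) S p v) (X p)
      + Γ (F p) (fderivWithin ℝ F S p w) (fderivWithin ℝ X S p v)) := by
  have dF := hF.differentiableOn (by simp) p hp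
  have dX := hX.differentiableOn (by simp) p hp
  have dFw := (contDiffOn_dir hS hF w).differentiableOn (by simp) p hp
  have dXw := (contDiffOn_dir hS hX w).differentiableOn (by simp) p hp
  have hΓ' : HasFDerivAt Γ (fderiv ℝ Γ (F p)) (F p) :=
    ((hΓ.contDiffAt (hU.mem_nhds (hFU hp))).differentiableAt (by simp)).hasFDerivAt
  have h1 : HasFDerivWithinAt (fun q => Γ (F q)) _ S p :=
    HasFDerivAt.comp_hasFDerivWithinAt (g := Γ) (g' := fderiv ℝ Γ (F p)) p hΓ'
      dF.hasFDerivWithinAt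
  have h2 := (h1.clm_apply dFw.hasFDerivWithinAt).clm_apply dX.hasFDerivWithinAt
  have h3 := congrArg (fun L => L v) ((dXw.hasFDerivWithinAt.add h2).fderivWithin (hS p hp))
  refine Eq.trans h3 ?_
  simp
  abel

/-- The directions `v`, `w` are constant, so there is no bracket term. After expansion the second
derivatives of `X` and `F` agree by symmetry, the products of `Γ` with a first derivative of `X`
pair off, and what is left is `∂Γ` and `ΓΓ`, that is, the curvature. -/
theorem covDir_covDir_sub (hU : IsOpen U) (hΓ : ContDiffOn ℝ ∞ Γ U) (hS : UniqueDiffOn ℝ S)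
    (hS' : S ⊆ closure (interior S))
    (hF : ContDiffOn ℝ ∞ F S) (hFU : MapsTo F S U) (hX : ContDiffOn ℝ ∞ X S) (v w : A)
    {p : A} (hp : p ∈ S) :
    covDir Γ S F v (covDir Γ S F w X) p = covDir Γ S F w (covDir Γ S F v X) p
      + localCurvature Γ (F p) (fderivWithin ℝ F S p v) (fderivWithin ℝ F S p w) (X p) := by
  rw [covDir, fderivWithin_covDir hU hΓ hS hF hFU hX v w hp, covDir.eq_1 Γ S F w (covDir _ _ _ _ _),
    fderivWithin_covDir hU hΓ hS hF hFU hX w v hp, dir_comm hS hS' hX v w hp,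
    dir_comm hS hS' hF v w hp]
  simp only [covDir, localCurvature, map_add]
  abel

/-- The second derivative of `⟨D_a F, D_b F⟩` in a direction `τ`. -/
theorem IsLeviCivita.dir_dir_inner (h : IsLeviCivita U H Γ) (hS : UniqueDiffOn ℝ S)
    (hS' : S ⊆ closure (interior S)) (hF : ContDiffOn ℝ ∞ F S) (hFU : MapsTo F S U) (a b τ : A)
    {p : A} (hp : p ∈ S) :
    fderivWithin ℝ (fun q => fderivWithin ℝ (fun q => H (F q) (fderivWithin ℝ F S q a)
        (fderivWithin ℝ F S q b)) S q τ) S p τ =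
      (H (F p) (covDir Γ S F a (covDir Γ S F τ fun q => fderivWithin ℝ F S q τ) p)
          (fderivWithin ℝ F S p b)
        + H (F p) (covDir Γ S F b (covDir Γ S F τ fun q => fderivWithin ℝ F S q τ) p)
          (fderivWithin ℝ F S p a))
      + 2 * H (F p) (covDir Γ S F a (fun q => fderivWithin ℝ F S q τ) p)
          (covDir Γ S F b (fun q => fderivWithin ℝ F S q τ) p)
      + (H (F p) (localCurvature Γ (F p) (fderivWithin ℝ F S p τ) (fderivWithin ℝ F S p a)
          (fderivWithin ℝ F S p τ)) (fderivWithin ℝ F S p b)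
        + H (F p) (localCurvature Γ (F p) (fderivWithin ℝ F S p τ) (fderivWithin ℝ F S p b)
          (fderivWithin ℝ F S p τ)) (fderivWithin ℝ F S p a)) := by
  have sm : ∀ c, ContDiffOn ℝ ∞ (fun q => fderivWithin ℝ F S q c) S := contDiffOn_dir hS hF
  have smc : ∀ c, ContDiffOn ℝ ∞ (covDir Γ S F c (fun q => fderivWithin ℝ F S q τ)) S :=
    contDiffOn_covDir h.smooth_christoffel hS hF hFU (sm τ)
  have df : ∀ {φ : A → V}, ContDiffOn ℝ ∞ φ S → ∀ {q}, q ∈ S → DifferentiableWithinAt ℝ φ S q :=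
    fun hφ q hq => hφ.differentiableOn (by simp) q hq
  -- The first derivative, with `∇_τ ∂_a F` already replaced by `∇_a ∂_τ F`, is needed on all of `S`
  -- because it is differentiated once more.
  have e1 : EqOn (fun q => fderivWithin ℝ (fun q => H (F q) (fderivWithin ℝ F S q a)
        (fderivWithin ℝ F S q b)) S q τ)
      (fun q => H (F q) (covDir Γ S F a (fun q => fderivWithin ℝ F S q τ) q)
          (fderivWithin ℝ F S q b) +
        H (F q) (fderivWithin ℝ F S q a) (covDir Γ S F b (fun q => fderivWithin ℝ F S q τ) q))
      S := fun q hq => by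
    simp only
    rw [h.dir_inner (hS q hq) (df hF hq) (hFU hq) (df (sm a) hq) (df (sm b) hq),
      h.covDir_comm hS hS' hF hFU τ a hq, h.covDir_comm hS hS' hF hFU τ b hq]
  have smH : ∀ {X Y : A → V}, ContDiffOn ℝ ∞ X S → ContDiffOn ℝ ∞ Y S →
      ContDiffOn ℝ ∞ (fun q => H (F q) (X q) (Y q)) S := fun hX hY =>
    ((h.smooth_metric.comp hF hFU).clm_apply hX).clm_apply hY
  -- The second derivative contains `∇_τ ∇_a ∂_τ F`; moving `∇_τ` inside produces the acceleration
  -- and a curvature term.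
  rw [fderivWithin_congr e1 (e1 hp), fderivWithin_fun_add (hS p hp)
    ((smH (smc a) (sm b)).differentiableOn (by simp) p hp)
    ((smH (sm a) (smc b)).differentiableOn (by simp) p hp), add_apply,
    h.dir_inner (hS p hp) (df hF hp) (hFU hp) (df (smc a) hp) (df (sm b) hp),
    h.dir_inner (hS p hp) (df hF hp) (hFU hp) (df (sm a) hp) (df (smc b) hp),
    covDir_covDir_sub h.isOpen h.smooth_christoffel hS hS' hF hFU (sm τ) τ a hp,
    covDir_covDir_sub h.isOpen h.smooth_christoffel hS hS' hF hFU (sm τ) τ b hp,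
    h.covDir_comm hS hS' hF hFU τ a hp, h.covDir_comm hS hS' hF hFU τ b hp,
    h.symm_metric _ (hFU hp) (fderivWithin ℝ F S p a)]
  simp only [map_add, add_apply]
  ring

/-- The transformation law of Christoffel symbols under a local isometry `σ`. -/
theorem IsLeviCivita.christoffel_transform (h : IsLeviCivita U H Γ)
    {U' : Set V} {H' : V → V →L[ℝ] V →L[ℝ] ℝ} {Γ' : V → V →L[ℝ] V →L[ℝ] V}
    (h' : IsLeviCivita U' H' Γ') {W : Set V} (hW : IsOpen W) (hWU : W ⊆ U) {σ : V → V}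
    (hσ : ContDiffOn ℝ ∞ σ W) (hσU : MapsTo σ W U')
    (hiso : ∀ y ∈ W, ∀ u v, H' (σ y) (fderiv ℝ σ y u) (fderiv ℝ σ y v) = H y u v)
    {y : V} (hy : y ∈ W) (hsurj : Function.Surjective (fderiv ℝ σ y)) (u v : V) :
    fderiv ℝ σ y (Γ y u v) = fderiv ℝ (fderiv ℝ σ) y u v
      + Γ' (σ y) (fderiv ℝ σ y u) (fderiv ℝ σ y v) := by
  have hWy := hW.mem_nhds hy
  have cσ : ContDiffAt ℝ ∞ σ y := hσ.contDiffAt hWy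
  have dσ : HasFDerivAt σ (fderiv ℝ σ y) y := (cσ.differentiableAt (by simp)).hasFDerivAt
  have ddσ : HasFDerivAt (fderiv ℝ σ) (fderiv ℝ (fderiv ℝ σ) y) y :=
    ((cσ.fderiv_right (m := ∞) (by simp)).differentiableAt (by simp)).hasFDerivAt
  have symmσ : ∀ a b, fderiv ℝ (fderiv ℝ σ) y a b = fderiv ℝ (fderiv ℝ σ) y b a :=
    (cσ.isSymmSndFDerivAt (by simpa using ENat.LEInfty.out)).eq
  have dH : HasFDerivAt H (fderiv ℝ H y) y :=
    ((h.smooth_metric.contDiffAt (h.isOpen.mem_nhds (hWU hy))).differentiableAt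
      (by simp)).hasFDerivAt
  have dH' : HasFDerivAt H' (fderiv ℝ H' (σ y)) (σ y) :=
    ((h'.smooth_metric.contDiffAt (h'.isOpen.mem_nhds (hσU hy))).differentiableAt
      (by simp)).hasFDerivAt
  have sH := h'.symm_metric _ (hσU hy)
  -- the defect of the transformation law
  set T : V → V → V := fun a b => fderiv ℝ (fderiv ℝ σ) y a b
      + Γ' (σ y) (fderiv ℝ σ y a) (fderiv ℝ σ y b) - fderiv ℝ σ y (Γ y a b) with hT
  have Tsymm : ∀ a b, T a b = T b a := fun a b => by
    simp only [hT]
    rw [symmσ a b, h'.torsion_free _ (hσU hy), h.torsion_free _ (hWU hy)]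
  -- The isometry identity is differentiated at `y`; with both compatibility conditions inserted,
  -- everything but the defect cancels.
  have key : ∀ w a b, H' (σ y) (T w a) (fderiv ℝ σ y b)
      + H' (σ y) (fderiv ℝ σ y a) (T w b) = 0 := fun w a b => by
    have e : (fun z => H' (σ z) (fderiv ℝ σ z a) (fderiv ℝ σ z b)) =ᶠ[𝓝 y] fun z => H z a b :=
      Filter.eventually_of_mem hWy fun z hz => hiso z hz a b
    have h0 : HasFDerivAt (fun z => H' (σ z)) _ y :=
      HasFDerivAt.comp (g := H') (g' := fderiv ℝ H' (σ y)) y dH' dσ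
    have h1' := h0.clm_apply (ddσ.clm_apply (hasFDerivAt_const a y))
    have h1 := h1'.clm_apply (ddσ.clm_apply (hasFDerivAt_const b y))
    have h2' := dH.clm_apply (hasFDerivAt_const a y)
    have h2 := h2'.clm_apply (hasFDerivAt_const b y)
    have h3 := congrArg (fun L => L w) (h1.unique (h2.congr_of_eventuallyEq e))
    simp [h.compat _ (hWU hy), h'.compat _ (hσU hy), ← hiso _ hy] at h3
    simp only [hT, map_add, map_sub, add_apply, sub_apply]
    linarith
  -- Koszul's argument: the trilinear form `⟨T w a, dσ b⟩` is symmetric in its first two arguments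
  -- and antisymmetric in its last two, hence zero.
  have zero : ∀ w a b, H' (σ y) (T w a) (fderiv ℝ σ y b) = 0 := fun w a b => by
    have k1 := key w a b
    have k2 := key a b w
    have k3 := key b w a
    rw [sH _ (T _ _)] at k1 k2 k3
    rw [Tsymm a b] at k2
    rw [Tsymm b w] at k3
    rw [Tsymm a w] at k2
    linarith
  -- By surjectivity the vector `T u v` is itself some `dσ b`, so it is orthogonal to itself.
  have Tz : T u v = 0 := by
    by_contra hne
    obtain ⟨b, hb⟩ := hsurj (T u v)
    have := h'.pos _ (hσU hy) _ hne
    rw [← hb, hb] at this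
    have h0 := zero u v b
    rw [hb] at h0
    exact absurd h0 this.ne'
  simp only [hT, sub_eq_zero] at Tz
  exact Tz.symm

end LocalCalculus

/-! ### Tangent vectors and the metric in the frame of a chart. -/

noncomputable section Charts

variable {d : ℕ} {H : Type*} [TopologicalSpace H]
  (I : ModelWithCorners ℝ (EuclideanSpace ℝ (Fin d)) H)
  {X : Type*} [TopologicalSpace X] [ChartedSpace H X] [IsManifold I ∞ X]

scoped instance isManifold_one_of_infty : IsManifold I 1 X := IsManifold.of_le (n := ∞) (by simp)

/-- The tangent vector at `q` with given coordinates in the chart at `x₀`. -/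
def frameMap (x₀ q : X) : EuclideanSpace ℝ (Fin d) →L[ℝ] TangentSpace I q :=
  (trivializationAt (EuclideanSpace ℝ (Fin d)) (TangentSpace I : X → Type _) x₀).symmL ℝ q

/-- The coordinates of a tangent vector at `q` in the chart at `x₀`. -/
def compMap (x₀ q : X) : TangentSpace I q →L[ℝ] EuclideanSpace ℝ (Fin d) :=
  (trivializationAt (EuclideanSpace ℝ (Fin d))
    (TangentSpace I : X → Type _) x₀).continuousLinearMapAt ℝ q

variable {I} {x₀ q : X}

theorem frameMap_single (hq : q ∈ (chartAt H x₀).source) (i : Fin d) :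
    frameMap I x₀ q (EuclideanSpace.single i 1) = coordVec I x₀ q i :=
  Bundle.Trivialization.symmL_apply _ (by simpa using hq) _

theorem compMap_apply (hq : q ∈ (chartAt H x₀).source) (v : TangentSpace I q) (i : Fin d) :
    compMap I x₀ q v i = coordComp I x₀ v i := by
  rw [compMap, Bundle.Trivialization.continuousLinearMapAt_apply_of_mem _ _ (by simpa using hq)]
  rfl

theorem compMap_frameMap (hq : q ∈ (chartAt H x₀).source) (v : EuclideanSpace ℝ (Fin d)) :
    compMap I x₀ q (frameMap I x₀ q v) = v :=
  Bundle.Trivialization.continuousLinearMapAt_symmL _ (by simpa using hq) _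

theorem frameMap_compMap (hq : q ∈ (chartAt H x₀).source) (v : TangentSpace I q) :
    frameMap I x₀ q (compMap I x₀ q v) = v :=
  Bundle.Trivialization.symmL_continuousLinearMapAt _ (by simpa using hq) _

theorem sum_single_smul (v : EuclideanSpace ℝ (Fin d)) :
    ∑ i, v i • EuclideanSpace.single i (1 : ℝ) = v := by
  ext j
  simp [Finset.sum_apply, Pi.single_apply]

theorem frameMap_eq_sum (hq : q ∈ (chartAt H x₀).source) (v : EuclideanSpace ℝ (Fin d)) :
    frameMap I x₀ q v = ∑ i, v i • coordVec I x₀ q i := by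
  conv_lhs => rw [← sum_single_smul v]
  simp only [map_sum, map_smul, frameMap_single hq]

theorem eq_sum_coordVec (hq : q ∈ (chartAt H x₀).source) (v : TangentSpace I q) :
    v = ∑ i, coordComp I x₀ v i • coordVec I x₀ q i := by
  conv_lhs => rw [← frameMap_compMap hq v, frameMap_eq_sum hq]
  simp only [compMap_apply hq]

/-- The derivative along a coordinate direction is the derivative in the chart. -/
theorem mfderiv_frameMap {G : Type*} [NormedAddCommGroup G] [NormedSpace ℝ G] {φ : X → G}
    (hq : q ∈ (chartAt H x₀).source) (hφ : MDifferentiableAt I 𝓘(ℝ, G) φ q)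
    (v : EuclideanSpace ℝ (Fin d)) :
    (mfderiv I 𝓘(ℝ, G) φ q (frameMap I x₀ q v) : G) =
      fderivWithin ℝ (φ ∘ (extChartAt I x₀).symm) (range I) (extChartAt I x₀ q) v := by
  have hq' : q ∈ (extChartAt I x₀).source := by simpa using hq
  have hl := (extChartAt I x₀).left_inv hq'
  have h1 : MDifferentiableWithinAt 𝓘(ℝ, EuclideanSpace ℝ (Fin d)) I (extChartAt I x₀).symm
      (range I) (extChartAt I x₀ q) :=
    mdifferentiableWithinAt_extChartAt_symm ((extChartAt I x₀).map_source hq')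
  have hu : UniqueMDiffWithinAt 𝓘(ℝ, EuclideanSpace ℝ (Fin d)) (range I) (extChartAt I x₀ q) :=
    (I.uniqueDiffOn _ (extChartAt_target_subset_range x₀
      ((extChartAt I x₀).map_source hq'))).uniqueMDiffWithinAt
  rw [← mfderivWithin_eq_fderivWithin, mfderiv_comp_mfderivWithin_of_eq (I' := I) hφ h1 hu hl,
    frameMap, TangentBundle.symmL_trivializationAt hq]
  rfl

theorem compMap_mfderiv {E : Type*} [NormedAddCommGroup E] [NormedSpace ℝ E]
    {G : Type*} [TopologicalSpace G] {K : ModelWithCorners ℝ E G}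
    {P : Type*} [TopologicalSpace P] [ChartedSpace G P] {u : P → X} {p : P}
    (hu : MDifferentiableAt K I u p) (hp : u p ∈ (chartAt H x₀).source) (w : TangentSpace K p) :
    compMap I x₀ (u p) (mfderiv K I u p w) =
      mfderiv K 𝓘(ℝ, EuclideanSpace ℝ (Fin d)) (extChartAt I x₀ ∘ u) p w := by
  rw [mfderiv_comp (I' := I) p (mdifferentiableAt_extChartAt hp) hu, compMap,
    TangentBundle.continuousLinearMapAt_trivializationAt hp]
  rfl

theorem compMap_frameMap_eq_fderivWithin {x₁ : X} (hq : q ∈ (chartAt H x₀).source)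
    (hq₁ : q ∈ (chartAt H x₁).source) (v : EuclideanSpace ℝ (Fin d)) :
    compMap I x₁ q (frameMap I x₀ q v) =
      fderivWithin ℝ (extChartAt I x₁ ∘ (extChartAt I x₀).symm) (range I)
        (extChartAt I x₀ q) v := by
  rw [← mfderiv_frameMap hq (mdifferentiableAt_extChartAt hq₁), compMap,
    TangentBundle.continuousLinearMapAt_trivializationAt hq₁]
  rfl

theorem coordVec_linearIndependent (hq : q ∈ (chartAt H x₀).source) :
    Function.Injective
      (fun v : EuclideanSpace ℝ (Fin d) => (∑ i, v i • coordVec I x₀ q i : TangentSpace I q)) := by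
  intro v w hvw
  simp only [← frameMap_eq_sum (I := I) hq] at hvw
  rw [← compMap_frameMap (I := I) hq v, hvw, compMap_frameMap hq]

/-- In the trivialization at `x₀` this section is constant. -/
theorem contMDiffOn_coordVec (i : Fin d) :
    ContMDiffOn I (I.prod 𝓘(ℝ, EuclideanSpace ℝ (Fin d))) ∞
      (fun q => Bundle.TotalSpace.mk' (EuclideanSpace ℝ (Fin d)) (E := (TangentSpace I : X → Type _))
        q (coordVec I x₀ q i)) (chartAt H x₀).source := by
  intro q hq
  have hb : q ∈ (trivializationAt (EuclideanSpace ℝ (Fin d))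
    (TangentSpace I : X → Type _) x₀).baseSet := by simpa using hq
  refine (Bundle.Trivialization.contMDiffWithinAt_section (IB := I) _ hb).2 ?_
  refine (contMDiffWithinAt_const (c := EuclideanSpace.single i (1 : ℝ))).congr_of_mem
    (fun z hz => ?_) hq
  have hz' : z ∈ (trivializationAt (EuclideanSpace ℝ (Fin d))
    (TangentSpace I : X → Type _) x₀).baseSet := by simpa using hz
  rw [coordVec, Bundle.Trivialization.apply_mk_symm _ hz']

variable (g : Bundle.ContMDiffRiemannianMetric I ∞ (EuclideanSpace ℝ (Fin d))
    (fun x : X => TangentSpace I x))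

theorem contMDiffOn_metricMatrix (x₀ : X) (i j : Fin d) :
    ContMDiffOn I 𝓘(ℝ, ℝ) ∞ (fun q => metricMatrix g x₀ q i j) (chartAt H x₀).source := by
  intro q hq
  have h1 : ContMDiffWithinAt I (I.prod 𝓘(ℝ)) ∞
      (fun m ↦ Bundle.TotalSpace.mk' ℝ (E := Bundle.Trivial X ℝ) m
        (g.inner m (coordVec I x₀ m i) (coordVec I x₀ m j))) (chartAt H x₀).source q := by
    apply ContMDiffWithinAt.clm_bundle_apply₂ (F₁ := EuclideanSpace ℝ (Fin d))
      (F₂ := EuclideanSpace ℝ (Fin d))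
    · exact g.contMDiff.contMDiffAt.contMDiffWithinAt
    · exact contMDiffOn_coordVec i q hq
    · exact contMDiffOn_coordVec j q hq
  simp only [Bundle.contMDiffWithinAt_totalSpace] at h1
  exact h1.2

theorem contDiffOn_comp_extChartAt_symm {G : Type*} [NormedAddCommGroup G] [NormedSpace ℝ G]
    {φ : X → G} (hφ : ContMDiffOn I 𝓘(ℝ, G) ∞ φ (chartAt H x₀).source) :
    ContDiffOn ℝ ∞ (fun ξ => φ ((extChartAt I x₀).symm ξ)) (extChartAt I x₀).target := by
  rw [← contMDiffOn_iff_contDiffOn]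
  refine hφ.comp (contMDiffOn_extChartAt_symm x₀) fun ξ hξ => ?_
  simpa using (extChartAt I x₀).map_target hξ

theorem contDiffOn_metricMatrix (x₀ : X) (i j : Fin d) :
    ContDiffOn ℝ ∞ (fun ξ => metricMatrix g x₀ ((extChartAt I x₀).symm ξ) i j)
      (extChartAt I x₀).target :=
  contDiffOn_comp_extChartAt_symm (contMDiffOn_metricMatrix g x₀ i j)

theorem inner_sum_coordVec (x₀ q : X) (u v : EuclideanSpace ℝ (Fin d)) :
    g.inner q (∑ i, u i • coordVec I x₀ q i) (∑ i, v i • coordVec I x₀ q i) =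
      ∑ i, ∑ j, metricMatrix g x₀ q i j * (u i * v j) := by
  simp only [map_sum, map_smul, FunLike.coe_sum, Finset.sum_apply, FunLike.coe_smul,
    Pi.smul_apply, smul_eq_mul, metricMatrix, Matrix.of_apply, Finset.mul_sum]
  rw [Finset.sum_comm]
  exact Finset.sum_congr rfl fun i _ => Finset.sum_congr rfl fun j _ => by ring

theorem metricMatrix_posDef (hq : q ∈ (chartAt H x₀).source) :
    (metricMatrix g x₀ q).PosDef := by
  refine Matrix.PosDef.of_dotProduct_mulVec_pos ?_ fun v hv => ?_
  · ext i j
    simp [metricMatrix, g.symm]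
  · have h1 : ∑ i, v i • coordVec I x₀ q i ≠ 0 := fun h0 => hv <| by
      have := coordVec_linearIndependent (I := I) hq (a₁ := WithLp.toLp 2 v) (a₂ := 0)
        (by simpa using h0)
      simpa using this
    have h2 := g.pos q _ h1
    have h3 := inner_sum_coordVec g x₀ q (WithLp.toLp 2 v) (WithLp.toLp 2 v)
    rw [h3] at h2
    refine h2.trans_eq ?_
    simp only [dotProduct, Matrix.mulVec, star_trivial, Finset.mul_sum]
    exact Finset.sum_congr rfl fun i _ => Finset.sum_congr rfl fun j _ => by ring

theorem metricMatrix_isSymm (x₀ q : X) : (metricMatrix g x₀ q).IsSymm := by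
  ext i j
  simp [metricMatrix, g.symm]

end Charts

/-! ### Smoothness of determinants and inverse matrices. -/

section MatrixSmooth

variable {A : Type*} [NormedAddCommGroup A] [NormedSpace ℝ A] {d : ℕ} {s : Set A}
  {M : A → Matrix (Fin d) (Fin d) ℝ}

theorem contDiffOn_det (hM : ∀ i j, ContDiffOn ℝ ∞ (fun x => M x i j) s) :
    ContDiffOn ℝ ∞ (fun x => (M x).det) s := by
  simp only [Matrix.det_apply']
  exact ContDiffOn.sum fun σ _ => contDiffOn_const.mul (contDiffOn_prod fun i _ => hM _ _)

theorem contDiffOn_matrix_inv (hM : ∀ i j, ContDiffOn ℝ ∞ (fun x => M x i j) s)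
    (h0 : ∀ x ∈ s, (M x).det ≠ 0) (i j : Fin d) :
    ContDiffOn ℝ ∞ (fun x => (M x)⁻¹ i j) s := by
  simp only [Matrix.inv_def, Ring.inverse_eq_inv', Matrix.smul_apply, smul_eq_mul,
    Matrix.adjugate_apply]
  refine ((contDiffOn_det hM).inv h0).mul (contDiffOn_det fun k l => ?_)
  -- An entry of the adjugate is the determinant of the matrix with row `j` replaced by a basis
  -- vector, so that row is constant and the others are rows of `M x`.
  by_cases hk : k = j
  · subst hk
    simpa using contDiffOn_const
  · simpa [hk] using hM k l

end MatrixSmooth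

/-! ### Integration over convex sets, Jacobi's formula, divergence in coordinates. -/

noncomputable section Divergence

/-- A segment that leaves `C` meets the frontier, since otherwise `interior C` and `Cᶜ` would
disconnect it. There `Y` vanishes, so `Y` at the inner endpoint is at most `L` times the distance to
the crossing point. -/
theorem lipschitzWith_indicator_of_frontier {E : Type*} [NormedAddCommGroup E] [NormedSpace ℝ E]
    {C : Set E} {Y : E → ℝ} {L : NNReal} (hL : LipschitzOnWith L Y C) (hC : IsClosed C)
    (h0 : ∀ x ∈ frontier C, Y x = 0) : LipschitzWith L (C.indicator Y) := by
  have key : ∀ x ∈ C, ∀ y ∉ C, ‖Y x‖ ≤ L * dist x y := by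
    intro x hx y hy
    obtain ⟨z, hz, hzf⟩ : ∃ z ∈ segment ℝ x y, z ∈ frontier C := by
      by_contra! hne
      have hint : ∀ z ∈ segment ℝ x y, z ∈ C → z ∈ interior C := fun z hz hzC => by
        by_contra hzi
        exact hne z hz ⟨subset_closure hzC, hzi⟩
      obtain ⟨z, -, hz1, hz2⟩ := (convex_segment x y).isPreconnected (interior C) Cᶜ
        isOpen_interior hC.isOpen_compl
        (fun z hz => (em (z ∈ C)).imp (hint z hz) id)
        ⟨x, left_mem_segment ℝ x y, hint x (left_mem_segment ℝ x y) hx⟩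
        ⟨y, right_mem_segment ℝ x y, hy⟩
      exact hz2 (interior_subset hz1)
    have h1 := hL.dist_le_mul x hx z (hC.frontier_subset hzf)
    rw [h0 z hzf, dist_zero_right] at h1
    refine h1.trans (mul_le_mul_of_nonneg_left ?_ L.2)
    have := dist_add_dist_of_mem_segment hz
    linarith [dist_nonneg (x := z) (y := y)]
  refine LipschitzWith.of_dist_le_mul fun x y => ?_
  by_cases hx : x ∈ C <;> by_cases hy : y ∈ C
  · simpa [hx, hy] using hL.dist_le_mul x hx y hy
  · simpa [hx, hy] using key x hx y hy
  · simpa [hx, hy, dist_comm] using key y hy x hx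
  · simp [hx, hy]
    positivity

/-- The integral over a closed convex set of a directional derivative of a compactly supported `C¹`
function vanishing on the frontier is zero. -/
theorem setIntegral_fderivWithin_eq_zero {E : Type*} [NormedAddCommGroup E] [NormedSpace ℝ E]
    [FiniteDimensional ℝ E] [MeasurableSpace E] [BorelSpace E] (μ : Measure E)
    [μ.IsAddHaarMeasure] {C K : Set E} {Y : E → ℝ} (hC : IsClosed C) (hconv : Convex ℝ C)
    (hu : UniqueDiffOn ℝ C) (hY : ContDiffOn ℝ 1 Y C) (hK : IsCompact K)
    (hYK : ∀ x ∈ C, x ∉ K → Y x = 0) (h0 : ∀ x ∈ frontier C, Y x = 0) (v : E) :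
    ∫ x in C, fderivWithin ℝ Y C x v ∂μ = 0 := by
  have hcont : ContinuousOn (fderivWithin ℝ Y C) C := hY.continuousOn_fderivWithin hu le_rfl
  obtain ⟨L, hL⟩ : ∃ L : ℝ, ∀ x ∈ C ∩ K, ‖fderivWithin ℝ Y C x‖ ≤ L :=
    (hK.inter_left hC).exists_bound_of_continuousOn (hcont.mono inter_subset_left)
  have hzero : ∀ x ∈ C, x ∉ K → fderivWithin ℝ Y C x = 0 := fun x hx hxK => by
    have e : Y =ᶠ[𝓝[C] x] fun _ => (0 : ℝ) := by
      filter_upwards [self_mem_nhdsWithin, mem_nhdsWithin_of_mem_nhds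
        (hK.isClosed.isOpen_compl.mem_nhds hxK)] with z hz hzK using hYK z hz hzK
    rw [e.fderivWithin_eq (hYK x hx hxK)]
    simp
  have hbound : ∀ x ∈ C, ‖fderivWithin ℝ Y C x‖₊ ≤ L.toNNReal := fun x hx => by
    by_cases hxK : x ∈ K
    · rw [← NNReal.coe_le_coe, coe_nnnorm]
      exact (hL x ⟨hx, hxK⟩).trans (Real.le_coe_toNNReal L)
    · simp [hzero x hx hxK]
  have hlip : LipschitzOnWith L.toNNReal Y C :=
    hconv.lipschitzOnWith_of_nnnorm_fderivWithin_le (hY.differentiableOn (by simp)) hbound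
  have hlip' := lipschitzWith_indicator_of_frontier hlip hC h0
  have hsupp : HasCompactSupport (C.indicator Y) := HasCompactSupport.intro hK fun x hx => by
    by_cases hxC : x ∈ C
    · simp [hxC, hYK x hxC hx]
    · simp [hxC]
  -- Integration by parts for Lipschitz functions, tested against the constant `1`; the direction is
  -- `-v` because the formula reverses it.
  have h1 := LipschitzWith.integral_lineDeriv_mul_eq (μ := μ)
    (LipschitzWith.const (1 : ℝ) : LipschitzWith 0 fun _ : E => (1 : ℝ)) hlip' hsupp (-v)
  have hc : ∀ x : E, lineDeriv ℝ (fun _ : E => (1 : ℝ)) x (-v) = 0 := fun x => by simp [lineDeriv]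
  simp only [hc, zero_mul, integral_zero, neg_neg, mul_one] at h1
  rw [← integral_indicator hC.measurableSet, h1]
  refine integral_congr_ae ?_
  -- The frontier of a convex set is null. Away from it the extension by zero is differentiable
  -- wherever `Y` is, with the derivative of `Y` inside and `0` outside.
  have hnull : ∀ᵐ x ∂μ, x ∉ frontier C := measure_eq_zero_iff_ae_notMem.1 (hconv.addHaar_frontier μ)
  filter_upwards [hnull] with x hx
  by_cases hxC : x ∈ C
  · have hxi : x ∈ interior C := by
      by_contra hxi
      exact hx ⟨subset_closure hxC, hxi⟩
    have hn := mem_interior_iff_mem_nhds.1 hxi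
    have hd : HasFDerivAt Y (fderivWithin ℝ Y C x) x :=
      ((hY.differentiableOn (by simp) x hxC).hasFDerivWithinAt).hasFDerivAt hn
    have he : C.indicator Y =ᶠ[𝓝 x] Y := by
      filter_upwards [hn] with z hz using by simp [hz]
    rw [((hd.congr_of_eventuallyEq he).hasLineDerivAt v).lineDeriv]
    simp [hxC]
  · have he : C.indicator Y =ᶠ[𝓝 x] fun _ => 0 := by
      filter_upwards [hC.isOpen_compl.mem_nhds hxC] with z hz using indicator_of_notMem hz _
    rw [(((hasFDerivAt_const (0 : ℝ) x).congr_of_eventuallyEq he).hasLineDerivAt v).lineDeriv]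
    simp [hxC]

variable {d : ℕ}

local notation "E" => EuclideanSpace ℝ (Fin d)

theorem det_eq_matrix_det (A : E →L[ℝ] E) :
    A.det = (Matrix.of fun i j => A (EuclideanSpace.single j 1) i).det := by
  rw [ContinuousLinearMap.det, ← LinearMap.det_toMatrix (EuclideanSpace.basisFun (Fin d) ℝ).toBasis]
  congr 1

theorem trace_eq_sum (A : E →L[ℝ] E) :
    LinearMap.trace ℝ E A = ∑ i, A (EuclideanSpace.single i 1) i := by
  rw [LinearMap.trace_eq_matrix_trace ℝ (EuclideanSpace.basisFun (Fin d) ℝ).toBasis, Matrix.trace]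
  refine Finset.sum_congr rfl fun i _ => ?_
  simp [LinearMap.toMatrix_apply]

theorem contDiff_clm_det : ContDiff ℝ ∞ (fun A : E →L[ℝ] E => A.det) := by
  simp only [det_eq_matrix_det]
  rw [← contDiffOn_univ]
  refine contDiffOn_det fun i j => ?_
  rw [contDiffOn_univ]
  simp only [Matrix.of_apply]
  fun_prop

theorem hasDerivAt_det_one_add (B : E →L[ℝ] E) :
    HasDerivAt (fun t : ℝ => (1 + t • B).det) (LinearMap.trace ℝ E B) 0 := by
  set M : Matrix (Fin d) (Fin d) ℝ := Matrix.of fun i j => B (EuclideanSpace.single j 1) i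
  obtain ⟨c, hc⟩ : ∃ c : Polynomial ℝ, ∀ t : ℝ,
      (1 + t • B).det = 1 + M.trace * t + c.eval t * t ^ 2 := by
    -- The remainder is the polynomial `det (1 + X M)` divided twice by `X`, which discards the
    -- coefficients `1` and `trace M`.
    refine ⟨(Matrix.det (1 + (Polynomial.X : Polynomial ℝ) • M.map Polynomial.C)).divX.divX,
      fun t => ?_⟩
    rw [← Matrix.det_one_add_smul, det_eq_matrix_det]
    congr 1
    ext i j
    simp [M, Matrix.one_apply]
  simp only [hc]
  have h1 : HasDerivAt (fun t : ℝ => 1 + M.trace * t + c.eval t * t ^ 2) _ 0 :=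
    (((hasDerivAt_id (0 : ℝ)).const_mul M.trace).const_add 1).add
      ((c.hasDerivAt 0).mul ((hasDerivAt_id (0 : ℝ)).pow 2))
  convert h1 using 1
  simp [trace_eq_sum, Matrix.trace, M]

/-- Jacobi's formula. -/
theorem fderiv_clm_det {A A' : E →L[ℝ] E} (h : A ∘L A' = ContinuousLinearMap.id ℝ E)
    (B : E →L[ℝ] E) :
    fderiv ℝ (fun A : E →L[ℝ] E => A.det) A B = A.det * LinearMap.trace ℝ E (A' ∘L B) := by
  have h1 : HasFDerivAt (fun A : E →L[ℝ] E => A.det) (fderiv ℝ (fun A : E →L[ℝ] E => A.det) A) A :=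
    (contDiff_clm_det.differentiable (by simp) A).hasFDerivAt
  have h2 : HasDerivAt (fun t : ℝ => (A + t • B).det)
      (fderiv ℝ (fun A : E →L[ℝ] E => A.det) A B) 0 := by
    have := h1.hasLineDerivAt B
    simpa [HasLineDerivAt] using this
  have h3 : HasDerivAt (fun t : ℝ => A.det * (1 + t • (A' ∘L B)).det)
      (A.det * LinearMap.trace ℝ E (A' ∘L B)) 0 := (hasDerivAt_det_one_add _).const_mul _
  refine h2.unique (h3.congr_of_eventuallyEq (Filter.Eventually.of_forall fun t => ?_))
  -- Taking `A` out reduces the derivative at `A` to the derivative at the identity.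
  have : A + t • B = A ∘L (1 + t • (A' ∘L B)) := by
    rw [ContinuousLinearMap.comp_add, ContinuousLinearMap.comp_smul,
      ← ContinuousLinearMap.comp_assoc, h]
    ext
    simp
  simp only [this, ContinuousLinearMap.det, ContinuousLinearMap.toLinearMap_comp,
    LinearMap.det_comp]

/-- The divergence `(1/ρ) ∂_α (ρ wᵃ)` of a vector field `w` with respect to the measure `ρ dx`. -/
def localDiv (S : Set E) (ρ : E → ℝ) (w : E → E) (ξ : E) : ℝ :=
  (ρ ξ)⁻¹ * LinearMap.trace ℝ E (fderivWithin ℝ (fun ξ => ρ ξ • w ξ) S ξ)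

/-- Separates the derivative of the field from that of the density: under a change of coordinates
each picks up a correction, and only their sum is invariant. -/
theorem localDiv_eq {S : Set E} {ρ : E → ℝ} {w : E → E} {ξ : E} (hS : UniqueDiffWithinAt ℝ S ξ)
    (hρ : DifferentiableWithinAt ℝ ρ S ξ) (hw : DifferentiableWithinAt ℝ w S ξ) (h0 : ρ ξ ≠ 0) :
    localDiv S ρ w ξ = LinearMap.trace ℝ E (fderivWithin ℝ w S ξ) +
      (ρ ξ)⁻¹ * fderivWithin ℝ ρ S ξ (w ξ) := by
  rw [localDiv, fderivWithin_fun_smul hS hρ hw, trace_eq_sum, trace_eq_sum]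
  have : fderivWithin ℝ ρ S ξ (w ξ) =
      ∑ i, fderivWithin ℝ ρ S ξ (EuclideanSpace.single i 1) * w ξ i := by
    conv_lhs => rw [← sum_single_smul (w ξ)]
    simp only [map_sum, map_smul, smul_eq_mul, mul_comm]
  rw [this]
  simp only [add_apply, FunLike.coe_smul, Pi.smul_apply, PiLp.add_apply, PiLp.smul_apply,
    smul_eq_mul, ContinuousLinearMap.smulRight_apply, Finset.sum_add_distrib, mul_add,
    ← Finset.mul_sum]
  field_simp

/-- The divergence does not depend on the coordinates. -/
theorem localDiv_transform {S S' : Set E} {κ : E → E} {ρ ρ' : E → ℝ} {w w' : E → E}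
    (hS : UniqueDiffOn ℝ S) (hS' : S ⊆ closure (interior S)) (hU' : UniqueDiffOn ℝ S')
    (hκ : ContDiffOn ℝ ∞ κ S) (hκS : MapsTo κ S S')
    (hρ : DifferentiableOn ℝ ρ S) (hw : DifferentiableOn ℝ w S)
    (hρ' : DifferentiableOn ℝ ρ' S') (hw' : DifferentiableOn ℝ w' S')
    (hww : ∀ ξ ∈ S, w' (κ ξ) = fderivWithin ℝ κ S ξ (w ξ))
    (hρρ : ∀ ξ ∈ S, ρ ξ = ρ' (κ ξ) * |(fderivWithin ℝ κ S ξ).det|)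
    {ξ : E} (hξ : ξ ∈ S) (h0 : ρ ξ ≠ 0) {Ji : E →L[ℝ] E}
    (hJ : fderivWithin ℝ κ S ξ ∘L Ji = ContinuousLinearMap.id ℝ E) :
    localDiv S' ρ' w' (κ ξ) = localDiv S ρ w ξ := by
  set J := fderivWithin ℝ κ S ξ with hJdef
  -- In finite dimension a right inverse is also a left inverse.
  have hJ' : Ji ∘L J = ContinuousLinearMap.id ℝ E := by
    have : (J : E →ₗ[ℝ] E) * (Ji : E →ₗ[ℝ] E) = 1 := congrArg ContinuousLinearMap.toLinearMap hJ
    ext1 v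
    exact congrArg (fun L : E →ₗ[ℝ] E => L v) (mul_eq_one_comm.1 this)
  have hdet : J.det ≠ 0 := fun h => h0 (by rw [hρρ ξ hξ, ← hJdef, h]; simp)
  have hρ'0 : ρ' (κ ξ) ≠ 0 := fun h => h0 (by rw [hρρ ξ hξ, h]; simp)
  have dκ : DifferentiableWithinAt ℝ κ S ξ := hκ.differentiableOn (by simp) ξ hξ
  have dJ : DifferentiableWithinAt ℝ (fderivWithin ℝ κ S) S ξ :=
    (hκ.fderivWithin hS (m := ∞) (by simp)).differentiableOn (by simp) ξ hξ
  set J' := fderivWithin ℝ (fderivWithin ℝ κ S) S ξ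
  have symm : ∀ a b, J' a b = J' b a :=
    ((hκ ξ hξ).isSymmSndFDerivWithinAt (by simpa using ENat.LEInfty.out) hS (hS' hξ) hξ).eq
  -- Differentiating `w' ∘ κ = J w` adds `tr (J⁻¹ J'(w))` to the trace; this uses the symmetry of
  -- the second derivative of `κ`. By Jacobi's formula the logarithmic derivative of `|det J|` is
  -- the same trace, and it enters the density part with the opposite sign.
  rw [localDiv_eq (hU' _ (hκS hξ)) (hρ' _ (hκS hξ)) (hw' _ (hκS hξ)) hρ'0,
    localDiv_eq (hS ξ hξ) (hρ ξ hξ) (hw ξ hξ) h0]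
  -- the derivative of the vector field
  have e1 : fderivWithin ℝ w' S' (κ ξ) ∘L J = J' (w ξ) + J ∘L fderivWithin ℝ w S ξ := by
    have a1 := (hw' _ (hκS hξ)).hasFDerivWithinAt.comp ξ dκ.hasFDerivWithinAt hκS
    have a2 := dJ.hasFDerivWithinAt.clm_apply (hw ξ hξ).hasFDerivWithinAt
    have a3 := a1.congr (f₁ := fun z => fderivWithin ℝ κ S z (w z))
      (fun z hz => (hww z hz).symm) (hww ξ hξ).symm
    have a4 := (a3.fderivWithin (hS ξ hξ)).symm.trans (a2.fderivWithin (hS ξ hξ))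
    rw [a4]
    ext1 v
    simp [J', symm v, add_comm, J]
  have e2 : LinearMap.trace ℝ E (fderivWithin ℝ w' S' (κ ξ)) =
      LinearMap.trace ℝ E (Ji ∘L J' (w ξ)) + LinearMap.trace ℝ E (fderivWithin ℝ w S ξ) := by
    have b1 : fderivWithin ℝ w' S' (κ ξ) = (J' (w ξ) + J ∘L fderivWithin ℝ w S ξ) ∘L Ji := by
      rw [← e1, ContinuousLinearMap.comp_assoc, hJ, ContinuousLinearMap.comp_id]
    rw [b1, ContinuousLinearMap.toLinearMap_comp, LinearMap.trace_comp_comm', ← map_add]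
    congr 1
    rw [← ContinuousLinearMap.toLinearMap_comp, ContinuousLinearMap.comp_add,
      ← ContinuousLinearMap.comp_assoc, hJ']
    rfl
  -- the derivative of the density
  have e3 : fderivWithin ℝ ρ S ξ (w ξ) = fderivWithin ℝ ρ' S' (κ ξ) (w' (κ ξ)) * |J.det|
      + ρ ξ * LinearMap.trace ℝ E (Ji ∘L J' (w ξ)) := by
    have a1 := (hρ' _ (hκS hξ)).hasFDerivWithinAt.comp ξ dκ.hasFDerivWithinAt hκS
    have a2 : HasFDerivWithinAt (fun z => (fderivWithin ℝ κ S z).det) _ S ξ :=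
      HasFDerivAt.comp_hasFDerivWithinAt (g := fun A : E →L[ℝ] E => A.det) ξ
        (contDiff_clm_det.differentiable (by simp) _).hasFDerivAt dJ.hasFDerivWithinAt
    have a3 : HasFDerivWithinAt (fun z => |(fderivWithin ℝ κ S z).det|) _ S ξ :=
      HasDerivAt.comp_hasFDerivWithinAt (h₂ := fun t : ℝ => |t|) ξ (hasDerivAt_abs hdet) a2
    have a4 := (a1.mul a3).congr (f₁ := ρ) hρρ (hρρ ξ hξ)
    rw [a4.fderivWithin (hS ξ hξ)]
    have a5 := fderiv_clm_det hJ (J' (w ξ))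
    have a6 : (SignType.sign J.det : ℝ) * J.det = |J.det| := sign_mul_self J.det
    simp only [add_apply, FunLike.coe_smul, Pi.smul_apply, smul_eq_mul, ← hJdef,
      ContinuousLinearMap.comp_apply, Function.comp_apply]
    rw [a5, hww ξ hξ, hρρ ξ hξ, ← hJdef, ← a6]
    ring
  rw [e2, e3, hρρ ξ hξ, ← hJdef]
  have := abs_pos.2 hdet
  field_simp
  ring

end Divergence

/-! ### Change of frame, and the Riemannian volume in charts. -/

noncomputable section Volume

variable {d : ℕ} {H : Type*} [TopologicalSpace H]
  {I : ModelWithCorners ℝ (EuclideanSpace ℝ (Fin d)) H}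
  {X : Type*} [TopologicalSpace X] [ChartedSpace H X] [IsManifold I ∞ X]
  (g : Bundle.ContMDiffRiemannianMetric I ∞ (EuclideanSpace ℝ (Fin d))
    (fun x : X => TangentSpace I x))
  {x₀ x₁ q : X}

/-- The matrix expressing the coordinate frame at `x₁` in terms of the one at `x₀`. -/
def frameChange (I : ModelWithCorners ℝ (EuclideanSpace ℝ (Fin d)) H) [IsManifold I ∞ X]
    (x₀ x₁ q : X) : Matrix (Fin d) (Fin d) ℝ :=
  Matrix.of fun a b => coordComp I x₀ (coordVec I x₁ q a) b

theorem coordVec_eq_sum_frameChange (hq : q ∈ (chartAt H x₀).source) (a : Fin d) :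
    coordVec I x₁ q a = ∑ b, frameChange I x₀ x₁ q a b • coordVec I x₀ q b :=
  eq_sum_coordVec hq _

theorem frameChange_mul (hq : q ∈ (chartAt H x₀).source) (hq₁ : q ∈ (chartAt H x₁).source) :
    frameChange I x₀ x₁ q * frameChange I x₁ x₀ q = 1 := by
  ext a c
  have h1 := congrArg (compMap I x₁ q) (coordVec_eq_sum_frameChange (I := I) (x₁ := x₁) hq a)
  rw [← frameMap_single hq₁, compMap_frameMap hq₁, map_sum] at h1
  have h2 := congrArg (fun v : EuclideanSpace ℝ (Fin d) => v c) h1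
  simp only [map_smul] at h2
  simp only [Matrix.mul_apply, Matrix.one_apply]
  simp [compMap_apply hq₁, @eq_comm _ c a] at h2
  exact h2.symm

theorem metricMatrix_frameChange (hq : q ∈ (chartAt H x₀).source) :
    metricMatrix g x₁ q =
      frameChange I x₀ x₁ q * metricMatrix g x₀ q * (frameChange I x₀ x₁ q).transpose := by
  ext a b
  rw [metricMatrix, Matrix.of_apply, coordVec_eq_sum_frameChange hq a,
    coordVec_eq_sum_frameChange hq b]
  have := inner_sum_coordVec g x₀ q (WithLp.toLp 2 (frameChange I x₀ x₁ q a))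
    (WithLp.toLp 2 (frameChange I x₀ x₁ q b))
  rw [this]
  simp only [Matrix.mul_apply, Matrix.transpose_apply, Finset.sum_mul]
  rw [Finset.sum_comm]
  exact Finset.sum_congr rfl fun i _ => Finset.sum_congr rfl fun j _ => by ring

/-- The trace of a bilinear form with respect to the metric does not depend on the frame. -/
theorem sum_inv_metricMatrix_mul (hq : q ∈ (chartAt H x₀).source)
    (hq₁ : q ∈ (chartAt H x₁).source)
    (T : TangentSpace I q →ₗ[ℝ] TangentSpace I q →ₗ[ℝ] ℝ) :
    ∑ a, ∑ b, (metricMatrix g x₁ q)⁻¹ a b * T (coordVec I x₁ q a) (coordVec I x₁ q b) =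
      ∑ a, ∑ b, (metricMatrix g x₀ q)⁻¹ a b * T (coordVec I x₀ q a) (coordVec I x₀ q b) := by
  set P := frameChange I x₀ x₁ q
  set Q := frameChange I x₁ x₀ q
  have hPQ : P * Q = 1 := frameChange_mul hq hq₁
  have hQP : Q * P = 1 := frameChange_mul hq₁ hq
  have hPi : P⁻¹ = Q := Matrix.inv_eq_right_inv hPQ
  have hPti : P.transpose⁻¹ = Q.transpose := by rw [← Matrix.transpose_nonsing_inv, hPi]
  have hG : (metricMatrix g x₁ q)⁻¹ = Q.transpose * (metricMatrix g x₀ q)⁻¹ * Q := by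
    rw [metricMatrix_frameChange g hq, Matrix.mul_inv_rev, Matrix.mul_inv_rev, hPi, hPti,
      Matrix.mul_assoc]
  set t₀ : Matrix (Fin d) (Fin d) ℝ :=
    Matrix.of fun a b => T (coordVec I x₀ q a) (coordVec I x₀ q b) with ht₀
  set t₁ : Matrix (Fin d) (Fin d) ℝ :=
    Matrix.of fun a b => T (coordVec I x₁ q a) (coordVec I x₁ q b) with ht₁
  have hT : t₁ = P * t₀ * P.transpose := by
    ext a b
    rw [ht₁, Matrix.of_apply, coordVec_eq_sum_frameChange hq a, coordVec_eq_sum_frameChange hq b]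
    simp only [map_sum, map_smul, Matrix.mul_apply, Matrix.transpose_apply,
      Finset.sum_mul, LinearMap.sum_apply, LinearMap.smul_apply, smul_eq_mul, Finset.mul_sum, ht₀,
      Matrix.of_apply]
    exact Finset.sum_congr rfl fun i _ => Finset.sum_congr rfl fun j _ => by
      simp only [P]
      ring
  -- The double sum is the trace of a matrix product, in which the frame changes `P` and `Q` cancel
  -- by cyclicity.
  have key : ∀ A B : Matrix (Fin d) (Fin d) ℝ,
      ∑ a, ∑ b, A a b * B a b = (A * B.transpose).trace := fun A B => by
    simp [Matrix.trace, Matrix.mul_apply]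
  have e0 := key (metricMatrix g x₀ q)⁻¹ t₀
  have e1 := key (metricMatrix g x₁ q)⁻¹ t₁
  simp only [ht₀, ht₁, Matrix.of_apply] at e0 e1
  rw [e0, e1, ← ht₀, ← ht₁, hT, hG, Matrix.transpose_mul, Matrix.transpose_mul,
    Matrix.transpose_transpose]
  calc (Q.transpose * (metricMatrix g x₀ q)⁻¹ * Q * (P * (t₀.transpose * P.transpose))).trace
      = (Q.transpose * ((metricMatrix g x₀ q)⁻¹ * (Q * P) * t₀.transpose * P.transpose)).trace := by
        simp only [Matrix.mul_assoc]
    _ = ((metricMatrix g x₀ q)⁻¹ * t₀.transpose * (P.transpose * Q.transpose)).trace := by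
        rw [Matrix.trace_mul_comm, hQP, Matrix.mul_one]
        simp only [Matrix.mul_assoc]
    _ = _ := by rw [← Matrix.transpose_mul, hQP, Matrix.transpose_one, Matrix.mul_one]

/-- The Riemannian density `√(det g)` in the chart at `x₀`. -/
def density (x₀ : X) (ξ : EuclideanSpace ℝ (Fin d)) : ℝ :=
  Real.sqrt (metricMatrix g x₀ ((extChartAt I x₀).symm ξ)).det

theorem symm_mem_source {ξ : EuclideanSpace ℝ (Fin d)} (hξ : ξ ∈ (extChartAt I x₀).target) :
    (extChartAt I x₀).symm ξ ∈ (chartAt H x₀).source := by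
  simpa using (extChartAt I x₀).map_target hξ

theorem metricMatrix_det_pos (hq : q ∈ (chartAt H x₀).source) :
    0 < (metricMatrix g x₀ q).det :=
  (metricMatrix_posDef g hq).det_pos

theorem density_pos {ξ : EuclideanSpace ℝ (Fin d)} (hξ : ξ ∈ (extChartAt I x₀).target) :
    0 < density g x₀ ξ :=
  Real.sqrt_pos.2 (metricMatrix_det_pos g (symm_mem_source hξ))

theorem contDiffOn_density (x₀ : X) :
    ContDiffOn ℝ ∞ (density g x₀) (extChartAt I x₀).target :=
  (contDiffOn_det fun i j => contDiffOn_metricMatrix g x₀ i j).sqrt fun _ hξ =>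
    (metricMatrix_det_pos g (symm_mem_source hξ)).ne'

/-- The transition map between two charts, and its domain. -/
def transition (I : ModelWithCorners ℝ (EuclideanSpace ℝ (Fin d)) H) (x₀ x₁ : X) :
    EuclideanSpace ℝ (Fin d) → EuclideanSpace ℝ (Fin d) :=
  extChartAt I x₁ ∘ (extChartAt I x₀).symm

def overlap (I : ModelWithCorners ℝ (EuclideanSpace ℝ (Fin d)) H) (x₀ x₁ : X) :
    Set (EuclideanSpace ℝ (Fin d)) :=
  (extChartAt I x₀).target ∩ (extChartAt I x₀).symm ⁻¹' (extChartAt I x₁).source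

theorem fderivWithin_transition {ξ : EuclideanSpace ℝ (Fin d)} (hξ : ξ ∈ overlap I x₀ x₁)
    (v : EuclideanSpace ℝ (Fin d)) :
    fderivWithin ℝ (transition I x₀ x₁) (range I) ξ v =
      compMap I x₁ ((extChartAt I x₀).symm ξ) (frameMap I x₀ ((extChartAt I x₀).symm ξ) v) := by
  have h := compMap_frameMap_eq_fderivWithin (I := I) (symm_mem_source hξ.1)
    (by simpa using hξ.2 : (extChartAt I x₀).symm ξ ∈ (chartAt H x₁).source) v
  rw [h, (extChartAt I x₀).right_inv hξ.1]
  rfl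

/-- The Gram determinant changes by the square of the Jacobian determinant; the square root leaves
its absolute value, the factor in the change of variables formula. -/
theorem density_transition {ξ : EuclideanSpace ℝ (Fin d)} (hξ : ξ ∈ overlap I x₀ x₁) :
    density g x₀ ξ = density g x₁ (transition I x₀ x₁ ξ) *
      |(fderivWithin ℝ (transition I x₀ x₁) (range I) ξ).det| := by
  have hq₁ : (extChartAt I x₀).symm ξ ∈ (chartAt H x₁).source := by simpa using hξ.2
  have h1 : (fderivWithin ℝ (transition I x₀ x₁) (range I) ξ).det =
      (frameChange I x₁ x₀ ((extChartAt I x₀).symm ξ)).det := by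
    rw [det_eq_matrix_det, ← Matrix.det_transpose]
    congr 1
    ext a b
    rw [Matrix.transpose_apply, Matrix.of_apply, fderivWithin_transition hξ,
      frameMap_single (symm_mem_source hξ.1), compMap_apply hq₁]
    rfl
  have h2 : (extChartAt I x₁).symm (transition I x₀ x₁ ξ) = (extChartAt I x₀).symm ξ :=
    (extChartAt I x₁).left_inv hξ.2
  rw [density, density, h2, metricMatrix_frameChange g hq₁, h1, Matrix.det_mul, Matrix.det_mul,
    Matrix.det_transpose, ← Real.sqrt_sq_eq_abs, ← Real.sqrt_mul (metricMatrix_det_pos g hq₁).le]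
  congr 1
  ring

theorem contDiffOn_transition (x₀ x₁ : X) :
    ContDiffOn ℝ ∞ (transition I x₀ x₁) (overlap I x₀ x₁) := by
  rw [← contMDiffOn_iff_contDiffOn]
  exact (contMDiffOn_extChartAt (n := ∞) (x := x₁)).comp
    ((contMDiffOn_extChartAt_symm x₀).mono inter_subset_left) fun ξ hξ => by simpa using hξ.2

theorem measurableSet_range (I : ModelWithCorners ℝ (EuclideanSpace ℝ (Fin d)) H) :
    MeasurableSet (range I) := I.isClosed_range.measurableSet

/-- With boundary, chart targets are only relatively open in `range I`. The open set `U` allows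
derivatives within a target or overlap to be replaced by derivatives within `range I`. -/
theorem isOpen_preimage_target (x₀ : X) {O : Set X} (hO : IsOpen O) :
    ∃ U : Set (EuclideanSpace ℝ (Fin d)), IsOpen U ∧
      (extChartAt I x₀).target ∩ (extChartAt I x₀).symm ⁻¹' O = range I ∩ U := by
  refine ⟨I.symm ⁻¹' ((chartAt H x₀).target ∩ (chartAt H x₀).symm ⁻¹' O),
    ((chartAt H x₀).isOpen_inter_preimage_symm hO).preimage I.continuous_symm, ?_⟩
  rw [extChartAt_target]
  ext ξ
  simp
  tauto

theorem measurableSet_target (x₀ : X) : MeasurableSet (extChartAt I x₀).target := by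
  obtain ⟨U, hU, h⟩ := isOpen_preimage_target (I := I) x₀ isOpen_univ
  rw [preimage_univ, inter_univ] at h
  rw [h]
  exact (measurableSet_range I).inter hU.measurableSet

variable [MeasurableSpace X] [BorelSpace X]

theorem measurableSet_target_inter (x₀ : X) {A : Set X} (hA : MeasurableSet A) :
    MeasurableSet ((extChartAt I x₀).target ∩ (extChartAt I x₀).symm ⁻¹' A) := by
  have h1 : Measurable ((extChartAt I x₀).target.domRestrict (extChartAt I x₀).symm) :=
    (continuousOn_extChartAt_symm x₀).domRestrict.measurable
  have h2 := (measurableSet_target (I := I) x₀).subtype_image (h1 hA)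
  convert h2 using 1
  ext ξ
  simp
  tauto

theorem aemeasurable_symm (x₀ : X) {μ : Measure (EuclideanSpace ℝ (Fin d))}
    (hμ : μ ≪ volume.restrict (extChartAt I x₀).target) : AEMeasurable (extChartAt I x₀).symm μ :=
  ((continuousOn_extChartAt_symm x₀).aemeasurable (measurableSet_target x₀)).mono_ac hμ

theorem chartVolume_apply (x₀ : X) {A : Set X} (hA : MeasurableSet A) :
    chartVolume g x₀ A = ∫⁻ ξ in (extChartAt I x₀).target ∩ (extChartAt I x₀).symm ⁻¹' A,
      ENNReal.ofReal (density g x₀ ξ) := by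
  have hB := measurableSet_target_inter (I := I) x₀ hA
  have h1 := aemeasurable_symm (I := I) x₀ (withDensity_absolutelyContinuous
    (volume.restrict (extChartAt I x₀).target) fun ξ => ENNReal.ofReal (density g x₀ ξ))
  have h2 : chartVolume g x₀ A = (volume.restrict (extChartAt I x₀).target).withDensity
      (fun ξ => ENNReal.ofReal (density g x₀ ξ)) ((extChartAt I x₀).symm ⁻¹' A) :=
    Measure.map_apply_of_aemeasurable h1 hA
  rw [h2, withDensity_apply₀, Measure.restrict_restrict₀', inter_comm]
  · exact (measurableSet_target x₀).nullMeasurableSet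
  · refine NullMeasurableSet.mono_ac ?_ Measure.AbsolutelyContinuous.rfl
    exact ((continuousOn_extChartAt_symm x₀).aemeasurable
      (measurableSet_target x₀)).nullMeasurable hA

theorem chartVolume_compl_source (x₀ : X) : chartVolume g x₀ (chartAt H x₀).sourceᶜ = 0 := by
  rw [chartVolume_apply g x₀ (chartAt H x₀).open_source.measurableSet.compl]
  have : (extChartAt I x₀).target ∩ (extChartAt I x₀).symm ⁻¹' (chartAt H x₀).sourceᶜ = ∅ := by
    ext ξ
    simp only [mem_inter_iff, mem_preimage, mem_compl_iff, mem_empty_iff_false, iff_false, not_and,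
      not_not]
    exact fun hξ => symm_mem_source hξ
  rw [this, Measure.restrict_empty, lintegral_zero_measure]

/-- Change of variables along the transition map, which is injective on the preimage `B` of `A` and
whose Jacobian is the ratio of the densities by `density_transition`. -/
theorem chartVolume_eq_of_subset (x₀ x₁ : X) {A : Set X} (hA : MeasurableSet A)
    (h₀ : A ⊆ (chartAt H x₀).source) (h₁ : A ⊆ (chartAt H x₁).source) :
    chartVolume g x₀ A = chartVolume g x₁ A := by
  rw [chartVolume_apply g x₀ hA, chartVolume_apply g x₁ hA]
  set B := (extChartAt I x₀).target ∩ (extChartAt I x₀).symm ⁻¹' A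
  have hB : MeasurableSet B := measurableSet_target_inter x₀ hA
  have hBo : B ⊆ overlap I x₀ x₁ := fun ξ hξ => ⟨hξ.1, by simpa using h₁ hξ.2⟩
  have himg : transition I x₀ x₁ '' B =
      (extChartAt I x₁).target ∩ (extChartAt I x₁).symm ⁻¹' A := by
    ext η
    constructor
    · rintro ⟨ξ, hξ, rfl⟩
      refine ⟨(extChartAt I x₁).map_source (hBo hξ).2, ?_⟩
      simp only [mem_preimage, transition, Function.comp_apply,
        (extChartAt I x₁).left_inv (hBo hξ).2]
      exact hξ.2
    · rintro ⟨h1, h2⟩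
      have h3 : (extChartAt I x₁).symm η ∈ (extChartAt I x₀).source := by simpa using h₀ h2
      refine ⟨extChartAt I x₀ ((extChartAt I x₁).symm η),
        ⟨(extChartAt I x₀).map_source h3, ?_⟩, ?_⟩
      · simpa only [mem_preimage, (extChartAt I x₀).left_inv h3] using h2
      · simp only [transition, Function.comp_apply, (extChartAt I x₀).left_inv h3,
          (extChartAt I x₁).right_inv h1]
  have hinj : InjOn (transition I x₀ x₁) B := fun a ha b hb hab => by
    have := congrArg (extChartAt I x₁).symm hab
    simp only [transition, Function.comp_apply, (extChartAt I x₁).left_inv (hBo ha).2,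
      (extChartAt I x₁).left_inv (hBo hb).2] at this
    exact (extChartAt I x₀).symm.injOn (hBo ha).1 (hBo hb).1 this
  have hder : ∀ ξ ∈ B, HasFDerivWithinAt (transition I x₀ x₁)
      (fderivWithin ℝ (transition I x₀ x₁) (range I) ξ) B ξ := fun ξ hξ => by
    obtain ⟨U, hU, hUeq⟩ := isOpen_preimage_target (I := I) x₀ (isOpen_extChartAt_source (I := I) x₁)
    have hξ' : ξ ∈ range I ∩ U := hUeq ▸ hBo hξ
    have hd := (contDiffOn_transition (I := I) x₀ x₁).differentiableOn (by simp) ξ (hBo hξ)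
    have hn : overlap I x₀ x₁ ∈ 𝓝[range I] ξ := by
      rw [overlap, hUeq]
      exact Filter.inter_mem self_mem_nhdsWithin (mem_nhdsWithin_of_mem_nhds (hU.mem_nhds hξ'.2))
    exact (hd.mono_of_mem_nhdsWithin hn).hasFDerivWithinAt.mono
      (hBo.trans (inter_subset_left.trans (extChartAt_target_subset_range x₀)))
  rw [← himg, lintegral_image_eq_lintegral_abs_det_fderiv_mul volume hB hder hinj]
  refine setLIntegral_congr_fun hB fun ξ hξ => ?_
  rw [density_transition g (hBo hξ), ← ENNReal.ofReal_mul (abs_nonneg _), mul_comm]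

/-- A supremum of measures is not computed set by set. Instead, `chartVolume g x₀` plus the part of
the supremum off the chart domain is shown to dominate every chart measure, hence the supremum;
restricting to the chart domain removes the second summand. -/
theorem riemannianVolume_restrict (x₀ : X) :
    (riemannianVolume g).restrict (chartAt H x₀).source = chartVolume g x₀ := by
  have hs : ∀ x : X, MeasurableSet (chartAt H x).source := fun x =>
    (chartAt H x).open_source.measurableSet
  have hc : ∀ x, chartVolume g x ≤ riemannianVolume g := le_iSup (chartVolume g)
  apply le_antisymm
  · have hle : riemannianVolume g ≤
        chartVolume g x₀ + (riemannianVolume g).restrict (chartAt H x₀).sourceᶜ := by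
      refine iSup_le fun x => Measure.le_iff.2 fun A hA => ?_
      rw [Measure.add_apply, Measure.restrict_apply hA]
      have h1 : chartVolume g x (A ∩ (chartAt H x₀).source) ≤ chartVolume g x₀ A := by
        have h2 : chartVolume g x (A ∩ (chartAt H x₀).source) ≤
            chartVolume g x (A ∩ (chartAt H x₀).source ∩ (chartAt H x).source) := by
          refine (measure_mono (t := A ∩ (chartAt H x₀).source ∩ (chartAt H x).source ∪
            (chartAt H x).sourceᶜ) fun z hz => ?_).trans ((measure_union_le _ _).trans ?_)
          · by_cases hz' : z ∈ (chartAt H x).source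
            · exact Or.inl ⟨hz, hz'⟩
            · exact Or.inr hz'
          · rw [chartVolume_compl_source, add_zero]
        rw [chartVolume_eq_of_subset g x x₀ ((hA.inter (hs x₀)).inter (hs x)) inter_subset_right
          (inter_subset_left.trans inter_subset_right)] at h2
        exact h2.trans (measure_mono (inter_subset_left.trans inter_subset_left))
      rw [← measure_inter_add_sdiff A (hs x₀)]
      exact add_le_add h1 (hc x _)
    refine (Measure.restrict_mono_measure hle _).trans ?_
    rw [Measure.restrict_add, Measure.restrict_restrict (hs x₀), inter_compl_self,
      Measure.restrict_empty, add_zero]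
    exact Measure.restrict_le_self
  · have h1 : (chartVolume g x₀).restrict (chartAt H x₀).source = chartVolume g x₀ :=
      Measure.restrict_eq_self_of_ae_mem (by
        rw [ae_iff]
        exact chartVolume_compl_source g x₀)
    rw [← h1]
    exact Measure.restrict_mono_measure (hc x₀) _

theorem setIntegral_source (x₀ : X) {φ : X → ℝ} (hφ : ContinuousOn φ (chartAt H x₀).source) :
    ∫ x in (chartAt H x₀).source, φ x ∂riemannianVolume g =
      ∫ ξ in (extChartAt I x₀).target, density g x₀ ξ * φ ((extChartAt I x₀).symm ξ) := by
  have hm : AEStronglyMeasurable φ (chartVolume g x₀) := by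
    rw [← riemannianVolume_restrict]
    exact hφ.aestronglyMeasurable (chartAt H x₀).open_source.measurableSet
  have hac := withDensity_absolutelyContinuous (volume.restrict (extChartAt I x₀).target)
    fun ξ => ENNReal.ofReal (density g x₀ ξ)
  have hd : AEMeasurable (density g x₀) (volume.restrict (extChartAt I x₀).target) :=
    (contDiffOn_density g x₀).continuousOn.aemeasurable (measurableSet_target x₀)
  rw [riemannianVolume_restrict]
  have h1 : ∫ x, φ x ∂chartVolume g x₀ = ∫ ξ, φ ((extChartAt I x₀).symm ξ)
      ∂(volume.restrict (extChartAt I x₀).target).withDensity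
        fun ξ => ENNReal.ofReal (density g x₀ ξ) :=
    integral_map (aemeasurable_symm x₀ hac) hm
  rw [h1, integral_withDensity_eq_integral_toReal_smul₀ hd.ennreal_ofReal
    (Filter.Eventually.of_forall fun ξ => ENNReal.ofReal_lt_top)]
  refine setIntegral_congr_fun (measurableSet_target x₀) fun ξ hξ => ?_
  simp [ENNReal.toReal_ofReal (density_pos g hξ).le]

/-- Near `x` the density is bounded and the chart image lies in a unit ball. This makes continuous
functions of compact support integrable. -/
instance isLocallyFiniteMeasure_riemannianVolume :
    IsLocallyFiniteMeasure (riemannianVolume g) := by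
  refine ⟨fun x => ?_⟩
  have hx : x ∈ (extChartAt I x).source := mem_extChartAt_source x
  have ht := (extChartAt I x).map_source hx
  have hc := (contDiffOn_density g x).continuousOn _ ht
  obtain ⟨V, hV, hxV, hVs⟩ := mem_nhdsWithin.1
    (hc.eventually_lt continuousWithinAt_const (lt_add_one (density g x (extChartAt I x x))))
  set O := V ∩ Metric.ball (extChartAt I x x) 1
  have hO : O ∈ 𝓝 (extChartAt I x x) :=
    Filter.inter_mem (hV.mem_nhds hxV) (Metric.ball_mem_nhds _ one_pos)
  have hU : (chartAt H x).source ∩ extChartAt I x ⁻¹' O ∈ 𝓝 x :=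
    Filter.inter_mem ((chartAt H x).open_source.mem_nhds (mem_chart_source H x))
      ((continuousAt_extChartAt x).preimage_mem_nhds hO)
  obtain ⟨W, hWU, hW, hxW⟩ := mem_nhds_iff.1 hU
  refine ⟨W, hW.mem_nhds hxW, ?_⟩
  have h1 : riemannianVolume g W = chartVolume g x W := by
    rw [← riemannianVolume_restrict, Measure.restrict_apply hW.measurableSet,
      inter_eq_self_of_subset_left (hWU.trans inter_subset_left)]
  rw [h1, chartVolume_apply g x hW.measurableSet]
  have hsub : ∀ ξ ∈ (extChartAt I x).target ∩ (extChartAt I x).symm ⁻¹' W, ξ ∈ O := fun ξ hξ => by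
    have := (hWU hξ.2).2
    rwa [mem_preimage, (extChartAt I x).right_inv hξ.1] at this
  calc ∫⁻ ξ in (extChartAt I x).target ∩ (extChartAt I x).symm ⁻¹' W,
        ENNReal.ofReal (density g x ξ)
      ≤ ∫⁻ _ in (extChartAt I x).target ∩ (extChartAt I x).symm ⁻¹' W,
        ENNReal.ofReal (density g x (extChartAt I x x) + 1) := by
        refine setLIntegral_mono' (measurableSet_target_inter x hW.measurableSet) fun ξ hξ => ?_
        exact ENNReal.ofReal_le_ofReal (hVs ⟨(hsub ξ hξ).1, hξ.1⟩ : density g x ξ < _).le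
    _ < ⊤ := by
        rw [setLIntegral_const]
        refine ENNReal.mul_lt_top ENNReal.ofReal_lt_top ((measure_mono fun ξ hξ => ?_).trans_lt
          (measure_ball_lt_top (x := extChartAt I x x) (r := 1)))
        exact (hsub ξ hξ).2

end Volume

/-! ### Divergence of vector fields and the divergence theorem. -/

noncomputable section VectorFields

theorem integrableOn_fderivWithin {E : Type*} [NormedAddCommGroup E] [NormedSpace ℝ E]
    [MeasurableSpace E] [BorelSpace E] (μ : Measure E)
    [IsFiniteMeasureOnCompacts μ] {C K : Set E} {Y : E → ℝ} (hC : IsClosed C)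
    (hu : UniqueDiffOn ℝ C) (hY : ContDiffOn ℝ 1 Y C) (hK : IsCompact K)
    (hYK : ∀ x ∈ C, x ∉ K → Y x = 0) (v : E) :
    IntegrableOn (fun x => fderivWithin ℝ Y C x v) C μ := by
  have hcont : ContinuousOn (fun x => fderivWithin ℝ Y C x v) C :=
    (hY.continuousOn_fderivWithin hu le_rfl).clm_apply continuousOn_const
  have hzero : ∀ x ∈ C, x ∉ K → fderivWithin ℝ Y C x v = 0 := fun x hx hxK => by
    have e : Y =ᶠ[𝓝[C] x] fun _ => (0 : ℝ) := by
      filter_upwards [self_mem_nhdsWithin, mem_nhdsWithin_of_mem_nhds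
        (hK.isClosed.isOpen_compl.mem_nhds hxK)] with z hz hzK using hYK z hz hzK
    rw [e.fderivWithin_eq (hYK x hx hxK)]
    simp
  have h1 : IntegrableOn (fun x => fderivWithin ℝ Y C x v) (C ∩ K) μ :=
    (hcont.mono inter_subset_left).integrableOn_compact (hK.inter_left hC)
  exact h1.of_forall_sdiff_eq_zero hC.measurableSet fun x hx =>
    hzero x hx.1 fun hxK => hx.2 ⟨hx.1, hxK⟩

variable {d : ℕ} {H : Type*} [TopologicalSpace H]
  {I : ModelWithCorners ℝ (EuclideanSpace ℝ (Fin d)) H}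
  {X : Type*} [TopologicalSpace X] [ChartedSpace H X] [IsManifold I ∞ X]
  (g : Bundle.ContMDiffRiemannianMetric I ∞ (EuclideanSpace ℝ (Fin d))
    (fun x : X => TangentSpace I x))
  {x₀ x₁ q : X}

/-- The coordinates of a vector field in the chart at `x₀`. -/
def fieldComp (x₀ : X) (w : ∀ x : X, TangentSpace I x) (ξ : EuclideanSpace ℝ (Fin d)) :
    EuclideanSpace ℝ (Fin d) :=
  compMap I x₀ ((extChartAt I x₀).symm ξ) (w ((extChartAt I x₀).symm ξ))

/-- A vector field with smooth coordinates. -/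
def IsSmoothField (w : ∀ x : X, TangentSpace I x) : Prop :=
  ∀ x₀, ContDiffOn ℝ ∞ (fieldComp x₀ w) (extChartAt I x₀).target

/-- The divergence of a vector field. -/
def divergence (w : ∀ x : X, TangentSpace I x) (x : X) : ℝ :=
  localDiv (range I) (density g x) (fieldComp x w) (extChartAt I x x)

theorem exists_isOpen_target (x₀ : X) :
    ∃ U : Set (EuclideanSpace ℝ (Fin d)), IsOpen U ∧ (extChartAt I x₀).target = range I ∩ U := by
  obtain ⟨U, hU, h⟩ := isOpen_preimage_target (I := I) x₀ isOpen_univ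
  exact ⟨U, hU, by rwa [preimage_univ, inter_univ] at h⟩

theorem exists_isOpen_overlap (x₀ x₁ : X) :
    ∃ U : Set (EuclideanSpace ℝ (Fin d)), IsOpen U ∧ overlap I x₀ x₁ = range I ∩ U :=
  isOpen_preimage_target (I := I) x₀ (isOpen_extChartAt_source x₁)

theorem subset_closure_interior_inter {E : Type*} [TopologicalSpace E] {C U : Set E}
    (hC : C ⊆ closure (interior C)) (hU : IsOpen U) : C ∩ U ⊆ closure (interior (C ∩ U)) := by
  rw [interior_inter, hU.interior_eq]
  exact fun x hx => hU.closure_inter ⟨hC hx.1, hx.2⟩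

theorem localDiv_inter {C U : Set (EuclideanSpace ℝ (Fin d))} (hU : IsOpen U)
    {ρ : EuclideanSpace ℝ (Fin d) → ℝ} {w : EuclideanSpace ℝ (Fin d) → EuclideanSpace ℝ (Fin d)}
    {ξ : EuclideanSpace ℝ (Fin d)} (hξ : ξ ∈ U) : localDiv (C ∩ U) ρ w ξ = localDiv C ρ w ξ := by
  rw [localDiv, localDiv, fderivWithin_inter (hU.mem_nhds hξ)]

variable {w : ∀ x : X, TangentSpace I x}

/-- The divergence of a smooth vector field can be computed in any chart. -/
theorem divergence_eq (hw : IsSmoothField w) (hq : q ∈ (chartAt H x₀).source) :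
    divergence g w q = localDiv (range I) (density g x₀) (fieldComp x₀ w) (extChartAt I x₀ q) := by
  have hq' : q ∈ (extChartAt I x₀).source := by simpa using hq
  have hq₁ : q ∈ (extChartAt I q).source := mem_extChartAt_source q
  obtain ⟨U, hU, hUeq⟩ := exists_isOpen_overlap (I := I) x₀ q
  obtain ⟨U', hU', hU'eq⟩ := exists_isOpen_target (I := I) q
  have hξ : extChartAt I x₀ q ∈ overlap I x₀ q := by
    refine ⟨(extChartAt I x₀).map_source hq', ?_⟩
    rwa [mem_preimage, (extChartAt I x₀).left_inv hq']
  have hκ : transition I x₀ q (extChartAt I x₀ q) = extChartAt I q q := by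
    rw [transition, Function.comp_apply, (extChartAt I x₀).left_inv hq']
  have hD : ∀ ξ ∈ overlap I x₀ q, fderivWithin ℝ (transition I x₀ q) (overlap I x₀ q) ξ =
      fderivWithin ℝ (transition I x₀ q) (range I) ξ := fun ξ hξ => by
    have : ξ ∈ U := (hUeq ▸ hξ : ξ ∈ range I ∩ U).2
    rw [hUeq, fderivWithin_inter (hU.mem_nhds this)]
  have hξU : extChartAt I x₀ q ∈ U := (hUeq ▸ hξ : _ ∈ range I ∩ U).2
  have hηU : extChartAt I q q ∈ U' :=
    (hU'eq ▸ (extChartAt I q).map_source hq₁ : _ ∈ range I ∩ U').2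
  -- `localDiv_transform` wants a map between two fixed sets, so `range I` is cut down to the
  -- overlap on one side and to the chart target on the other; both cuts are relatively open.
  rw [divergence, ← hκ, ← localDiv_inter hU' (hκ.symm ▸ hηU), ← localDiv_inter hU hξU, ← hUeq,
    ← hU'eq]
  have hUS : UniqueDiffOn ℝ (overlap I x₀ q) := hUeq ▸ I.uniqueDiffOn.inter hU
  have hUS' : UniqueDiffOn ℝ (extChartAt I q).target := hU'eq ▸ I.uniqueDiffOn.inter hU'
  refine localDiv_transform (Ji := (compMap I x₀ q).comp (frameMap I q q)) hUS ?_ hUS'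
    (contDiffOn_transition x₀ q)
    (fun ξ hξ => (extChartAt I q).map_source hξ.2)
    (((contDiffOn_density g x₀).differentiableOn (by simp)).mono inter_subset_left)
    (((hw x₀).differentiableOn (by simp)).mono inter_subset_left)
    ((contDiffOn_density g q).differentiableOn (by simp))
    ((hw q).differentiableOn (by simp)) ?_ ?_ hξ
    (density_pos g hξ.1).ne' ?_
  · rw [hUeq]
    exact subset_closure_interior_inter I.range_subset_closure_interior hU
  · intro ξ hξ
    rw [hD ξ hξ, fderivWithin_transition hξ, fieldComp, fieldComp,
      frameMap_compMap (symm_mem_source hξ.1), transition, Function.comp_apply,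
      (extChartAt I q).left_inv hξ.2]
  · intro ξ hξ
    rw [hD ξ hξ]
    exact density_transition g hξ
  · ext1 v
    rw [hD _ hξ, ContinuousLinearMap.comp_apply, fderivWithin_transition hξ,
      (extChartAt I x₀).left_inv hq', ContinuousLinearMap.comp_apply, frameMap_compMap hq,
      compMap_frameMap (mem_chart_source H q), ContinuousLinearMap.id_apply]

theorem continuousOn_localDiv {S : Set (EuclideanSpace ℝ (Fin d))} (hS : UniqueDiffOn ℝ S)
    {ρ : EuclideanSpace ℝ (Fin d) → ℝ} {w : EuclideanSpace ℝ (Fin d) → EuclideanSpace ℝ (Fin d)}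
    (hρ : ContDiffOn ℝ ∞ ρ S) (hw : ContDiffOn ℝ ∞ w S) (h0 : ∀ ξ ∈ S, ρ ξ ≠ 0) :
    ContinuousOn (localDiv S ρ w) S := by
  refine (hρ.continuousOn.inv₀ h0).mul ?_
  have h1 := (hρ.smul hw).continuousOn_fderivWithin hS (by simp)
  simp only [trace_eq_sum]
  refine continuousOn_finsetSum _ fun i _ => ?_
  exact (EuclideanSpace.proj (𝕜 := ℝ) i).continuous.comp_continuousOn
    (h1.clm_apply continuousOn_const)

theorem continuous_of_forall_continuousOn_chart {Z : Type*} [TopologicalSpace Z] {φ : X → Z}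
    (h : ∀ x₀ : X, ContinuousOn (fun ξ => φ ((extChartAt I x₀).symm ξ)) (extChartAt I x₀).target) :
    Continuous φ := by
  refine continuous_iff_continuousAt.2 fun x => ?_
  have hn : (extChartAt I x).source ∈ 𝓝 x := extChartAt_source_mem_nhds x
  have h1 : ContinuousOn φ (extChartAt I x).source :=
    ((h x).comp (continuousOn_extChartAt x) (extChartAt I x).mapsTo).congr fun z hz => by
      rw [Function.comp_apply, (extChartAt I x).left_inv hz]
  exact h1.continuousAt hn

theorem continuous_divergence (hw : IsSmoothField w) : Continuous (divergence g w) := by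
  refine continuous_of_forall_continuousOn_chart (I := I) fun x₀ => ?_
  obtain ⟨U, hU, hUeq⟩ := exists_isOpen_target (I := I) x₀
  have hS : UniqueDiffOn ℝ (extChartAt I x₀).target := hUeq ▸ I.uniqueDiffOn.inter hU
  refine (continuousOn_localDiv hS (contDiffOn_density g x₀) (hw x₀)
    fun ξ hξ => (density_pos g hξ).ne').congr fun ξ hξ => ?_
  rw [divergence_eq g hw (symm_mem_source hξ), (extChartAt I x₀).right_inv hξ]
  have : ξ ∈ U := (hUeq ▸ hξ : ξ ∈ range I ∩ U).2
  rw [hUeq, localDiv_inter hU this]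

theorem divergence_eq_zero {K : Set X} (hK : IsClosed K) (hwK : ∀ x ∉ K, w x = 0) {x : X}
    (hx : x ∉ K) : divergence g w x = 0 := by
  have h1 : ∀ᶠ ξ in 𝓝[range I] (extChartAt I x x), fieldComp x w ξ = 0 := by
    have h2 : Filter.Tendsto (extChartAt I x).symm (𝓝[range I] (extChartAt I x x)) (𝓝 x) := by
      have := (continuousAt_extChartAt_symm (I := I) x).tendsto
      rw [extChartAt_to_inv] at this
      exact this.mono_left nhdsWithin_le_nhds
    filter_upwards [h2 (hK.isOpen_compl.mem_nhds hx)] with ξ hξ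
    rw [fieldComp, hwK _ hξ, map_zero]
  have h3 : (fun ξ => density g x ξ • fieldComp x w ξ) =ᶠ[𝓝[range I] (extChartAt I x x)]
      fun _ => 0 := by
    filter_upwards [h1] with ξ hξ
    rw [hξ, smul_zero]
  rw [divergence, localDiv, h3.fderivWithin_eq (h3.self_of_nhdsWithin (mem_range_self _))]
  simp

/-- Being an interior point can be tested in any chart of the atlas, so an interior point has its
coordinates in the interior of the target and hence of `range I`. -/
theorem mem_boundary_of_mem_frontier {ξ : EuclideanSpace ℝ (Fin d)}
    (hξ : ξ ∈ (extChartAt I x₀).target) (hf : ξ ∈ frontier (range I)) :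
    (extChartAt I x₀).symm ξ ∈ I.boundary X := by
  refine (I.isBoundaryPoint_iff_not_isInteriorPoint _).2 fun hi => ?_
  have h1 := (I.isInteriorPoint_iff_of_mem_atlas (n := ∞) (by simp) (chart_mem_atlas H x₀)
    (symm_mem_source hξ)).1 hi
  have h2 : extChartAt I x₀ ((extChartAt I x₀).symm ξ) ∈ interior (extChartAt I x₀).target := h1
  rw [(extChartAt I x₀).right_inv hξ] at h2
  exact hf.2 (interior_mono (extChartAt_target_subset_range x₀) h2)

variable [T2Space X] [MeasurableSpace X] [BorelSpace X]

/-- The divergence theorem for a vector field supported in a chart. -/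
theorem integral_divergence_of_subset_source (hw : IsSmoothField w) {K : Set X}
    (hK : IsCompact K) (hKs : K ⊆ (chartAt H x₀).source) (hwK : ∀ x ∉ K, w x = 0)
    (hb : ∀ x ∈ I.boundary X, w x = 0) : ∫ x, divergence g w x ∂riemannianVolume g = 0 := by
  have hKs' : K ⊆ (extChartAt I x₀).source := by simpa using hKs
  rw [← setIntegral_eq_integral_of_forall_compl_eq_zero (s := (chartAt H x₀).source)
    fun x hx => divergence_eq_zero g hK.isClosed hwK fun h => hx (hKs h),
    setIntegral_source g x₀ (continuous_divergence g hw).continuousOn]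
  set C := range I
  set T := (extChartAt I x₀).target
  obtain ⟨U, hU, hUeq⟩ := exists_isOpen_target (I := I) x₀
  change T = C ∩ U at hUeq
  set K' := extChartAt I x₀ '' K
  have hK' : IsCompact K' := hK.image_of_continuousOn ((continuousOn_extChartAt x₀).mono hKs')
  have hK'T : K' ⊆ T := by
    rintro _ ⟨x, hx, rfl⟩
    exact (extChartAt I x₀).map_source (hKs' hx)
  set Z : EuclideanSpace ℝ (Fin d) → EuclideanSpace ℝ (Fin d) :=
    fun ξ => density g x₀ ξ • fieldComp x₀ w ξ
  have hZ : ContDiffOn ℝ ∞ Z T := (contDiffOn_density g x₀).smul (hw x₀)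
  have hZK : ∀ ξ ∈ T, ξ ∉ K' → Z ξ = 0 := fun ξ hξ hξK => by
    have : (extChartAt I x₀).symm ξ ∉ K := fun h =>
      hξK ⟨_, h, (extChartAt I x₀).right_inv hξ⟩
    simp only [Z, fieldComp, hwK _ this, map_zero, smul_zero]
  -- The components of `√|g| w`, extended by zero from the chart target to all of `range I`. They
  -- stay `C¹` because their support lies in the compact set `K'` inside the target.
  set Y : Fin d → EuclideanSpace ℝ (Fin d) → ℝ := fun i => T.indicator fun ξ => Z ξ i
  have hYK : ∀ i, ∀ ξ ∈ C, ξ ∉ K' → Y i ξ = 0 := fun i ξ _ hξK => by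
    by_cases hξ : ξ ∈ T
    · simp [Y, hξ, hZK ξ hξ hξK]
    · simp [Y, hξ]
  have hYe : ∀ i, ∀ ξ ∈ T, Y i =ᶠ[𝓝[C] ξ] fun ξ => Z ξ i := fun i ξ hξ => by
    have hT : T ∈ 𝓝[C] ξ := by
      rw [hUeq] at hξ ⊢
      exact Filter.inter_mem self_mem_nhdsWithin (mem_nhdsWithin_of_mem_nhds (hU.mem_nhds hξ.2))
    filter_upwards [hT] with η hη using by simp [Y, hη]
  have hY : ∀ i, ContDiffOn ℝ 1 (Y i) C := fun i ξ hξ => by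
    by_cases hξT : ξ ∈ T
    · have h1 : ContDiffWithinAt ℝ 1 (fun ξ => Z ξ i) T ξ :=
        ((EuclideanSpace.proj (𝕜 := ℝ) i).contDiff.comp_contDiffOn (hZ.of_le (by simp))) ξ hξT
      have h2 : ContDiffWithinAt ℝ 1 (fun ξ => Z ξ i) C ξ := by
        rw [hUeq] at h1 hξT
        exact (contDiffWithinAt_inter (hU.mem_nhds hξT.2)).1 h1
      exact h2.congr_of_eventuallyEq (hYe i ξ hξT) (by simp [Y, hξT])
    · have h1 : Y i =ᶠ[𝓝[C] ξ] fun _ => (0 : ℝ) := by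
        filter_upwards [self_mem_nhdsWithin, mem_nhdsWithin_of_mem_nhds
          (hK'.isClosed.isOpen_compl.mem_nhds fun h => hξT (hK'T h))] with η hη hηK
          using hYK i η hη hηK
      exact contDiffWithinAt_const.congr_of_eventuallyEq h1 (h1.self_of_nhdsWithin hξ)
  -- Frontier points inside the target are boundary points of the manifold, where `w` vanishes;
  -- outside the target `Y i` is zero by construction.
  have hYf : ∀ i, ∀ ξ ∈ frontier C, Y i ξ = 0 := fun i ξ hξ => by
    by_cases hξT : ξ ∈ T
    · simp only [Y, indicator_of_mem hξT, Z, fieldComp, hb _ (mem_boundary_of_mem_frontier hξT hξ),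
        map_zero, smul_zero, PiLp.zero_apply]
    · simp [Y, hξT]
  -- The volume density cancels the factor `1/√|g|` of the divergence, leaving a plain sum of
  -- partial derivatives.
  have hsum : EqOn (fun ξ => density g x₀ ξ * divergence g w ((extChartAt I x₀).symm ξ))
      (fun ξ => ∑ i, fderivWithin ℝ (Y i) C ξ (EuclideanSpace.single i 1)) T := fun ξ hξ => by
    simp only
    rw [divergence_eq g hw (symm_mem_source hξ), (extChartAt I x₀).right_inv hξ, localDiv,
      mul_inv_cancel_left₀ (density_pos g hξ).ne', trace_eq_sum]
    refine Finset.sum_congr rfl fun i _ => ?_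
    have hξC : ξ ∈ C := extChartAt_target_subset_range x₀ hξ
    have hd : DifferentiableWithinAt ℝ Z C ξ := by
      have h1 := hZ.differentiableOn (by simp) ξ hξ
      rw [hUeq] at h1 hξ
      exact (differentiableWithinAt_inter (hU.mem_nhds hξ.2)).1 h1
    rw [(hYe i ξ hξ).fderivWithin_eq (by simp [Y, hξ])]
    have h2 : HasFDerivWithinAt (fun ξ => Z ξ i)
        ((EuclideanSpace.proj (𝕜 := ℝ) i).comp (fderivWithin ℝ Z C ξ)) C ξ :=
      (EuclideanSpace.proj (𝕜 := ℝ) i).hasFDerivAt.comp_hasFDerivWithinAt ξ hd.hasFDerivWithinAt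
    rw [h2.fderivWithin (I.uniqueDiffOn ξ hξC)]
    rfl
  rw [setIntegral_congr_fun (measurableSet_target x₀) hsum]
  have hzero : ∀ ξ ∈ C \ T, ∑ i, fderivWithin ℝ (Y i) C ξ (EuclideanSpace.single i 1) = 0 :=
    fun ξ hξ => Finset.sum_eq_zero fun i _ => by
      have h1 : Y i =ᶠ[𝓝[C] ξ] fun _ => (0 : ℝ) := by
        filter_upwards [self_mem_nhdsWithin, mem_nhdsWithin_of_mem_nhds
          (hK'.isClosed.isOpen_compl.mem_nhds fun h => hξ.2 (hK'T h))] with η hη hηK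
          using hYK i η hη hηK
      rw [h1.fderivWithin_eq (h1.self_of_nhdsWithin hξ.1)]
      simp
  rw [← setIntegral_eq_of_subset_of_forall_sdiff_eq_zero (measurableSet_range I)
    (extChartAt_target_subset_range x₀) hzero, integral_finsetSum]
  · exact Finset.sum_eq_zero fun i _ => setIntegral_fderivWithin_eq_zero volume I.isClosed_range
      I.convex_range I.uniqueDiffOn (hY i) hK' (hYK i) (hYf i) _
  · exact fun i _ => integrableOn_fderivWithin volume I.isClosed_range I.uniqueDiffOn (hY i) hK'
      (hYK i) _

theorem fieldComp_smul (ρ : X → ℝ) (w : ∀ x : X, TangentSpace I x)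
    (ξ : EuclideanSpace ℝ (Fin d)) :
    fieldComp x₀ (fun x => ρ x • w x) ξ =
      ρ ((extChartAt I x₀).symm ξ) • fieldComp x₀ w ξ := by
  simp only [fieldComp, map_smul]

theorem IsSmoothField.smul (hw : IsSmoothField w) {ρ : X → ℝ} (hρ : ContMDiff I 𝓘(ℝ, ℝ) ∞ ρ) :
    IsSmoothField fun x => ρ x • w x := fun x₀ => by
  refine ContDiffOn.congr ?_ fun ξ _ => fieldComp_smul ρ w ξ
  exact (contDiffOn_comp_extChartAt_symm hρ.contMDiffOn).smul (hw x₀)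

theorem divergence_sum {ι : Type*} (s : Finset ι) {v : ι → ∀ x : X, TangentSpace I x}
    (hv : ∀ i, IsSmoothField (v i)) (hw : ∀ x, w x = ∑ i ∈ s, v i x) (x : X) :
    divergence g w x = ∑ i ∈ s, divergence g (v i) x := by
  obtain ⟨U, hU, hUeq⟩ := exists_isOpen_target (I := I) x
  have hξ := (extChartAt I x).map_source (mem_extChartAt_source (I := I) x)
  have hξU : extChartAt I x x ∈ U := (hUeq ▸ hξ : _ ∈ range I ∩ U).2
  have e : (fun ξ => density g x ξ • fieldComp x w ξ) =
      fun ξ => ∑ i ∈ s, density g x ξ • fieldComp x (v i) ξ := by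
    ext1 ξ
    simp only [fieldComp, hw, map_sum, Finset.smul_sum]
  have hd : ∀ i, DifferentiableWithinAt ℝ (fun ξ => density g x ξ • fieldComp x (v i) ξ) (range I)
      (extChartAt I x x) := fun i => by
    have h1 := ((contDiffOn_density g x).smul (hv i x)).differentiableOn (by simp) _ hξ
    rw [hUeq] at h1
    exact (differentiableWithinAt_inter (hU.mem_nhds hξU)).1 h1
  simp only [divergence, localDiv, e]
  rw [fderivWithin_fun_sum (I.uniqueDiffOn _ (extChartAt_target_subset_range x hξ)) fun i _ => hd i,
    ContinuousLinearMap.toLinearMap_sum, map_sum, Finset.mul_sum]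

/-- The divergence theorem for a compactly supported vector field vanishing on the boundary. -/
theorem integral_divergence_eq_zero [SecondCountableTopology X] (hw : IsSmoothField w) {K : Set X}
    (hK : IsCompact K) (hwK : ∀ x ∉ K, w x = 0) (hb : ∀ x ∈ I.boundary X, w x = 0) :
    ∫ x, divergence g w x ∂riemannianVolume g = 0 := by
  have : LocallyCompactSpace H := I.locallyCompactSpace
  have : LocallyCompactSpace X := ChartedSpace.locallyCompactSpace H X
  -- By local finiteness only finitely many members of the partition meet `K`, so `w` is a finite
  -- sum of fields each supported in one chart domain; the factor `ρ i` keeps the boundary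
  -- condition.
  obtain ⟨ρ, hρ⟩ := SmoothPartitionOfUnity.exists_isSubordinate_chartAt_source I X
  have hfin := ρ.locallyFinite.finite_nonempty_inter_compact hK
  set s := hfin.toFinset
  set v : X → ∀ x : X, TangentSpace I x := fun i x => ρ i x • w x
  have hv : ∀ i, IsSmoothField (v i) := fun i => hw.smul (ρ i).contMDiff
  have hwv : ∀ x, w x = ∑ i ∈ s, v i x := fun x => by
    by_cases hx : x ∈ K
    · have h1 : ∑ i ∈ s, ρ i x = 1 := by
        rw [← ρ.sum_eq_one (mem_univ x)]
        refine (finsum_eq_sum_of_support_subset _ fun i hi => ?_).symm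
        simp only [s, Finite.coe_toFinset, mem_ofPred_eq]
        exact ⟨x, hi, hx⟩
      simp only [v]
      rw [← Finset.sum_smul, h1, one_smul]
    · simp [v, hwK x hx]
  have hvK : ∀ i, ∀ x ∉ K ∩ tsupport (ρ i), v i x = 0 := fun i x hx => by
    by_cases hxK : x ∈ K
    · have : ρ i x = 0 := by
        by_contra h
        exact hx ⟨hxK, subset_tsupport _ h⟩
      simp only [v, this, zero_smul]
    · simp only [v, hwK x hxK, smul_zero]
  have hKi : ∀ i, IsCompact (K ∩ tsupport (ρ i)) := fun i =>
    hK.inter_right (isClosed_tsupport _)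
  rw [integral_congr_ae (Filter.Eventually.of_forall (divergence_sum g s hv hwv)),
    integral_finsetSum]
  · exact Finset.sum_eq_zero fun i _ => integral_divergence_of_subset_source g (hv i) (hKi i)
      (inter_subset_right.trans (hρ i)) (hvK i) fun x hx => by simp [v, hb x hx]
  · exact fun i _ => (continuous_divergence g (hv i)).integrable_of_hasCompactSupport
      (HasCompactSupport.intro (hKi i) fun x hx =>
        divergence_eq_zero g (hKi i).isClosed (hvK i) hx)

end VectorFields

/-! ### The metric and Christoffel symbols of the target in a chart. -/

noncomputable section Target

variable {n : ℕ}

theorem eq_of_isLinearMap_of_single {F F' : EuclideanSpace ℝ (Fin n) → ℝ}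
    (hF : IsLinearMap ℝ F) (hF' : IsLinearMap ℝ F')
    (h : ∀ i, F (EuclideanSpace.single i 1) = F' (EuclideanSpace.single i 1))
    (v : EuclideanSpace ℝ (Fin n)) : F v = F' v := by
  have h1 : hF.mk' = hF'.mk' := by
    refine (EuclideanSpace.basisFun (Fin n) ℝ).toBasis.ext fun i => ?_
    simpa using h i
  exact congrArg (fun L : EuclideanSpace ℝ (Fin n) →ₗ[ℝ] ℝ => L v) h1

theorem contDiffOn_smul_vector {A F : Type*} [NormedAddCommGroup A] [NormedSpace ℝ A]
    [NormedAddCommGroup F] [NormedSpace ℝ F] {φ : A → ℝ} {s : Set A} (hφ : ContDiffOn ℝ ∞ φ s)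
    (c : F) : ContDiffOn ℝ ∞ (fun x => φ x • c) s := hφ.smul contDiffOn_const

variable
  {N : Type*} [TopologicalSpace N]
  [ChartedSpace (EuclideanSpace ℝ (Fin n)) N] [IsManifold (𝓡 n) ∞ N]
  (h : Bundle.ContMDiffRiemannianMetric (𝓡 n) ∞ (EuclideanSpace ℝ (Fin n))
    (fun y : N => TangentSpace (𝓡 n) y))
  {y₀ y₁ y : N}

local notation "V" => EuclideanSpace ℝ (Fin n)

/-- The metric in the chart at `y₀`. -/
def chartMetric (y₀ : N) (η : V) : V →L[ℝ] V →L[ℝ] ℝ :=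
  ∑ i, ∑ j, metricMatrix h y₀ ((extChartAt (𝓡 n) y₀).symm η) i j •
    (EuclideanSpace.proj (𝕜 := ℝ) i : V →L[ℝ] ℝ).smulRight
      (EuclideanSpace.proj (𝕜 := ℝ) j : V →L[ℝ] ℝ)

/-- The Christoffel symbols in the chart at `y₀`. -/
def chartChristoffel (y₀ : N) (η : V) : V →L[ℝ] V →L[ℝ] V :=
  ∑ k, ∑ i, ∑ j, christoffel h y₀ k i j ((extChartAt (𝓡 n) y₀).symm η) •
    (EuclideanSpace.proj (𝕜 := ℝ) i : V →L[ℝ] ℝ).smulRight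
      ((EuclideanSpace.proj (𝕜 := ℝ) j : V →L[ℝ] ℝ).smulRight (EuclideanSpace.single k (1 : ℝ)))

theorem chartMetric_apply (η u v : V) : chartMetric h y₀ η u v =
    ∑ i, ∑ j, metricMatrix h y₀ ((extChartAt (𝓡 n) y₀).symm η) i j * (u i * v j) := by
  simp [chartMetric]

theorem chartChristoffel_apply (η u v : V) (k : Fin n) : chartChristoffel h y₀ η u v k =
    ∑ i, ∑ j, christoffel h y₀ k i j ((extChartAt (𝓡 n) y₀).symm η) * (u i * v j) := by
  simp [chartChristoffel, Finset.sum_apply, Pi.single_apply]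

theorem chartMetric_single (η : V) (i j : Fin n) :
    chartMetric h y₀ η (EuclideanSpace.single i 1) (EuclideanSpace.single j 1) =
      metricMatrix h y₀ ((extChartAt (𝓡 n) y₀).symm η) i j := by
  simp [chartMetric_apply]

theorem chartChristoffel_single (η : V) (i j k : Fin n) :
    chartChristoffel h y₀ η (EuclideanSpace.single i 1) (EuclideanSpace.single j 1) k =
      christoffel h y₀ k i j ((extChartAt (𝓡 n) y₀).symm η) := by
  simp [chartChristoffel_apply]

theorem chartMetric_compMap (hy : y ∈ (chartAt V y₀).source) (u v : TangentSpace (𝓡 n) y) :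
    chartMetric h y₀ (extChartAt (𝓡 n) y₀ y) (compMap (𝓡 n) y₀ y u) (compMap (𝓡 n) y₀ y v) =
      h.inner y u v := by
  rw [chartMetric_apply, (extChartAt (𝓡 n) y₀).left_inv (by simpa using hy),
    ← inner_sum_coordVec, ← frameMap_eq_sum hy, ← frameMap_eq_sum hy, frameMap_compMap hy,
    frameMap_compMap hy]

theorem isOpen_target (y₀ : N) : IsOpen (extChartAt (𝓡 n) y₀).target :=
  isOpen_extChartAt_target y₀

/-- Coordinate partial derivatives are partial derivatives in the chart. -/
theorem partialDeriv_symm {φ : N → ℝ} {η : V} (hη : η ∈ (extChartAt (𝓡 n) y₀).target)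
    (hφ : MDifferentiableAt (𝓡 n) 𝓘(ℝ, ℝ) φ ((extChartAt (𝓡 n) y₀).symm η)) (i : Fin n) :
    partialDeriv (𝓡 n) y₀ i φ ((extChartAt (𝓡 n) y₀).symm η) =
      fderiv ℝ (fun η => φ ((extChartAt (𝓡 n) y₀).symm η)) η (EuclideanSpace.single i 1) := by
  have hs := symm_mem_source hη
  have := mfderiv_frameMap hs hφ (EuclideanSpace.single i 1)
  rw [frameMap_single hs, (extChartAt (𝓡 n) y₀).right_inv hη, ModelWithCorners.range_eq_univ,
    fderivWithin_univ] at this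
  exact this

theorem mdifferentiableAt_metricMatrix (hy : y ∈ (chartAt V y₀).source) (i j : Fin n) :
    MDifferentiableAt (𝓡 n) 𝓘(ℝ, ℝ) (fun p => metricMatrix h y₀ p i j) y :=
  ((contMDiffOn_metricMatrix h y₀ i j).contMDiffAt
    ((chartAt V y₀).open_source.mem_nhds hy)).mdifferentiableAt (by simp)

theorem contDiffOn_christoffel (y₀ : N) (k i j : Fin n) :
    ContDiffOn ℝ ∞ (fun η => christoffel h y₀ k i j ((extChartAt (𝓡 n) y₀).symm η))
      (extChartAt (𝓡 n) y₀).target := by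
  have h1 : ∀ a b c : Fin n, ContDiffOn ℝ ∞ (fun η => partialDeriv (𝓡 n) y₀ a
      (fun p => metricMatrix h y₀ p b c) ((extChartAt (𝓡 n) y₀).symm η))
      (extChartAt (𝓡 n) y₀).target := fun a b c => by
    refine ContDiffOn.congr ?_ fun η hη => partialDeriv_symm hη
      (mdifferentiableAt_metricMatrix h (symm_mem_source hη) b c) a
    exact ((contDiffOn_metricMatrix h y₀ b c).fderiv_of_isOpen (isOpen_target y₀)
      (by simp)).clm_apply contDiffOn_const
  refine contDiffOn_const.mul (ContDiffOn.sum fun l _ => ?_)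
  exact (contDiffOn_matrix_inv (fun a b => contDiffOn_metricMatrix h y₀ a b)
    (fun η hη => (metricMatrix_det_pos h (symm_mem_source hη)).ne') k l).mul
      (((h1 _ _ _).add (h1 _ _ _)).sub (h1 _ _ _))

/-- Lowering the index cancels the inverse metric and leaves the Christoffel symbols of the first
kind. -/
theorem sum_metricMatrix_mul_christoffel (hy : y ∈ (chartAt V y₀).source) (a b c : Fin n) :
    ∑ k, metricMatrix h y₀ y c k * christoffel h y₀ k a b y = (1 / 2) *
      (partialDeriv (𝓡 n) y₀ a (fun p => metricMatrix h y₀ p b c) y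
      + partialDeriv (𝓡 n) y₀ b (fun p => metricMatrix h y₀ p a c) y
      - partialDeriv (𝓡 n) y₀ c (fun p => metricMatrix h y₀ p a b) y) := by
  set S : Fin n → ℝ := fun l => partialDeriv (𝓡 n) y₀ a (fun p => metricMatrix h y₀ p b l) y
      + partialDeriv (𝓡 n) y₀ b (fun p => metricMatrix h y₀ p a l) y
      - partialDeriv (𝓡 n) y₀ l (fun p => metricMatrix h y₀ p a b) y
  have h1 : metricMatrix h y₀ y * (metricMatrix h y₀ y)⁻¹ = 1 :=
    Matrix.mul_nonsing_inv _ (metricMatrix_det_pos h hy).ne'.isUnit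
  have h2 : (metricMatrix h y₀ y).mulVec ((metricMatrix h y₀ y)⁻¹.mulVec S) c = S c := by
    rw [Matrix.mulVec_mulVec, h1, Matrix.one_mulVec]
  change _ = 1 / 2 * S c
  rw [← h2]
  simp only [Matrix.mulVec, dotProduct, christoffel, Finset.mul_sum]
  exact Finset.sum_congr rfl fun k _ => Finset.sum_congr rfl fun l _ => by
    simp only [S]
    ring

/-- The bridge from the coordinate formula for the Christoffel symbols to the axioms from which the
local calculus was derived. -/
theorem isLeviCivita_chart (y₀ : N) : IsLeviCivita (extChartAt (𝓡 n) y₀).target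
    (chartMetric h y₀) (chartChristoffel h y₀) := by
  have smM : ContDiffOn ℝ ∞ (chartMetric h y₀) (extChartAt (𝓡 n) y₀).target :=
    ContDiffOn.sum fun i _ => ContDiffOn.sum fun j _ =>
      contDiffOn_smul_vector (contDiffOn_metricMatrix h y₀ i j) _
  have symmM : ∀ η u v, chartMetric h y₀ η u v = chartMetric h y₀ η v u := fun η u v => by
    rw [chartMetric_apply, chartMetric_apply, Finset.sum_comm]
    refine Finset.sum_congr rfl fun i _ => Finset.sum_congr rfl fun j _ => ?_
    rw [(metricMatrix_isSymm h y₀ _).apply i j]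
    ring
  have symmP : ∀ (b c : Fin n), (fun p => metricMatrix h y₀ p b c) =
      fun p => metricMatrix h y₀ p c b := fun b c => by
    ext p
    exact (metricMatrix_isSymm h y₀ p).apply c b
  refine ⟨isOpen_target y₀, smM, ?_, fun η _ => symmM η, ?_, ?_, ?_⟩
  · exact ContDiffOn.sum fun k _ => ContDiffOn.sum fun i _ => ContDiffOn.sum fun j _ =>
      contDiffOn_smul_vector (contDiffOn_christoffel h y₀ k i j) _
  · intro η hη u hu
    have hs := symm_mem_source hη
    have h1 := chartMetric_compMap h hs (frameMap (𝓡 n) y₀ _ u) (frameMap (𝓡 n) y₀ _ u)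
    rw [compMap_frameMap hs, (extChartAt (𝓡 n) y₀).right_inv hη] at h1
    rw [h1]
    refine h.pos _ _ fun h0 => hu ?_
    rw [← compMap_frameMap (I := 𝓡 n) hs u, h0, map_zero]
  · intro η _ u v
    ext k
    rw [chartChristoffel_apply, chartChristoffel_apply, Finset.sum_comm]
    refine Finset.sum_congr rfl fun i _ => Finset.sum_congr rfl fun j _ => ?_
    have : christoffel h y₀ k j i = christoffel h y₀ k i j := by
      ext p
      simp only [christoffel, symmP i j]
      congr 1
      exact Finset.sum_congr rfl fun l _ => by ring
    rw [this]
    ring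
  · intro η hη w u v
    have hs := symm_mem_source hη
    -- Both sides of the compatibility identity are linear in each argument, so it is tested on
    -- basis vectors, one argument at a time.
    have lin3 : ∀ w u : V, IsLinearMap ℝ fun v => chartMetric h y₀ η (chartChristoffel h y₀ η w u) v
        + chartMetric h y₀ η u (chartChristoffel h y₀ η w v) := fun w u =>
      ⟨fun a b => by simp only [map_add]; ring, fun c a => by simp only [map_smul, smul_add]⟩
    have lin2 : ∀ w v : V, IsLinearMap ℝ fun u => chartMetric h y₀ η (chartChristoffel h y₀ η w u) v
        + chartMetric h y₀ η u (chartChristoffel h y₀ η w v) := fun w v =>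
      ⟨fun a b => by simp only [map_add, add_apply]; ring,
        fun c a => by simp only [map_smul, smul_add, FunLike.coe_smul, Pi.smul_apply]⟩
    have lin1 : ∀ u v : V, IsLinearMap ℝ fun w => chartMetric h y₀ η (chartChristoffel h y₀ η w u) v
        + chartMetric h y₀ η u (chartChristoffel h y₀ η w v) := fun u v =>
      ⟨fun a b => by simp only [map_add, add_apply]; ring,
        fun c a => by simp only [map_smul, smul_add, FunLike.coe_smul, Pi.smul_apply]⟩
    refine eq_of_isLinearMap_of_single (F := fun v => fderiv ℝ (chartMetric h y₀) η w u v)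
      ⟨fun a b => by simp, fun c a => by simp⟩ (lin3 w u) (fun c => ?_) v
    refine eq_of_isLinearMap_of_single (F := fun u => fderiv ℝ (chartMetric h y₀) η w u _)
      ⟨fun a b => by simp, fun c a => by simp⟩ (lin2 w _) (fun b => ?_) u
    refine eq_of_isLinearMap_of_single (F := fun w => fderiv ℝ (chartMetric h y₀) η w _ _)
      ⟨fun a b => by simp, fun c a => by simp⟩ (lin1 _ _) (fun a => ?_) w
    have dM : HasFDerivAt (chartMetric h y₀) (fderiv ℝ (chartMetric h y₀) η) η :=
      ((smM.contDiffAt ((isOpen_target y₀).mem_nhds hη)).differentiableAt (by simp)).hasFDerivAt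
    have e1 : fderiv ℝ (chartMetric h y₀) η (EuclideanSpace.single a 1) (EuclideanSpace.single b 1)
        (EuclideanSpace.single c 1) =
        partialDeriv (𝓡 n) y₀ a (fun p => metricMatrix h y₀ p b c)
          ((extChartAt (𝓡 n) y₀).symm η) := by
      rw [partialDeriv_symm hη (mdifferentiableAt_metricMatrix h hs b c)]
      have d1 := dM.clm_apply (hasFDerivAt_const (EuclideanSpace.single b (1 : ℝ)) η)
      have d2 := d1.clm_apply (hasFDerivAt_const (EuclideanSpace.single c (1 : ℝ)) η)
      simp only [chartMetric_single] at d2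
      rw [d2.fderiv]
      simp
    have e2 : ∀ b c : Fin n, chartMetric h y₀ η (chartChristoffel h y₀ η (EuclideanSpace.single a 1)
        (EuclideanSpace.single b 1)) (EuclideanSpace.single c 1) =
        ∑ k, metricMatrix h y₀ ((extChartAt (𝓡 n) y₀).symm η) c k *
          christoffel h y₀ k a b ((extChartAt (𝓡 n) y₀).symm η) := fun b c => by
      rw [chartMetric_apply]
      refine Finset.sum_congr rfl fun k _ => ?_
      rw [chartChristoffel_single, (metricMatrix_isSymm h y₀ _).apply]
      simp
    -- In the sum of the two lowered symbols the derivatives `∂_b g_ac` and `∂_c g_ab` cancel and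
    -- `∂_a g_bc` remains.
    rw [symmM η (EuclideanSpace.single b 1), e1, e2, e2, sum_metricMatrix_mul_christoffel h hs,
      sum_metricMatrix_mul_christoffel h hs, symmP c b]
    ring

end Target

/-! ### The pullback connection in an arbitrary chart of the target; curvature at the base point. -/

noncomputable section CovariantDerivative

variable {n : ℕ}
  {N : Type*} [TopologicalSpace N]
  [ChartedSpace (EuclideanSpace ℝ (Fin n)) N] [IsManifold (𝓡 n) ∞ N]
  (h : Bundle.ContMDiffRiemannianMetric (𝓡 n) ∞ (EuclideanSpace ℝ (Fin n))
    (fun y : N => TangentSpace (𝓡 n) y))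
  {y₀ y₁ y : N}

local notation "V" => EuclideanSpace ℝ (Fin n)

/-- Coordinates of tangent vectors of the target in the chart at `y₀`. -/
local notation "cmp" => compMap (𝓡 n)

theorem fderiv_transition {η : V} (hη : η ∈ overlap (𝓡 n) y₀ y₁) (v : V) :
    fderiv ℝ (transition (𝓡 n) y₀ y₁) η v =
      cmp y₁ ((extChartAt (𝓡 n) y₀).symm η) (frameMap (𝓡 n) y₀ ((extChartAt (𝓡 n) y₀).symm η) v) := by
  rw [← fderivWithin_transition hη, ModelWithCorners.range_eq_univ, fderivWithin_univ]

theorem mem_overlap (hy : y ∈ (chartAt V y₀).source) (hy₁ : y ∈ (chartAt V y₁).source) :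
    extChartAt (𝓡 n) y₀ y ∈ overlap (𝓡 n) y₀ y₁ := by
  have hs : y ∈ (extChartAt (𝓡 n) y₀).source := by simpa using hy
  refine ⟨(extChartAt (𝓡 n) y₀).map_source hs, ?_⟩
  rw [mem_preimage, (extChartAt (𝓡 n) y₀).left_inv hs]
  simpa using hy₁

theorem fderiv_transition_compMap (hy : y ∈ (chartAt V y₀).source)
    (hy₁ : y ∈ (chartAt V y₁).source) (v : TangentSpace (𝓡 n) y) :
    fderiv ℝ (transition (𝓡 n) y₀ y₁) (extChartAt (𝓡 n) y₀ y) (cmp y₀ y v) = cmp y₁ y v := by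
  have hs : y ∈ (extChartAt (𝓡 n) y₀).source := by simpa using hy
  rw [fderiv_transition (mem_overlap hy hy₁), (extChartAt (𝓡 n) y₀).left_inv hs,
    frameMap_compMap hy]

theorem isOpen_overlap (y₀ y₁ : N) : IsOpen (overlap (𝓡 n) y₀ y₁) := by
  obtain ⟨U, hU, h⟩ := exists_isOpen_overlap (I := 𝓡 n) y₀ y₁
  rw [h, ModelWithCorners.range_eq_univ, univ_inter]
  exact hU

/-- A transition map is an isometry of the two chart metrics, because both express `h`. -/
theorem christoffel_transition (hy : y ∈ (chartAt V y₀).source)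
    (hy₁ : y ∈ (chartAt V y₁).source) (u v : V) :
    fderiv ℝ (transition (𝓡 n) y₀ y₁) (extChartAt (𝓡 n) y₀ y)
        (chartChristoffel h y₀ (extChartAt (𝓡 n) y₀ y) u v) =
      fderiv ℝ (fderiv ℝ (transition (𝓡 n) y₀ y₁)) (extChartAt (𝓡 n) y₀ y) u v +
      chartChristoffel h y₁ (extChartAt (𝓡 n) y₁ y)
        (fderiv ℝ (transition (𝓡 n) y₀ y₁) (extChartAt (𝓡 n) y₀ y) u)
        (fderiv ℝ (transition (𝓡 n) y₀ y₁) (extChartAt (𝓡 n) y₀ y) v) := by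
  have hs : y ∈ (extChartAt (𝓡 n) y₀).source := by simpa using hy
  have hσ : transition (𝓡 n) y₀ y₁ (extChartAt (𝓡 n) y₀ y) = extChartAt (𝓡 n) y₁ y := by
    rw [transition, Function.comp_apply, (extChartAt (𝓡 n) y₀).left_inv hs]
  have := (isLeviCivita_chart h y₀).christoffel_transform (isLeviCivita_chart h y₁)
    (isOpen_overlap y₀ y₁) inter_subset_left (contDiffOn_transition y₀ y₁)
    (fun η hη => (extChartAt (𝓡 n) y₁).map_source hη.2) ?_ (mem_overlap hy hy₁) ?_ u v
  · rwa [hσ] at this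
  · intro η hη u v
    have hp := symm_mem_source hη.1
    have hp₁ : (extChartAt (𝓡 n) y₀).symm η ∈ (chartAt V y₁).source := by simpa using hη.2
    rw [fderiv_transition hη, fderiv_transition hη, transition, Function.comp_apply,
      chartMetric_compMap h hp₁, ← chartMetric_compMap h hp, compMap_frameMap hp,
      compMap_frameMap hp, (extChartAt (𝓡 n) y₀).right_inv hη.1]
  · intro v
    refine ⟨cmp y₀ y (frameMap (𝓡 n) y₁ y v), ?_⟩
    rw [fderiv_transition_compMap hy hy₁, compMap_frameMap hy₁]

variable {E : Type*} [NormedAddCommGroup E] [NormedSpace ℝ E]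
    {G : Type*} [TopologicalSpace G] {K : ModelWithCorners ℝ E G}
    {P : Type*} [TopologicalSpace P] [ChartedSpace G P] {u : P → N}
    {W : ∀ p : P, TangentSpace (𝓡 n) (u p)} {p : P}

/-- The derivative of a vector-valued map, as a vector. -/
def mderiv {F : Type*} [NormedAddCommGroup F] [NormedSpace ℝ F] (K : ModelWithCorners ℝ E G)
    (φ : P → F) (p : P) (w : TangentSpace K p) : F := mfderiv K 𝓘(ℝ, F) φ p w

/-- The covariant derivative can be computed in any chart. -/
theorem compMap_covDeriv (hu : MDifferentiableAt K (𝓡 n) u p)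
    (hp : u p ∈ (chartAt V y₀).source)
    (hW : MDifferentiableAt K 𝓘(ℝ, V) (fun q => cmp y₀ (u q) (W q)) p)
    (w : TangentSpace K p) :
    cmp y₀ (u p) (covDeriv h K u W p w) =
      mderiv K (fun q => cmp y₀ (u q) (W q)) p w +
      chartChristoffel h y₀ (extChartAt (𝓡 n) y₀ (u p))
        (mderiv K (extChartAt (𝓡 n) y₀ ∘ u) p w) (cmp y₀ (u p) (W p)) := by
  have hp₁ : u p ∈ (chartAt V (u p)).source := mem_chart_source V (u p)
  set σ := transition (𝓡 n) y₀ (u p) with hσ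
  set F₀ : P → V := extChartAt (𝓡 n) y₀ ∘ u with hF₀
  set W₀ : P → V := fun q => cmp y₀ (u q) (W q) with hW₀
  set W₁ : P → V := fun q => cmp (u p) (u q) (W q) with hW₁
  have dF₀ : MDifferentiableAt K 𝓘(ℝ, V) F₀ p :=
    (mdifferentiableAt_extChartAt hp).comp p hu
  have ev : ∀ᶠ q in 𝓝 p, u q ∈ (chartAt V y₀).source ∧ u q ∈ (chartAt V (u p)).source :=
    hu.continuousAt.eventually (Filter.Eventually.and
      ((chartAt V y₀).open_source.mem_nhds hp) ((chartAt V (u p)).open_source.mem_nhds hp₁))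
  have smσ : ContDiffAt ℝ ∞ σ (F₀ p) := (contDiffOn_transition y₀ (u p)).contDiffAt
    ((isOpen_overlap y₀ (u p)).mem_nhds (mem_overlap hp hp₁))
  have dσ : HasFDerivAt σ (fderiv ℝ σ (F₀ p)) (F₀ p) :=
    (smσ.differentiableAt (by simp)).hasFDerivAt
  have ddσ : HasFDerivAt (fderiv ℝ σ) (fderiv ℝ (fderiv ℝ σ) (F₀ p)) (F₀ p) :=
    ((smσ.fderiv_right (m := ∞) (by simp)).differentiableAt (by simp)).hasFDerivAt
  -- the derivative of the new components
  have hW₁' : HasMFDerivAt K 𝓘(ℝ, V) W₁ p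
      (((fderiv ℝ (fderiv ℝ σ) (F₀ p)).flip (W₀ p)).comp (mfderiv K 𝓘(ℝ, V) F₀ p) +
        (fderiv ℝ σ (F₀ p)).comp (mfderiv K 𝓘(ℝ, V) W₀ p)) := by
    have h1 : HasFDerivAt (fun z : V × V => fderiv ℝ σ z.1 z.2)
        (((fderiv ℝ (fderiv ℝ σ) (F₀ p)).flip (W₀ p)).comp (ContinuousLinearMap.fst ℝ V V) +
          (fderiv ℝ σ (F₀ p)).comp (ContinuousLinearMap.snd ℝ V V)) (F₀ p, W₀ p) := by
      have := (HasFDerivAt.comp (g := fderiv ℝ σ) (F₀ p, W₀ p) ddσ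
        (hasFDerivAt_fst (𝕜 := ℝ) (E := V) (F := V))).clm_apply
        (hasFDerivAt_snd (𝕜 := ℝ) (E := V) (F := V) (p := (F₀ p, W₀ p)))
      refine this.congr_fderiv ?_
      ext <;> simp
    have h2' : HasMFDerivAt K 𝓘(ℝ, V × V) (fun q => (F₀ q, W₀ q)) p
        ((mfderiv K 𝓘(ℝ, V) F₀ p).prod (mfderiv K 𝓘(ℝ, V) W₀ p)) :=
      ⟨dF₀.hasMFDerivAt.1.prodMk hW.hasMFDerivAt.1, dF₀.hasMFDerivAt.2.prodMk hW.hasMFDerivAt.2⟩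
    have h2 := HasMFDerivAt.comp (g := fun z : V × V => fderiv ℝ σ z.1 z.2)
      (f := fun q => (F₀ q, W₀ q)) p h1.hasMFDerivAt h2'
    have h3 : W₁ =ᶠ[𝓝 p] fun q => fderiv ℝ σ (F₀ q) (W₀ q) := by
      filter_upwards [ev] with q hq
      exact (fderiv_transition_compMap hq.1 hq.2 (W q)).symm
    refine (h2.congr_of_eventuallyEq h3).congr_mfderiv ?_
    ext v : 1
    rfl
  have hF₁ : ∀ v : TangentSpace K p, cmp (u p) (u p) (mfderiv K (𝓡 n) u p v) =
      fderiv ℝ σ (F₀ p) (mderiv K F₀ p v) := fun v => by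
    rw [← fderiv_transition_compMap hp hp₁, compMap_mfderiv hu hp]
    rfl
  -- the definition of the covariant derivative, in the chart at `u p`
  have hdef : cmp (u p) (u p) (covDeriv h K u W p w) = (mderiv K W₁ p w) +
      chartChristoffel h (u p) (extChartAt (𝓡 n) (u p) (u p))
        (cmp (u p) (u p) (mfderiv K (𝓡 n) u p w)) (W₁ p) := by
    have hd : ∀ k, dirDeriv K (fun q => coordComp (𝓡 n) (u p) (W q) k) p w =
        (mderiv K W₁ p w) k := fun k => by
      have e : (fun q => coordComp (𝓡 n) (u p) (W q) k) =ᶠ[𝓝 p] fun q => W₁ q k := by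
        filter_upwards [ev] with q hq
        exact (compMap_apply hq.2 (W q) k).symm
      have h4 : HasMFDerivAt K 𝓘(ℝ, ℝ) (fun q => W₁ q k) p _ :=
        ((EuclideanSpace.proj (𝕜 := ℝ) k : V →L[ℝ] ℝ).hasFDerivAt (x := W₁ p)).hasMFDerivAt.comp p
          hW₁'.mdifferentiableAt.hasMFDerivAt
      rw [dirDeriv, e.mfderiv_eq, h4.mfderiv]
      rfl
    simp only [covDeriv, hd]
    set Z : V := WithLp.toLp 2 fun k => (mderiv K W₁ p w) k +
      ∑ i, ∑ j, christoffel h (u p) k i j (u p) *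
        (coordComp (𝓡 n) (u p) (mfderiv K (𝓡 n) u p w) i * coordComp (𝓡 n) (u p) (W p) j)
    have h5 := frameMap_eq_sum (I := 𝓡 n) hp₁ Z
    have h6 : cmp (u p) (u p) (frameMap (𝓡 n) (u p) (u p) Z) = Z := compMap_frameMap hp₁ Z
    rw [h5] at h6
    refine h6.trans ?_
    ext k
    rw [PiLp.add_apply, chartChristoffel_apply, (extChartAt (𝓡 n) (u p)).left_inv
      (mem_extChartAt_source (u p))]
    simp only [compMap_apply hp₁, hW₁, Z]
  have hinj : Function.Injective (fderiv ℝ σ (F₀ p)) := fun a b hab => by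
    have e : ∀ a, fderiv ℝ σ (F₀ p) a = cmp (u p) (u p) (frameMap (𝓡 n) y₀ (u p) a) := fun a => by
      rw [← fderiv_transition_compMap hp hp₁, compMap_frameMap hp]
      rfl
    rw [e, e] at hab
    have := congrArg (fun v => cmp y₀ (u p) (frameMap (𝓡 n) (u p) (u p) v)) hab
    simpa only [frameMap_compMap hp₁, compMap_frameMap hp] using this
  -- The two expressions are compared after applying the injective `dσ`. The second derivative of
  -- `σ` that comes from differentiating `W₁ = dσ W₀` is the one in the transformation law of the
  -- Christoffel symbols.
  apply hinj
  have e0 : fderiv ℝ σ (F₀ p) (cmp y₀ (u p) (covDeriv h K u W p w)) =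
      cmp (u p) (u p) (covDeriv h K u W p w) := fderiv_transition_compMap hp hp₁ _
  have e1 : W₁ p = fderiv ℝ σ (F₀ p) (W₀ p) := (fderiv_transition_compMap hp hp₁ (W p)).symm
  have e2 := christoffel_transition h hp hp₁ (mderiv K F₀ p w) (W₀ p)
  have e3 : (mderiv K W₁ p w) =
      fderiv ℝ (fderiv ℝ σ) (F₀ p) (mderiv K F₀ p w) (W₀ p) +
      fderiv ℝ σ (F₀ p) (mderiv K W₀ p w) := by
    rw [mderiv, hW₁'.mfderiv]
    rfl
  rw [e0, hdef, hF₁, e1, e3, map_add]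
  refine Eq.trans ?_ (congrArg (fun z => fderiv ℝ σ (F₀ p) (mderiv K W₀ p w) + z)
    e2.symm)
  simp only [hF₀, Function.comp_apply]
  abel

/-- Pure reindexing: with `D i j k = ∂_i Γˡ_jk` it splits the coordinate formula for the curvature
into the four terms of `localCurvature`. -/
theorem sum_curvature {n : ℕ} (D : Fin n → Fin n → Fin n → ℝ) (Γ : Fin n → Fin n → Fin n → ℝ)
    (u v w : Fin n → ℝ) (l : Fin n) :
    ∑ i, ∑ j, ∑ k, (D i j k - D j i k + ∑ p, (Γ l i p * Γ p j k - Γ l j p * Γ p i k)) *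
      (u i * v j * w k) =
    ∑ i, ∑ j, ∑ k, D i j k * (u i * v j * w k) - ∑ i, ∑ j, ∑ k, D i j k * (v i * u j * w k) +
      (∑ i, ∑ p, Γ l i p * (u i * ∑ j, ∑ k, Γ p j k * (v j * w k)) -
        ∑ j, ∑ p, Γ l j p * (v j * ∑ i, ∑ k, Γ p i k * (u i * w k))) := by
  have h1 : ∑ i, ∑ j, ∑ k, D j i k * (u i * v j * w k) =
      ∑ i, ∑ j, ∑ k, D i j k * (v i * u j * w k) := by
    rw [Finset.sum_comm]
    exact Finset.sum_congr rfl fun i _ => Finset.sum_congr rfl fun j _ =>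
      Finset.sum_congr rfl fun k _ => by ring
  have h2 : ∀ a b : Fin n → ℝ, ∑ i, ∑ p, Γ l i p * (a i * ∑ j, ∑ k, Γ p j k * (b j * w k)) =
      ∑ i, ∑ j, ∑ k, (∑ p, Γ l i p * Γ p j k) * (a i * b j * w k) := fun a b => by
    refine Finset.sum_congr rfl fun i _ => ?_
    simp only [Finset.mul_sum, Finset.sum_mul]
    rw [Finset.sum_comm]
    refine Finset.sum_congr rfl fun j _ => ?_
    rw [Finset.sum_comm]
    exact Finset.sum_congr rfl fun k _ => Finset.sum_congr rfl fun p _ => by ring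
  have h3 : ∑ i, ∑ j, ∑ k, (∑ p, Γ l i p * Γ p j k) * (v i * u j * w k) =
      ∑ i, ∑ j, ∑ k, (∑ p, Γ l j p * Γ p i k) * (u i * v j * w k) := by
    rw [Finset.sum_comm]
    exact Finset.sum_congr rfl fun i _ => Finset.sum_congr rfl fun j _ =>
      Finset.sum_congr rfl fun k _ => by ring
  rw [h2, h2, h3, ← h1]
  simp only [← Finset.sum_sub_distrib, ← Finset.sum_add_distrib]
  exact Finset.sum_congr rfl fun i _ => Finset.sum_congr rfl fun j _ =>
    Finset.sum_congr rfl fun k _ => by rw [Finset.sum_sub_distrib]; ring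

/-- The curvature tensor in the chart at the base point. -/
theorem compMap_curvature (u v w : TangentSpace (𝓡 n) y) :
    cmp y y (curvature h y u v w) =
      localCurvature (chartChristoffel h y) (extChartAt (𝓡 n) y y) (cmp y y u) (cmp y y v)
        (cmp y y w) := by
  have hy : y ∈ (chartAt V y).source := mem_chart_source V y
  have hη := (extChartAt (𝓡 n) y).map_source (mem_extChartAt_source (I := 𝓡 n) y)
  set η := extChartAt (𝓡 n) y y
  have hyη : (extChartAt (𝓡 n) y).symm η = y :=
    (extChartAt (𝓡 n) y).left_inv (mem_extChartAt_source y)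
  set Γ := chartChristoffel h y
  have dΓ : HasFDerivAt Γ (fderiv ℝ Γ η) η :=
    (((isLeviCivita_chart h y).smooth_christoffel.contDiffAt
      ((isOpen_target y).mem_nhds hη)).differentiableAt (by simp)).hasFDerivAt
  have dchr : ∀ k i j, MDifferentiableAt (𝓡 n) 𝓘(ℝ, ℝ) (christoffel h y k i j) y := fun k i j => by
    have h1 : MDifferentiableAt (𝓡 n) 𝓘(ℝ, ℝ)
        ((fun η => christoffel h y k i j ((extChartAt (𝓡 n) y).symm η)) ∘ extChartAt (𝓡 n) y) y :=
      MDifferentiableAt.comp (I' := 𝓘(ℝ, V)) y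
        (((contDiffOn_christoffel h y k i j).contDiffAt
          ((isOpen_target y).mem_nhds hη)).differentiableAt (by simp)).mdifferentiableAt
        (mdifferentiableAt_extChartAt hy)
    refine h1.congr_of_eventuallyEq ?_
    filter_upwards [(chartAt V y).open_source.mem_nhds hy] with z hz
    rw [Function.comp_apply, (extChartAt (𝓡 n) y).left_inv (by simpa using hz)]
  -- The scalar function `η ↦ Γ η b c l` is differentiated in two ways: as a component of the
  -- bundled `Γ`, and as a combination of the Christoffel symbols.
  have hder : ∀ (a b c : V) (l : Fin n), fderiv ℝ Γ η a b c l =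
      ∑ i, ∑ j, ∑ k, partialDeriv (𝓡 n) y i (christoffel h y l j k) y * (a i * b j * c k) := by
    intro a b c l
    have d1 : ∀ j k, HasFDerivAt (fun η => christoffel h y l j k ((extChartAt (𝓡 n) y).symm η))
        (fderiv ℝ (fun η => christoffel h y l j k ((extChartAt (𝓡 n) y).symm η)) η) η :=
      fun j k => (((contDiffOn_christoffel h y l j k).contDiffAt
          ((isOpen_target y).mem_nhds hη)).differentiableAt (by simp)).hasFDerivAt
    have d2 : ∀ j k, fderiv ℝ (fun η => christoffel h y l j k ((extChartAt (𝓡 n) y).symm η)) η a =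
        ∑ i, partialDeriv (𝓡 n) y i (christoffel h y l j k) y * a i := fun j k => by
      conv_lhs => rw [← sum_single_smul a]
      rw [map_sum]
      refine Finset.sum_congr rfl fun i _ => ?_
      have := partialDeriv_symm (y₀ := y) (φ := christoffel h y l j k) hη
        (by rw [hyη]; exact dchr l j k) i
      rw [hyη] at this
      rw [map_smul, this, smul_eq_mul, mul_comm]
    have d3 := (dΓ.clm_apply (hasFDerivAt_const b η))
    have d4 := (d3.clm_apply (hasFDerivAt_const c η))
    have d5 := HasFDerivAt.comp (g := fun z : V => z l) (g' := EuclideanSpace.proj (𝕜 := ℝ) l) η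
      (EuclideanSpace.proj (𝕜 := ℝ) l : V →L[ℝ] ℝ).hasFDerivAt d4
    have d6 : HasFDerivAt (fun η => Γ η b c l) (∑ j, ∑ k, (b j * c k) •
        fderiv ℝ (fun η => christoffel h y l j k ((extChartAt (𝓡 n) y).symm η)) η) η := by
      simp only [Γ, chartChristoffel_apply]
      exact HasFDerivAt.fun_sum fun j _ => HasFDerivAt.fun_sum fun k _ =>
        (d1 j k).mul_const (b j * c k)
    have d7 := congrArg (fun L : V →L[ℝ] ℝ => L a) (d5.unique d6)
    simp only [FunLike.coe_sum, Finset.sum_apply, FunLike.coe_smul, Pi.smul_apply, d2] at d7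
    refine Eq.trans ?_ (d7.trans ?_)
    · simp
    · simp only [smul_eq_mul, Finset.mul_sum]
      rw [Finset.sum_comm]
      rw [Finset.sum_congr rfl fun k _ => Finset.sum_comm, Finset.sum_comm]
      refine Finset.sum_congr rfl fun i _ => ?_
      rw [Finset.sum_comm]
      exact Finset.sum_congr rfl fun j _ => Finset.sum_congr rfl fun k _ => by ring
  set Z : V := WithLp.toLp 2 fun l => ∑ i, ∑ j, ∑ k, curvatureComp h y l i j k y *
    (coordComp (𝓡 n) y u i * coordComp (𝓡 n) y v j * coordComp (𝓡 n) y w k)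
  have h5 := frameMap_eq_sum (I := 𝓡 n) hy Z
  have h6 : cmp y y (frameMap (𝓡 n) y y Z) = Z := compMap_frameMap hy Z
  rw [h5] at h6
  refine Eq.trans h6 ?_
  ext l
  have hΓ : ∀ (a b : V) (l : Fin n), Γ η a b l = ∑ i, ∑ j, christoffel h y l i j y * (a i * b j) :=
    fun a b l => by rw [chartChristoffel_apply, hyη]
  simp only [localCurvature, PiLp.add_apply, PiLp.sub_apply, hder, hΓ, compMap_apply hy, Z,
    curvatureComp]
  exact sum_curvature (fun i j k => partialDeriv (𝓡 n) y i (christoffel h y l j k) y)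
    (fun l i j => christoffel h y l i j y) _ _ _ l

end CovariantDerivative

/-! ### Space and time derivatives as directional derivatives on a product. -/

noncomputable section Slices

variable {E F : Type*} [NormedAddCommGroup E] [NormedSpace ℝ E]
  [NormedAddCommGroup F] [NormedSpace ℝ F] {S : Set (E × ℝ)} {Φ : E × ℝ → F} {ξ : E} {t : ℝ}

/-- All nearby times are admissible, so the time derivative is two-sided even over a boundary point
`ξ`; in space only a derivative within a set is available. -/
theorem hasDerivAt_slice (hS : ∀ᶠ s in 𝓝 t, (ξ, s) ∈ S)
    (hΦ : DifferentiableWithinAt ℝ Φ S (ξ, t)) :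
    HasDerivAt (fun s => Φ (ξ, s)) (fderivWithin ℝ Φ S (ξ, t) (0, 1)) t := by
  have h1 : HasDerivWithinAt (fun s : ℝ => (ξ, s)) ((0 : E), (1 : ℝ)) {s | (ξ, s) ∈ S} t :=
    ((hasDerivAt_const t ξ).prodMk (hasDerivAt_id t)).hasDerivWithinAt
  have h2 := HasFDerivWithinAt.comp_hasDerivWithinAt (l := Φ) (f := fun s : ℝ => (ξ, s)) t
    hΦ.hasFDerivWithinAt h1 fun s hs => hs
  exact h2.hasDerivAt hS

theorem hasFDerivWithinAt_slice {C : Set E} (hS : ∀ᶠ η in 𝓝[C] ξ, (η, t) ∈ S)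
    (hΦ : DifferentiableWithinAt ℝ Φ S (ξ, t)) :
    HasFDerivWithinAt (fun η => Φ (η, t))
      ((fderivWithin ℝ Φ S (ξ, t)).comp (ContinuousLinearMap.inl ℝ E ℝ)) C ξ := by
  have h1 : HasFDerivWithinAt (fun η : E => (η, t)) (ContinuousLinearMap.inl ℝ E ℝ)
      {η | (η, t) ∈ S} ξ :=
    ((hasFDerivAt_id ξ).prodMk (hasFDerivAt_const t ξ)).hasFDerivWithinAt
  have h2 := HasFDerivWithinAt.comp (g := Φ) (f := fun η : E => (η, t)) ξ
    hΦ.hasFDerivWithinAt h1 fun s hs => hs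
  exact h2.mono_of_mem_nhdsWithin hS

end Slices

/-! ### A smooth family of maps written in charts. -/

noncomputable section Families

variable {m n : ℕ} {H : Type*} [TopologicalSpace H]
  {I : ModelWithCorners ℝ (EuclideanSpace ℝ (Fin m)) H}
  {M : Type*} [TopologicalSpace M] [ChartedSpace H M] [IsManifold I ∞ M]
  {N : Type*} [TopologicalSpace N]
  [ChartedSpace (EuclideanSpace ℝ (Fin n)) N] [IsManifold (𝓡 n) ∞ N]
  (h : Bundle.ContMDiffRiemannianMetric (𝓡 n) ∞ (EuclideanSpace ℝ (Fin n))
    (fun y : N => TangentSpace (𝓡 n) y))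
  {f : M × ℝ → N} {T : Set ℝ} {x₀ x : M} {y₀ : N} {t : ℝ}

local notation "E" => EuclideanSpace ℝ (Fin m)
local notation "V" => EuclideanSpace ℝ (Fin n)

/-- The set on which `f` can be written in the charts at `x₀` and `y₀`. -/
def familyDomain (n : ℕ) [ChartedSpace (EuclideanSpace ℝ (Fin n)) N]
    (I : ModelWithCorners ℝ (EuclideanSpace ℝ (Fin m)) H) (f : M × ℝ → N) (T : Set ℝ) (x₀ : M) (y₀ : N) : Set (E × ℝ) :=
  {p | p.1 ∈ (extChartAt I x₀).target ∧ p.2 ∈ T ∧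
    f ((extChartAt I x₀).symm p.1, p.2) ∈ (chartAt (EuclideanSpace ℝ (Fin n)) y₀).source}

/-- The family `f` in the charts at `x₀` and `y₀`. -/
def localFamily (n : ℕ) [ChartedSpace (EuclideanSpace ℝ (Fin n)) N]
    (I : ModelWithCorners ℝ (EuclideanSpace ℝ (Fin m)) H) (f : M × ℝ → N)
    (x₀ : M) (y₀ : N) (p : E × ℝ) : EuclideanSpace ℝ (Fin n) :=
  extChartAt (𝓡 n) y₀ (f ((extChartAt I x₀).symm p.1, p.2))

theorem contMDiffOn_symm_prod (x₀ : M) (T : Set ℝ) :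
    ContMDiffOn 𝓘(ℝ, E × ℝ) (I.prod 𝓘(ℝ, ℝ)) ∞
      (fun p : E × ℝ => ((extChartAt I x₀).symm p.1, p.2)) ((extChartAt I x₀).target ×ˢ T) := by
  refine ContMDiffOn.prodMk ?_ contDiff_snd.contMDiff.contMDiffOn
  exact (contMDiffOn_extChartAt_symm x₀).comp contDiff_fst.contMDiff.contMDiffOn
    fun p hp => hp.1

variable (hT : IsOpen T) (hf : ContMDiffOn (I.prod 𝓘(ℝ, ℝ)) (𝓡 n) ∞ f (univ ×ˢ T))

include hf in
theorem contMDiffOn_family_symm (x₀ : M) :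
    ContMDiffOn 𝓘(ℝ, E × ℝ) (𝓡 n) ∞ (fun p : E × ℝ => f ((extChartAt I x₀).symm p.1, p.2))
      ((extChartAt I x₀).target ×ˢ T) :=
  hf.comp (contMDiffOn_symm_prod x₀ T) fun _ hp => ⟨mem_univ _, hp.2⟩

include hT hf in
-- The domain is relatively open in `range I × ℝ`, and so inherits unique differentiability and the
-- density of its interior, the two properties on which the local calculus rests.
theorem familyDomain_eq (x₀ : M) (y₀ : N) : ∃ U : Set (E × ℝ), IsOpen U ∧
    familyDomain n I f T x₀ y₀ = range I ×ˢ univ ∩ U := by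
  obtain ⟨U₀, hU₀, e₀⟩ := exists_isOpen_target (I := I) x₀
  obtain ⟨U₁, hU₁, e₁⟩ := (continuousOn_iff'.1 (contMDiffOn_family_symm hf x₀).continuousOn)
    _ (chartAt V y₀).open_source
  refine ⟨U₀ ×ˢ T ∩ U₁, (hU₀.prod hT).inter hU₁, ?_⟩
  ext p
  have h0 : p.1 ∈ (extChartAt I x₀).target ↔ p.1 ∈ range I ∧ p.1 ∈ U₀ := by rw [e₀]; rfl
  have h1 := Set.ext_iff.1 e₁ p
  simp only [mem_inter_iff, mem_preimage, mem_prod, h0] at h1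
  simp only [familyDomain, mem_ofPred_eq, mem_inter_iff, mem_prod, mem_univ, h0]
  tauto

include hT hf in
theorem uniqueDiffOn_familyDomain (x₀ : M) (y₀ : N) :
    UniqueDiffOn ℝ (familyDomain n I f T x₀ y₀) := by
  obtain ⟨U, hU, e⟩ := familyDomain_eq (n := n) hT hf x₀ y₀
  exact e ▸ (I.uniqueDiffOn.prod uniqueDiffOn_univ).inter hU

include hT hf in
theorem familyDomain_subset_closure (x₀ : M) (y₀ : N) :
    familyDomain n I f T x₀ y₀ ⊆ closure (interior (familyDomain n I f T x₀ y₀)) := by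
  obtain ⟨U, hU, e⟩ := familyDomain_eq (n := n) hT hf x₀ y₀
  rw [e]
  refine subset_closure_interior_inter ?_ hU
  rw [interior_prod_eq, interior_univ, closure_prod_eq, closure_univ]
  exact prod_mono I.range_subset_closure_interior subset_rfl

include hf in
theorem contDiffOn_localFamily (x₀ : M) (y₀ : N) :
    ContDiffOn ℝ ∞ (localFamily n I f x₀ y₀) (familyDomain n I f T x₀ y₀) := by
  rw [← contMDiffOn_iff_contDiffOn]
  exact (contMDiffOn_extChartAt (I := 𝓡 n) (x := y₀)).comp
    ((contMDiffOn_family_symm hf x₀).mono fun p hp => ⟨hp.1, hp.2.1⟩) fun p hp => hp.2.2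

theorem mapsTo_localFamily (x₀ : M) (y₀ : N) :
    MapsTo (localFamily n I f x₀ y₀) (familyDomain n I f T x₀ y₀) (extChartAt (𝓡 n) y₀).target :=
  fun _ hp => (extChartAt (𝓡 n) y₀).map_source (by simpa using hp.2.2)

theorem mem_familyDomain (hx : x ∈ (chartAt H x₀).source) (ht : t ∈ T)
    (hy : f (x, t) ∈ (chartAt V y₀).source) :
    (extChartAt I x₀ x, t) ∈ familyDomain n I f T x₀ y₀ := by
  have hs : x ∈ (extChartAt I x₀).source := by simpa using hx
  refine ⟨(extChartAt I x₀).map_source hs, ht, ?_⟩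
  simpa only [(extChartAt I x₀).left_inv hs] using hy

theorem localFamily_apply (hx : x ∈ (chartAt H x₀).source) :
    localFamily n I f x₀ y₀ (extChartAt I x₀ x, t) = extChartAt (𝓡 n) y₀ (f (x, t)) := by
  rw [localFamily, (extChartAt I x₀).left_inv (by simpa using hx)]

include hT hf in
theorem contMDiffAt_family (x : M) (ht : t ∈ T) :
    ContMDiffAt (I.prod 𝓘(ℝ, ℝ)) (𝓡 n) ∞ f (x, t) :=
  hf.contMDiffAt ((isOpen_univ.prod hT).mem_nhds ⟨mem_univ _, ht⟩)

include hT hf in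
theorem mdifferentiableAt_space (x : M) (ht : t ∈ T) :
    MDifferentiableAt I (𝓡 n) (fun z => f (z, t)) x :=
  ((contMDiffAt_family hT hf x ht).comp (f := fun z : M => (z, t)) x
    (contMDiffAt_id.prodMk contMDiffAt_const)).mdifferentiableAt (by simp)

include hT hf in
theorem mdifferentiableAt_time (x : M) (ht : t ∈ T) :
    MDifferentiableAt 𝓘(ℝ, ℝ) (𝓡 n) (fun s => f (x, s)) t :=
  ((contMDiffAt_family hT hf x ht).comp (f := fun s : ℝ => (x, s)) t
    (contMDiffAt_const.prodMk contMDiffAt_id)).mdifferentiableAt (by simp)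

include hT hf in
theorem eventually_space (hx : x ∈ (chartAt H x₀).source) (ht : t ∈ T)
    (hy : f (x, t) ∈ (chartAt V y₀).source) :
    ∀ᶠ z in 𝓝 x, z ∈ (chartAt H x₀).source ∧ f (z, t) ∈ (chartAt V y₀).source :=
  Filter.Eventually.and ((chartAt H x₀).open_source.mem_nhds hx)
    ((mdifferentiableAt_space hT hf x ht).continuousAt.eventually
      ((chartAt V y₀).open_source.mem_nhds hy))

include hT hf in
theorem eventually_time (x : M) (ht : t ∈ T) (hy : f (x, t) ∈ (chartAt V y₀).source) :
    ∀ᶠ s in 𝓝 t, s ∈ T ∧ f (x, s) ∈ (chartAt V y₀).source :=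
  Filter.Eventually.and (hT.mem_nhds ht)
    ((mdifferentiableAt_time hT hf x ht).continuousAt.eventually
      ((chartAt V y₀).open_source.mem_nhds hy))

include hT hf in
theorem eventually_mem_familyDomain_space {ξ : E} (hp : (ξ, t) ∈ familyDomain n I f T x₀ y₀) :
    ∀ᶠ η in 𝓝[range I] ξ, (η, t) ∈ familyDomain n I f T x₀ y₀ := by
  obtain ⟨U, hU, e⟩ := familyDomain_eq (n := n) hT hf x₀ y₀
  rw [e] at hp ⊢
  have h1 : ∀ᶠ η in 𝓝 ξ, (η, t) ∈ U :=
    (Continuous.prodMk_left t).continuousAt.eventually (hU.mem_nhds hp.2)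
  filter_upwards [self_mem_nhdsWithin, nhdsWithin_le_nhds h1] with η hη hηU
  exact ⟨⟨hη, mem_univ _⟩, hηU⟩

include hT hf in
theorem eventually_mem_familyDomain_time {ξ : E} (hp : (ξ, t) ∈ familyDomain n I f T x₀ y₀) :
    ∀ᶠ s in 𝓝 t, (ξ, s) ∈ familyDomain n I f T x₀ y₀ := by
  obtain ⟨U, hU, e⟩ := familyDomain_eq (n := n) hT hf x₀ y₀
  rw [e] at hp ⊢
  have h1 : ∀ᶠ s in 𝓝 t, (ξ, s) ∈ U :=
    (Continuous.prodMk_right ξ).continuousAt.eventually (hU.mem_nhds hp.2)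
  filter_upwards [h1] with s hs
  exact ⟨⟨hp.1.1, mem_univ _⟩, hs⟩

/-- The derivative of a map given in a chart. -/
theorem hasMFDerivAt_of_chart {G : Type*} [NormedAddCommGroup G] [NormedSpace ℝ G] {φ : M → G}
    {Φ : E → G} (hx : x ∈ (chartAt H x₀).source)
    (hΦ : DifferentiableWithinAt ℝ Φ (range I) (extChartAt I x₀ x))
    (hφ : ∀ᶠ z in 𝓝 x, φ z = Φ (extChartAt I x₀ z)) :
    MDifferentiableAt I 𝓘(ℝ, G) φ x ∧ ∀ v, mderiv I φ x (frameMap I x₀ x v) =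
      fderivWithin ℝ Φ (range I) (extChartAt I x₀ x) v := by
  have hx' : x ∈ (extChartAt I x₀).source := by simpa using hx
  have h1 : MDifferentiableAt I 𝓘(ℝ, G) φ x := by
    have h2 : MDifferentiableWithinAt I 𝓘(ℝ, G) (Φ ∘ extChartAt I x₀) univ x :=
      MDifferentiableWithinAt.comp (I' := 𝓘(ℝ, E)) x hΦ.mdifferentiableWithinAt
        (mdifferentiableAt_extChartAt hx).mdifferentiableWithinAt fun z _ => by
          rw [mem_preimage, extChartAt_coe]; exact mem_range_self _
    exact (mdifferentiableWithinAt_univ.1 h2).congr_of_eventuallyEq hφ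
  refine ⟨h1, fun v => ?_⟩
  refine (mfderiv_frameMap hx h1 v).trans ?_
  have hξ := (extChartAt I x₀).map_source hx'
  have h3 : Filter.Tendsto (extChartAt I x₀).symm (𝓝[range I] (extChartAt I x₀ x)) (𝓝 x) := by
    have := (continuousAt_extChartAt_symm' (I := I) hx').tendsto
    rw [(extChartAt I x₀).left_inv hx'] at this
    exact this.mono_left nhdsWithin_le_nhds
  refine congrArg (fun L : E →L[ℝ] G => L v) (Filter.EventuallyEq.fderivWithin_eq ?_ ?_)
  · filter_upwards [h3.eventually hφ, extChartAt_target_mem_nhdsWithin' (I := I) hx'] with η hη hη'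
    rw [Function.comp_apply, hη, (extChartAt I x₀).right_inv hη']
  · rw [Function.comp_apply, (extChartAt I x₀).left_inv hx', hφ.self_of_nhds]

include hT hf in
-- Together with its time analogue this is the dictionary of the file: derivatives on `M` and in `t`
-- become derivatives of one function on one set in the directions `(v, 0)` and `(0, 1)`, where the
-- commutation rules apply.
theorem hasMFDerivAt_of_familyDomain {G : Type*} [NormedAddCommGroup G] [NormedSpace ℝ G]
    {φ : M → G} {Φ : E × ℝ → G} (hx : x ∈ (chartAt H x₀).source) (ht : t ∈ T)
    (hy : f (x, t) ∈ (chartAt V y₀).source)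
    (hΦ : ContDiffOn ℝ ∞ Φ (familyDomain n I f T x₀ y₀))
    (hφ : ∀ z ∈ (chartAt H x₀).source, f (z, t) ∈ (chartAt V y₀).source →
      φ z = Φ (extChartAt I x₀ z, t)) :
    MDifferentiableAt I 𝓘(ℝ, G) φ x ∧ ∀ v, mderiv I φ x (frameMap I x₀ x v) =
      fderivWithin ℝ Φ (familyDomain n I f T x₀ y₀) (extChartAt I x₀ x, t) (v, 0) := by
  have hp := mem_familyDomain (n := n) (I := I) hx ht hy
  have h1 := hasFDerivWithinAt_slice (eventually_mem_familyDomain_space hT hf hp)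
    (hΦ.differentiableOn (by simp) _ hp)
  have h2 := hasMFDerivAt_of_chart (φ := φ) hx h1.differentiableWithinAt
    ((eventually_space hT hf hx ht hy).mono fun z hz => hφ z hz.1 hz.2)
  refine ⟨h2.1, fun v => ?_⟩
  rw [h2.2, h1.fderivWithin (I.uniqueDiffOn _ (extChartAt_target_subset_range x₀ hp.1))]
  rfl

include hT hf in
theorem hasMFDerivAt_time_of_familyDomain {G : Type*} [NormedAddCommGroup G] [NormedSpace ℝ G]
    {φ : ℝ → G} {Φ : E × ℝ → G} (hx : x ∈ (chartAt H x₀).source) (ht : t ∈ T)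
    (hy : f (x, t) ∈ (chartAt V y₀).source)
    (hΦ : ContDiffOn ℝ ∞ Φ (familyDomain n I f T x₀ y₀))
    (hφ : ∀ s ∈ T, f (x, s) ∈ (chartAt V y₀).source → φ s = Φ (extChartAt I x₀ x, s)) :
    MDifferentiableAt 𝓘(ℝ, ℝ) 𝓘(ℝ, G) φ t ∧ mderiv 𝓘(ℝ, ℝ) φ t (1 : ℝ) =
      fderivWithin ℝ Φ (familyDomain n I f T x₀ y₀) (extChartAt I x₀ x, t) (0, 1) := by
  have hp := mem_familyDomain (n := n) (I := I) hx ht hy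
  have h1 := (hasDerivAt_slice (eventually_mem_familyDomain_time hT hf hp)
    (hΦ.differentiableOn (by simp) _ hp)).congr_of_eventuallyEq (f₁ := φ)
    ((eventually_time hT hf x ht hy).mono fun s hs => hφ s hs.1 hs.2)
  refine ⟨h1.differentiableAt.mdifferentiableAt, ?_⟩
  refine Eq.trans ?_ h1.deriv
  rw [← fderiv_apply_one_eq_deriv, ← mfderiv_eq_fderiv]
  rfl

end Families

/-! ### Coordinate expressions for the terms of the formula. -/

noncomputable section Components

/-- The covariant derivative along `F`, as a linear map of the direction. -/
def covDirMap {V A : Type*} [NormedAddCommGroup V] [NormedSpace ℝ V] [NormedAddCommGroup A]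
    [NormedSpace ℝ A] (Γ : V → V →L[ℝ] V →L[ℝ] V) (S : Set A) (F : A → V) (X : A → V) (p : A) :
    A →L[ℝ] V :=
  fderivWithin ℝ X S p + ((Γ (F p)).flip (X p)).comp (fderivWithin ℝ F S p)

theorem covDirMap_apply {V A : Type*} [NormedAddCommGroup V] [NormedSpace ℝ V]
    [NormedAddCommGroup A] [NormedSpace ℝ A] (Γ : V → V →L[ℝ] V →L[ℝ] V) (S : Set A) (F X : A → V)
    (p v : A) : covDirMap Γ S F X p v = covDir Γ S F v X p := by
  simp [covDirMap, covDir]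

variable {m n : ℕ} {H : Type*} [TopologicalSpace H]
  {I : ModelWithCorners ℝ (EuclideanSpace ℝ (Fin m)) H}
  {M : Type*} [TopologicalSpace M] [ChartedSpace H M] [IsManifold I ∞ M]
  {N : Type*} [TopologicalSpace N]
  [ChartedSpace (EuclideanSpace ℝ (Fin n)) N] [IsManifold (𝓡 n) ∞ N]
  (g : Bundle.ContMDiffRiemannianMetric I ∞ (EuclideanSpace ℝ (Fin m))
    (fun x : M => TangentSpace I x))
  (h : Bundle.ContMDiffRiemannianMetric (𝓡 n) ∞ (EuclideanSpace ℝ (Fin n))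
    (fun y : N => TangentSpace (𝓡 n) y))
  {f : M × ℝ → N} {T : Set ℝ} {x₀ x : M} {y₀ y : N} {t : ℝ}

local notation "E" => EuclideanSpace ℝ (Fin m)
local notation "V" => EuclideanSpace ℝ (Fin n)
local notation "cmp" => compMap (𝓡 n)
local notation "Ω" => familyDomain n I f T x₀ y₀
local notation "F" => localFamily n I f x₀ y₀
local notation "Γ" => chartChristoffel h y₀

/-- The variation field in charts. -/
def localVelocity (n : ℕ) [ChartedSpace (EuclideanSpace ℝ (Fin n)) N]
    (I : ModelWithCorners ℝ (EuclideanSpace ℝ (Fin m)) H) (f : M × ℝ → N) (T : Set ℝ)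
    (x₀ : M) (y₀ : N) (p : E × ℝ) : EuclideanSpace ℝ (Fin n) :=
  fderivWithin ℝ (localFamily n I f x₀ y₀) (familyDomain n I f T x₀ y₀) p (0, 1)

/-- The acceleration in charts. -/
def localAcceleration (I : ModelWithCorners ℝ (EuclideanSpace ℝ (Fin m)) H) (f : M × ℝ → N)
    (T : Set ℝ) (x₀ : M) (y₀ : N) : E × ℝ → V :=
  covDir (chartChristoffel h y₀) (familyDomain n I f T x₀ y₀) (localFamily n I f x₀ y₀) (0, 1)
    (localVelocity n I f T x₀ y₀)

variable (hT : IsOpen T) (hf : ContMDiffOn (I.prod 𝓘(ℝ, ℝ)) (𝓡 n) ∞ f (univ ×ˢ T))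

include hT hf in
theorem contDiffOn_localVelocity : ContDiffOn ℝ ∞ (localVelocity n I f T x₀ y₀) Ω :=
  contDiffOn_dir (uniqueDiffOn_familyDomain hT hf x₀ y₀) (contDiffOn_localFamily hf x₀ y₀) (0, 1)

include hT hf in
theorem contDiffOn_covDir_family {X : E × ℝ → V} (hX : ContDiffOn ℝ ∞ X Ω) (v : E × ℝ) :
    ContDiffOn ℝ ∞ (covDir Γ Ω F v X) Ω :=
  contDiffOn_covDir (isLeviCivita_chart h y₀).smooth_christoffel
    (uniqueDiffOn_familyDomain hT hf x₀ y₀) (contDiffOn_localFamily hf x₀ y₀)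
    (mapsTo_localFamily x₀ y₀) hX v

include hT hf in
theorem contDiffOn_localAcceleration : ContDiffOn ℝ ∞ (localAcceleration h I f T x₀ y₀) Ω :=
  contDiffOn_covDir_family h hT hf (contDiffOn_localVelocity hT hf) (0, 1)

include hT hf in
theorem compMap_mfderiv_family
    (hx : x ∈ (chartAt H x₀).source) (ht : t ∈ T)
    (hy : f (x, t) ∈ (chartAt V y₀).source) (v : E) :
    cmp y₀ (f (x, t)) (mfderiv I (𝓡 n) (fun z => f (z, t)) x (frameMap I x₀ x v)) =
      fderivWithin ℝ F Ω (extChartAt I x₀ x, t) (v, 0) := by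
  refine (compMap_mfderiv (mdifferentiableAt_space hT hf x ht) hy _).trans ?_
  exact (hasMFDerivAt_of_familyDomain hT hf hx ht hy (contDiffOn_localFamily hf x₀ y₀)
    fun z hz _ => (localFamily_apply hz).symm).2 v

include hT hf in
theorem compMap_variationField
    (hx : x ∈ (chartAt H x₀).source) (ht : t ∈ T)
    (hy : f (x, t) ∈ (chartAt V y₀).source) :
    cmp y₀ (f (x, t)) (variationField f t x) =
      localVelocity n I f T x₀ y₀ (extChartAt I x₀ x, t) := by
  refine (compMap_mfderiv (mdifferentiableAt_time hT hf x ht) hy _).trans ?_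
  exact (hasMFDerivAt_time_of_familyDomain hT hf hx ht hy (contDiffOn_localFamily hf x₀ y₀)
    fun s _ _ => (localFamily_apply hx).symm).2

include hT hf in
theorem compMap_covDeriv_space
    (hx : x ∈ (chartAt H x₀).source) (ht : t ∈ T)
    (hy : f (x, t) ∈ (chartAt V y₀).source) {W : ∀ z : M, TangentSpace (𝓡 n) (f (z, t))} {X : E × ℝ → V}
    (hX : ContDiffOn ℝ ∞ X Ω)
    (hWX : ∀ z ∈ (chartAt H x₀).source, f (z, t) ∈ (chartAt V y₀).source →
      cmp y₀ (f (z, t)) (W z) = X (extChartAt I x₀ z, t)) (v : E) :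
    cmp y₀ (f (x, t)) (covDeriv h I (fun z => f (z, t)) W x (frameMap I x₀ x v)) =
      covDir Γ Ω F (v, 0) X (extChartAt I x₀ x, t) := by
  have h1 := hasMFDerivAt_of_familyDomain hT hf hx ht hy hX hWX
  have h2 := hasMFDerivAt_of_familyDomain hT hf hx ht hy (contDiffOn_localFamily hf x₀ y₀)
    (φ := extChartAt (𝓡 n) y₀ ∘ fun z => f (z, t)) fun z hz _ => (localFamily_apply hz).symm
  refine (compMap_covDeriv h (mdifferentiableAt_space hT hf x ht) hy h1.1 _).trans ?_
  rw [h1.2, h2.2, hWX x hx hy, covDir, localFamily_apply hx]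

include hT hf in
theorem compMap_covDeriv_time
    (hx : x ∈ (chartAt H x₀).source) (ht : t ∈ T)
    (hy : f (x, t) ∈ (chartAt V y₀).source) {W : ∀ s : ℝ, TangentSpace (𝓡 n) (f (x, s))} {X : E × ℝ → V}
    (hX : ContDiffOn ℝ ∞ X Ω)
    (hWX : ∀ s ∈ T, f (x, s) ∈ (chartAt V y₀).source →
      cmp y₀ (f (x, s)) (W s) = X (extChartAt I x₀ x, s)) :
    cmp y₀ (f (x, t)) (covDeriv h 𝓘(ℝ, ℝ) (fun s => f (x, s)) W t (1 : ℝ)) =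
      covDir Γ Ω F (0, 1) X (extChartAt I x₀ x, t) := by
  have h1 := hasMFDerivAt_time_of_familyDomain hT hf hx ht hy hX hWX
  have h2 := hasMFDerivAt_time_of_familyDomain hT hf hx ht hy (contDiffOn_localFamily hf x₀ y₀)
    (φ := extChartAt (𝓡 n) y₀ ∘ fun s => f (x, s)) fun s _ _ => (localFamily_apply hx).symm
  refine (compMap_covDeriv h (mdifferentiableAt_time hT hf x ht) hy h1.1 _).trans ?_
  rw [h1.2, h2.2, hWX t ht hy, covDir, localFamily_apply hx]

include hT hf in
theorem compMap_acceleration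
    (hx : x ∈ (chartAt H x₀).source) (ht : t ∈ T)
    (hy : f (x, t) ∈ (chartAt V y₀).source) :
    cmp y₀ (f (x, t)) (acceleration h f t x) =
      localAcceleration h I f T x₀ y₀ (extChartAt I x₀ x, t) :=
  compMap_covDeriv_time h hT hf hx ht hy (contDiffOn_localVelocity hT hf)
    fun _ hs hys => compMap_variationField hT hf hx hs hys

/-- The inner product on `T*M ⊗ TN` in charts. -/
def localHomInner (x₀ : M) (y₀ : N) (f : M × ℝ → N) (X Y : Fin m → E × ℝ → V) (p : E × ℝ) : ℝ :=
  ∑ a, ∑ b, (metricMatrix g x₀ ((extChartAt I x₀).symm p.1))⁻¹ a b *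
    chartMetric h y₀ (localFamily n I f x₀ y₀ p) (X a p) (Y b p)

include hT hf in
theorem contDiffOn_localInner {X Y : E × ℝ → V} (hX : ContDiffOn ℝ ∞ X Ω)
    (hY : ContDiffOn ℝ ∞ Y Ω) :
    ContDiffOn ℝ ∞ (fun p => chartMetric h y₀ (F p) (X p) (Y p)) Ω :=
  (((isLeviCivita_chart h y₀).smooth_metric.comp (contDiffOn_localFamily hf x₀ y₀)
    (mapsTo_localFamily x₀ y₀)).clm_apply hX).clm_apply hY

theorem contDiffOn_inv_metricMatrix (x₀ : M) (a b : Fin m) :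
    ContDiffOn ℝ ∞ (fun ξ => (metricMatrix g x₀ ((extChartAt I x₀).symm ξ))⁻¹ a b)
      (extChartAt I x₀).target :=
  contDiffOn_matrix_inv (fun a b => contDiffOn_metricMatrix g x₀ a b)
    (fun _ hη => (metricMatrix_det_pos g (symm_mem_source hη)).ne') a b

include hT hf in
theorem contDiffOn_localHomInner {X Y : Fin m → E × ℝ → V} (hX : ∀ a, ContDiffOn ℝ ∞ (X a) Ω)
    (hY : ∀ a, ContDiffOn ℝ ∞ (Y a) Ω) :
    ContDiffOn ℝ ∞ (localHomInner g h x₀ y₀ f X Y) Ω :=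
  ContDiffOn.sum fun a _ => ContDiffOn.sum fun b _ =>
    ((contDiffOn_inv_metricMatrix g x₀ a b).comp contDiff_fst.contDiffOn fun _ hp => hp.1).mul
      (contDiffOn_localInner h hT hf (hX a) (hY b))

/-- `A` and `B` are bare functions; `A'` and `B'` supply the linearity that makes `Q` bilinear, and
`sum_inv_metricMatrix_mul` then changes the frame on `M`. -/
theorem homInner_eq {A B : TangentSpace I x → TangentSpace (𝓡 n) y} {A' B' : E →L[ℝ] V}
    (hx : x ∈ (chartAt H x₀).source)
    (hy : y ∈ (chartAt V y₀).source)
    (hA : ∀ v, cmp y₀ y (A (frameMap I x₀ x v)) = A' v)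
    (hB : ∀ v, cmp y₀ y (B (frameMap I x₀ x v)) = B' v) :
    homInner h g x y A B = ∑ a, ∑ b, (metricMatrix g x₀ x)⁻¹ a b *
      chartMetric h y₀ (extChartAt (𝓡 n) y₀ y) (A' (EuclideanSpace.single a 1))
        (B' (EuclideanSpace.single b 1)) := by
  have hA2 : ∀ v, cmp y₀ y (A v) = A' (compMap I x₀ x v) := fun v => by
    rw [← hA, frameMap_compMap hx]
  have hB2 : ∀ v, cmp y₀ y (B v) = B' (compMap I x₀ x v) := fun v => by
    rw [← hB, frameMap_compMap hx]
  let Q : TangentSpace I x →ₗ[ℝ] TangentSpace I x →ₗ[ℝ] ℝ :=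
    LinearMap.mk₂ ℝ (fun u v => chartMetric h y₀ (extChartAt (𝓡 n) y₀ y)
      (A' (compMap I x₀ x u)) (B' (compMap I x₀ x v))) (fun u u' v => by simp)
      (fun c u v => by simp) (fun u v v' => by simp) (fun c u v => by simp)
  have hQ : ∀ u v, h.inner y (A u) (B v) = Q u v := fun u v => by
    rw [← chartMetric_compMap h hy, hA2, hB2]
    rfl
  simp only [homInner, hQ]
  rw [sum_inv_metricMatrix_mul g hx (mem_chart_source H x) Q]
  refine Finset.sum_congr rfl fun a _ => Finset.sum_congr rfl fun b _ => ?_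
  rw [← hQ, ← chartMetric_compMap h hy, ← frameMap_single hx, ← frameMap_single hx, hA, hB]

theorem homInner_family
    (hx : x ∈ (chartAt H x₀).source) {A B : TangentSpace I x → TangentSpace (𝓡 n) (f (x, t))}
    {X Y : E × ℝ → E × ℝ →L[ℝ] V} (hy : f (x, t) ∈ (chartAt V y₀).source)
    (hA : ∀ v, cmp y₀ (f (x, t)) (A (frameMap I x₀ x v)) = X (extChartAt I x₀ x, t) (v, 0))
    (hB : ∀ v, cmp y₀ (f (x, t)) (B (frameMap I x₀ x v)) = Y (extChartAt I x₀ x, t) (v, 0)) :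
    homInner h g x (f (x, t)) A B =
      localHomInner g h x₀ y₀ f (fun a p => X p (EuclideanSpace.single a 1, 0))
        (fun a p => Y p (EuclideanSpace.single a 1, 0)) (extChartAt I x₀ x, t) := by
  rw [homInner_eq (x₀ := x₀) g h hx hy (A' := (X _).comp (ContinuousLinearMap.inl ℝ E ℝ))
    (B' := (Y _).comp (ContinuousLinearMap.inl ℝ E ℝ)) hA hB, localHomInner,
    localFamily_apply hx, (extChartAt I x₀).left_inv (by simpa using hx)]
  rfl

/-- `⟨∇ ∇_t ∂_t f, df⟩`. -/
def hessianTerm (f : M × ℝ → N) (t : ℝ) (x : M) : ℝ :=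
  homInner h g x (f (x, t))
    (covDeriv h I (fun z => f (z, t)) (fun z => acceleration h f t z) x)
    (mfderiv I (𝓡 n) (fun z => f (z, t)) x)

/-- The partial derivatives of `f` in charts. -/
def localPartial (n : ℕ) [ChartedSpace (EuclideanSpace ℝ (Fin n)) N]
    (I : ModelWithCorners ℝ (EuclideanSpace ℝ (Fin m)) H) (f : M × ℝ → N) (T : Set ℝ)
    (x₀ : M) (y₀ : N) (a : Fin m) (p : E × ℝ) : EuclideanSpace ℝ (Fin n) :=
  fderivWithin ℝ (localFamily n I f x₀ y₀) (familyDomain n I f T x₀ y₀) p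
    (EuclideanSpace.single a 1, 0)

/-- The covariant partial derivatives of a section in charts. -/
def localCovPartial (I : ModelWithCorners ℝ (EuclideanSpace ℝ (Fin m)) H) (f : M × ℝ → N)
    (T : Set ℝ) (x₀ : M) (y₀ : N) (X : E × ℝ → V) (a : Fin m) : E × ℝ → V :=
  covDir (chartChristoffel h y₀) (familyDomain n I f T x₀ y₀) (localFamily n I f x₀ y₀)
    (EuclideanSpace.single a 1, 0) X

include hT hf in
theorem contDiffOn_localPartial (a : Fin m) : ContDiffOn ℝ ∞ (localPartial n I f T x₀ y₀ a) Ω :=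
  contDiffOn_dir (uniqueDiffOn_familyDomain hT hf x₀ y₀) (contDiffOn_localFamily hf x₀ y₀) _

include hT hf in
theorem contDiffOn_localCovPartial {X : E × ℝ → V} (hX : ContDiffOn ℝ ∞ X Ω) (a : Fin m) :
    ContDiffOn ℝ ∞ (localCovPartial h I f T x₀ y₀ X a) Ω :=
  contDiffOn_covDir_family h hT hf hX _

include hT hf in
theorem energyDensity_eq
    (hx : x ∈ (chartAt H x₀).source) (ht : t ∈ T)
    (hy : f (x, t) ∈ (chartAt V y₀).source) : energyDensity h g (fun z => f (z, t)) x = (1 / 2) *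
    localHomInner g h x₀ y₀ f (localPartial n I f T x₀ y₀) (localPartial n I f T x₀ y₀)
      (extChartAt I x₀ x, t) := by
  rw [energyDensity]
  refine congrArg _ ?_
  exact homInner_family g h hx hy (compMap_mfderiv_family hT hf hx ht hy)
    (compMap_mfderiv_family hT hf hx ht hy)

include hT hf in
theorem normSqCovVariation_eq
    (hx : x ∈ (chartAt H x₀).source) (ht : t ∈ T)
    (hy : f (x, t) ∈ (chartAt V y₀).source) : normSqCovVariation h g f t x =
    localHomInner g h x₀ y₀ f (localCovPartial h I f T x₀ y₀ (localVelocity n I f T x₀ y₀))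
      (localCovPartial h I f T x₀ y₀ (localVelocity n I f T x₀ y₀)) (extChartAt I x₀ x, t) := by
  have h1 : ∀ v, cmp y₀ (f (x, t)) (covVariation h f t x (frameMap I x₀ x v)) =
      covDirMap Γ Ω F (localVelocity n I f T x₀ y₀) (extChartAt I x₀ x, t) (v, 0) := fun v => by
    rw [covDirMap_apply]
    exact compMap_covDeriv_space h hT hf hx ht hy (contDiffOn_localVelocity hT hf)
      (fun z hz hyz => compMap_variationField hT hf hz ht hyz) v
  have h2 := homInner_family g h hx hy h1 h1
  simp only [covDirMap_apply] at h2
  exact h2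

include hT hf in
theorem hessianTerm_eq
    (hx : x ∈ (chartAt H x₀).source) (ht : t ∈ T)
    (hy : f (x, t) ∈ (chartAt V y₀).source) : hessianTerm g h f t x =
    localHomInner g h x₀ y₀ f (localCovPartial h I f T x₀ y₀ (localAcceleration h I f T x₀ y₀))
      (localPartial n I f T x₀ y₀) (extChartAt I x₀ x, t) := by
  have h1 : ∀ v, cmp y₀ (f (x, t)) (covDeriv h I (fun z => f (z, t))
      (fun z => acceleration h f t z) x (frameMap I x₀ x v)) =
      covDirMap Γ Ω F (localAcceleration h I f T x₀ y₀) (extChartAt I x₀ x, t) (v, 0) := fun v => by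
    rw [covDirMap_apply]
    exact compMap_covDeriv_space h hT hf hx ht hy (contDiffOn_localAcceleration h hT hf)
      (fun z hz hyz => compMap_acceleration h hT hf hz ht hyz) v
  have h2 := homInner_family g h hx hy h1 (compMap_mfderiv_family hT hf hx ht hy)
  simp only [covDirMap_apply] at h2
  exact h2

end Components

/-! ### Time derivatives of the energy density. -/

noncomputable section TimeDerivatives

variable {m n : ℕ} {H : Type*} [TopologicalSpace H]
  {I : ModelWithCorners ℝ (EuclideanSpace ℝ (Fin m)) H}
  {M : Type*} [TopologicalSpace M] [ChartedSpace H M] [IsManifold I ∞ M]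
  {N : Type*} [TopologicalSpace N]
  [ChartedSpace (EuclideanSpace ℝ (Fin n)) N] [IsManifold (𝓡 n) ∞ N]
  (g : Bundle.ContMDiffRiemannianMetric I ∞ (EuclideanSpace ℝ (Fin m))
    (fun x : M => TangentSpace I x))
  (h : Bundle.ContMDiffRiemannianMetric (𝓡 n) ∞ (EuclideanSpace ℝ (Fin n))
    (fun y : N => TangentSpace (𝓡 n) y))
  {f : M × ℝ → N} {T : Set ℝ} {x₀ x : M} {y₀ y : N} {t : ℝ}

local notation "E" => EuclideanSpace ℝ (Fin m)
local notation "V" => EuclideanSpace ℝ (Fin n)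
local notation "Ω" => familyDomain n I f T x₀ y₀

/-- The trace of a field of bilinear forms with components `q` in a chart. -/
def localTrace (x₀ : M) (q : Fin m → Fin m → E × ℝ → ℝ) (p : E × ℝ) : ℝ :=
  ∑ a, ∑ b, (metricMatrix g x₀ ((extChartAt I x₀).symm p.1))⁻¹ a b * q a b p

/-- The pullback metric in charts. -/
def localPullback (f : M × ℝ → N) (T : Set ℝ) (x₀ : M) (y₀ : N) (a b : Fin m) (p : E × ℝ) : ℝ :=
  chartMetric h y₀ (localFamily n I f x₀ y₀ p) (localPartial n I f T x₀ y₀ a p)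
    (localPartial n I f T x₀ y₀ b p)

/-- The time derivative of a function in charts. -/
def timeDeriv (n : ℕ) [ChartedSpace (EuclideanSpace ℝ (Fin n)) N]
    (I : ModelWithCorners ℝ (EuclideanSpace ℝ (Fin m)) H) (f : M × ℝ → N) (T : Set ℝ) (x₀ : M)
    (y₀ : N) (q : E × ℝ → ℝ) (p : E × ℝ) : ℝ :=
  fderivWithin ℝ q (familyDomain n I f T x₀ y₀) p (0, 1)

variable (hT : IsOpen T) (hf : ContMDiffOn (I.prod 𝓘(ℝ, ℝ)) (𝓡 n) ∞ f (univ ×ˢ T))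

include hT hf in
theorem contDiffOn_localPullback (a b : Fin m) :
    ContDiffOn ℝ ∞ (localPullback (I := I) h f T x₀ y₀ a b) Ω :=
  contDiffOn_localInner h hT hf (contDiffOn_localPartial hT hf a) (contDiffOn_localPartial hT hf b)

include hT hf in
theorem contDiffOn_timeDeriv {q : E × ℝ → ℝ} (hq : ContDiffOn ℝ ∞ q Ω) :
    ContDiffOn ℝ ∞ (timeDeriv n I f T x₀ y₀ q) Ω :=
  contDiffOn_dir (uniqueDiffOn_familyDomain hT hf x₀ y₀) hq _

theorem contDiffOn_localTrace {q : Fin m → Fin m → E × ℝ → ℝ} (hq : ∀ a b, ContDiffOn ℝ ∞ (q a b) Ω) :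
    ContDiffOn ℝ ∞ (localTrace g x₀ q) Ω :=
  ContDiffOn.sum fun a _ => ContDiffOn.sum fun b _ =>
    ((contDiffOn_inv_metricMatrix g x₀ a b).comp contDiff_fst.contDiffOn fun _ hp => hp.1).mul
      (hq a b)

include hT hf in
-- The inverse metric of `M` does not depend on time, so only the components `q a b` are
-- differentiated.
theorem hasDerivAt_localTrace {q : Fin m → Fin m → E × ℝ → ℝ}
    (hq : ∀ a b, ContDiffOn ℝ ∞ (q a b) Ω) {ξ : E} (hp : (ξ, t) ∈ Ω) :
    HasDerivAt (fun s => localTrace g x₀ q (ξ, s))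
      (localTrace g x₀ (fun a b => timeDeriv n I f T x₀ y₀ (q a b)) (ξ, t)) t :=
  HasDerivAt.fun_sum fun a _ => HasDerivAt.fun_sum fun b _ => (hasDerivAt_slice
    (eventually_mem_familyDomain_time hT hf hp)
    ((hq a b).differentiableOn (by simp) _ hp)).const_mul
      ((metricMatrix g x₀ ((extChartAt I x₀).symm ξ))⁻¹ a b)

include hT hf in
theorem hasDerivAt_energyDensity (hx : x ∈ (chartAt H x₀).source) (ht : t ∈ T)
    (hy : f (x, t) ∈ (chartAt V y₀).source) :
    HasDerivAt (fun s => energyDensity h g (fun z => f (z, s)) x) ((1 / 2) * localTrace g x₀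
      (fun a b => timeDeriv n I f T x₀ y₀ (localPullback (I := I) h f T x₀ y₀ a b))
        (extChartAt I x₀ x, t)) t := by
  refine ((hasDerivAt_localTrace g hT hf (contDiffOn_localPullback h hT hf)
    (mem_familyDomain hx ht hy)).const_mul _).congr_of_eventuallyEq ?_
  filter_upwards [eventually_time hT hf x ht hy] with s hs
  exact energyDensity_eq g h hT hf hx hs.1 hs.2

include hT hf in
theorem hasDerivAt_deriv_energyDensity (hx : x ∈ (chartAt H x₀).source) (ht : t ∈ T)
    (hy : f (x, t) ∈ (chartAt V y₀).source) :
    HasDerivAt (deriv fun s => energyDensity h g (fun z => f (z, s)) x) ((1 / 2) * localTrace g x₀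
      (fun a b => timeDeriv n I f T x₀ y₀
        (timeDeriv n I f T x₀ y₀ (localPullback (I := I) h f T x₀ y₀ a b)))
        (extChartAt I x₀ x, t)) t := by
  refine ((hasDerivAt_localTrace g hT hf
    (fun a b => contDiffOn_timeDeriv hT hf (contDiffOn_localPullback h hT hf a b))
    (mem_familyDomain hx ht hy)).const_mul _).congr_of_eventuallyEq ?_
  filter_upwards [eventually_time hT hf x ht hy] with s hs
  exact (hasDerivAt_energyDensity g h hT hf hx hs.1 hs.2).deriv

include hT hf in
/-- A function that is continuous in charts is continuous. -/
theorem continuousOn_of_familyDomain {Z : Type*} [TopologicalSpace Z] {φ : M × ℝ → Z}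
    {Φ : M → N → E × ℝ → Z}
    (hΦ : ∀ x₀ y₀, ContinuousOn (Φ x₀ y₀) (familyDomain n I f T x₀ y₀))
    (hφ : ∀ x₀ y₀, ∀ x ∈ (chartAt H x₀).source, ∀ t ∈ T, f (x, t) ∈ (chartAt V y₀).source →
      φ (x, t) = Φ x₀ y₀ (extChartAt I x₀ x, t)) : ContinuousOn φ (univ ×ˢ T) := by
  rintro ⟨x, t⟩ ⟨-, ht⟩
  refine ContinuousAt.continuousWithinAt ?_
  have hx := mem_chart_source H x
  have hy := mem_chart_source V (f (x, t))
  have hc : ContinuousAt f (x, t) := (contMDiffAt_family hT hf x ht).continuousAt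
  have ev : ∀ᶠ p : M × ℝ in 𝓝 (x, t), p.1 ∈ (chartAt H x).source ∧ p.2 ∈ T ∧
      f p ∈ (chartAt V (f (x, t))).source :=
    (continuousAt_fst.eventually ((chartAt H x).open_source.mem_nhds hx)).and
      ((continuousAt_snd.eventually (hT.mem_nhds ht)).and
        (hc.eventually ((chartAt V (f (x, t))).open_source.mem_nhds hy)))
  have h1 : Filter.Tendsto (fun p : M × ℝ => (extChartAt I x p.1, p.2)) (𝓝 (x, t))
      (𝓝[familyDomain n I f T x (f (x, t))] (extChartAt I x x, t)) := by
    refine tendsto_nhdsWithin_iff.2 ⟨?_, ev.mono fun p hp => mem_familyDomain hp.1 hp.2.1 hp.2.2⟩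
    exact Filter.Tendsto.prodMk_nhds ((continuousAt_extChartAt (I := I) x).tendsto.comp
      (continuousAt_fst (p := (x, t))).tendsto) continuousAt_snd
  have h2 := (hΦ x (f (x, t)) _ (mem_familyDomain hx ht hy)).tendsto.comp h1
  rw [← hφ x (f (x, t)) x hx t ht hy] at h2
  refine h2.congr' (ev.mono fun p hp => ?_)
  exact (hφ x (f (x, t)) p.1 hp.1 p.2 hp.2.1 hp.2.2).symm

include hT hf in
theorem continuousOn_energyDensity :
    ContinuousOn (fun p : M × ℝ => energyDensity h g (fun z => f (z, p.2)) p.1) (univ ×ˢ T) :=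
  continuousOn_of_familyDomain hT hf
    (fun _ _ => (contDiffOn_const.mul (contDiffOn_localTrace g
      (contDiffOn_localPullback h hT hf))).continuousOn)
    fun _ _ _ hx _ ht hy => energyDensity_eq g h hT hf hx ht hy

include hT hf in
theorem continuousOn_deriv_energyDensity :
    ContinuousOn (fun p : M × ℝ => deriv (fun s => energyDensity h g (fun z => f (z, s)) p.1) p.2)
      (univ ×ˢ T) :=
  continuousOn_of_familyDomain hT hf
    (fun _ _ => (contDiffOn_const.mul (contDiffOn_localTrace g fun a b =>
      contDiffOn_timeDeriv hT hf (contDiffOn_localPullback h hT hf a b))).continuousOn)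
    fun _ _ _ hx _ ht hy => (hasDerivAt_energyDensity g h hT hf hx ht hy).deriv

include hT hf in
theorem continuousOn_deriv_deriv_energyDensity :
    ContinuousOn (fun p : M × ℝ =>
      deriv (deriv fun s => energyDensity h g (fun z => f (z, s)) p.1) p.2) (univ ×ˢ T) :=
  continuousOn_of_familyDomain hT hf
    (fun _ _ => (contDiffOn_const.mul (contDiffOn_localTrace g fun a b =>
      contDiffOn_timeDeriv hT hf
        (contDiffOn_timeDeriv hT hf (contDiffOn_localPullback h hT hf a b)))).continuousOn)
    fun _ _ _ hx _ ht hy => (hasDerivAt_deriv_energyDensity g h hT hf hx ht hy).deriv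

include hT hf in
theorem continuousOn_normSqCovVariation :
    ContinuousOn (fun p : M × ℝ => normSqCovVariation h g f p.2 p.1) (univ ×ˢ T) :=
  continuousOn_of_familyDomain hT hf
    (fun _ _ => (contDiffOn_localHomInner g h hT hf
      (contDiffOn_localCovPartial h hT hf (contDiffOn_localVelocity hT hf))
      (contDiffOn_localCovPartial h hT hf (contDiffOn_localVelocity hT hf))).continuousOn)
    fun _ _ _ hx _ ht hy => normSqCovVariation_eq g h hT hf hx ht hy

include hT hf in
theorem continuousOn_hessianTerm :
    ContinuousOn (fun p : M × ℝ => hessianTerm g h f p.2 p.1) (univ ×ˢ T) :=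
  continuousOn_of_familyDomain hT hf
    (fun _ _ => (contDiffOn_localHomInner g h hT hf
      (contDiffOn_localCovPartial h hT hf (contDiffOn_localAcceleration h hT hf))
      (contDiffOn_localPartial hT hf)).continuousOn)
    fun _ _ _ hx _ ht hy => hessianTerm_eq g h hT hf hx ht hy

/-- Contraction with a symmetric matrix identifies a term with its transpose. It is applied with `A`
the Hessian, `B` the norm and `C` the curvature contribution. -/
theorem sum_half_symm {G : Matrix (Fin m) (Fin m) ℝ} (hG : G.IsSymm) (A B C : Fin m → Fin m → ℝ) :
    1 / 2 * ∑ a, ∑ b, G a b * ((A a b + A b a) + 2 * B a b - (C a b + C b a)) =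
      ∑ a, ∑ b, G a b * B a b + ∑ a, ∑ b, G a b * A a b - ∑ a, ∑ b, G a b * C a b := by
  have h1 : ∀ A : Fin m → Fin m → ℝ, ∑ a, ∑ b, G a b * A b a = ∑ a, ∑ b, G a b * A a b :=
    fun A => by
      rw [Finset.sum_comm]
      exact Finset.sum_congr rfl fun a _ => Finset.sum_congr rfl fun b _ => by
        rw [hG.apply a b]
  have h2 : ∀ a b, G a b * ((A a b + A b a) + 2 * B a b - (C a b + C b a)) =
      2 * (G a b * B a b) + (G a b * A a b + G a b * A b a) - (G a b * C a b + G a b * C b a) :=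
    fun a b => by ring
  simp_rw [h2, Finset.sum_sub_distrib, Finset.sum_add_distrib, ← Finset.mul_sum]
  rw [h1 A, h1 C]
  ring

theorem localCurvature_antisymm {W : Type*} [NormedAddCommGroup W] [NormedSpace ℝ W]
    (Γ' : W → W →L[ℝ] W →L[ℝ] W) (η u v w : W) :
    localCurvature Γ' η u v w = -localCurvature Γ' η v u w := by
  simp only [localCurvature]
  abel

/-- The curvature as a linear map of its first argument. -/
def curvatureMap {W : Type*} [NormedAddCommGroup W] [NormedSpace ℝ W]
    (Γ' : W → W →L[ℝ] W →L[ℝ] W) (η v w : W) : W →L[ℝ] W :=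
  (((fderiv ℝ Γ' η).flip v).flip w) - (fderiv ℝ Γ' η v).flip w +
    ((Γ' η).flip (Γ' η v w) - (Γ' η v).comp ((Γ' η).flip w))

theorem curvatureMap_apply {W : Type*} [NormedAddCommGroup W] [NormedSpace ℝ W]
    (Γ' : W → W →L[ℝ] W →L[ℝ] W) (η u v w : W) :
    curvatureMap Γ' η v w u = localCurvature Γ' η u v w := by
  simp [curvatureMap, localCurvature]

include hT hf in
-- The charts at `x` and `f (x, t)` are enough, since the curvature term enters only a pointwise
-- identity, from which its integrability is later deduced. Chart independence of the curvature is
-- therefore never needed.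
theorem curvatureTerm_eq (ht : t ∈ T) : curvatureTerm h g f t x =
    ∑ a, ∑ b, (metricMatrix g x x)⁻¹ a b * chartMetric h (f (x, t))
      (localFamily n I f x (f (x, t)) (extChartAt I x x, t))
      (localCurvature (chartChristoffel h (f (x, t)))
        (localFamily n I f x (f (x, t)) (extChartAt I x x, t))
        (localPartial n I f T x (f (x, t)) a (extChartAt I x x, t))
        (localVelocity n I f T x (f (x, t)) (extChartAt I x x, t))
        (localVelocity n I f T x (f (x, t)) (extChartAt I x x, t)))
      (localPartial n I f T x (f (x, t)) b (extChartAt I x x, t)) := by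
  have hx := mem_chart_source H x
  have hy := mem_chart_source V (f (x, t))
  set p : E × ℝ := (extChartAt I x x, t) with hp
  set F' := localFamily n I f x (f (x, t)) with hF'
  set D := fderivWithin ℝ F' (familyDomain n I f T x (f (x, t))) p
  set W := localVelocity n I f T x (f (x, t)) p with hW
  have h1 := homInner_eq (x₀ := x) (y₀ := f (x, t)) g h hx hy
    (A := fun v => curvature h (f (x, t)) (mfderiv I (𝓡 n) (fun z : M => f (z, t)) x v)
      (variationField f t x) (variationField f t x))
    (B := mfderiv I (𝓡 n) (fun z : M => f (z, t)) x)
    (A' := (curvatureMap (chartChristoffel h (f (x, t))) (F' p) W W).comp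
      (D.comp (ContinuousLinearMap.inl ℝ E ℝ)))
    (B' := D.comp (ContinuousLinearMap.inl ℝ E ℝ))
    (fun v => by
      rw [compMap_curvature, compMap_mfderiv_family hT hf hx ht hy,
        compMap_variationField hT hf hx ht hy, ContinuousLinearMap.comp_apply, curvatureMap_apply,
        hF', localFamily_apply hx]
      rfl)
    (fun v => compMap_mfderiv_family hT hf hx ht hy v)
  refine h1.trans ?_
  simp only [ContinuousLinearMap.comp_apply, curvatureMap_apply]
  rw [hF', localFamily_apply hx]
  rfl

include hT hf in
/-- The second time derivative of the energy density. -/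
theorem deriv_deriv_energyDensity (ht : t ∈ T) :
    deriv (deriv fun s => energyDensity h g (fun z => f (z, s)) x) t =
      normSqCovVariation h g f t x + hessianTerm g h f t x - curvatureTerm h g f t x := by
  have hx := mem_chart_source H x
  have hy := mem_chart_source V (f (x, t))
  have hp := mem_familyDomain (n := n) (I := I) hx ht hy
  have LC := isLeviCivita_chart h (f (x, t))
  rw [(hasDerivAt_deriv_energyDensity g h hT hf hx ht hy).deriv,
    normSqCovVariation_eq g h hT hf hx ht hy, hessianTerm_eq g h hT hf hx ht hy,
    curvatureTerm_eq g h hT hf ht]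
  have hG : ((metricMatrix g x x)⁻¹).IsSymm := (metricMatrix_isSymm g x x).inv
  simp only [localTrace, localHomInner, (extChartAt I x).left_inv (mem_extChartAt_source x)]
  rw [← sum_half_symm hG]
  refine congrArg _ (Finset.sum_congr rfl fun a _ => Finset.sum_congr rfl fun b _ => ?_)
  refine congrArg _ ?_
  refine (LC.dir_dir_inner (uniqueDiffOn_familyDomain hT hf x (f (x, t)))
    (familyDomain_subset_closure hT hf x (f (x, t))) (contDiffOn_localFamily hf x (f (x, t)))
    (mapsTo_localFamily x (f (x, t))) (EuclideanSpace.single a 1, 0) (EuclideanSpace.single b 1, 0)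
    (0, 1) hp).trans ?_
  -- `R(V, ∂_a f)V = -R(∂_a f, V)V`; this is the minus sign in front of the curvature term.
  rw [localCurvature_antisymm _ _ _ (fderivWithin ℝ _ _ _ (EuclideanSpace.single a 1, 0)),
    localCurvature_antisymm _ _ _ (fderivWithin ℝ _ _ _ (EuclideanSpace.single b 1, 0))]
  simp only [map_neg, neg_apply]
  rw [sub_eq_add_neg, neg_add]
  rfl

end TimeDerivatives

/-! ### The vector field dual to `⟨∇_t ∂_t f, df⟩` and its divergence. -/

noncomputable section AccelerationField

variable {m n : ℕ} {H : Type*} [TopologicalSpace H]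
  {I : ModelWithCorners ℝ (EuclideanSpace ℝ (Fin m)) H}
  {M : Type*} [TopologicalSpace M] [ChartedSpace H M] [IsManifold I ∞ M]
  {N : Type*} [TopologicalSpace N]
  [ChartedSpace (EuclideanSpace ℝ (Fin n)) N] [IsManifold (𝓡 n) ∞ N]
  (g : Bundle.ContMDiffRiemannianMetric I ∞ (EuclideanSpace ℝ (Fin m))
    (fun x : M => TangentSpace I x))
  (h : Bundle.ContMDiffRiemannianMetric (𝓡 n) ∞ (EuclideanSpace ℝ (Fin n))
    (fun y : N => TangentSpace (𝓡 n) y))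
  {f : M × ℝ → N} {T : Set ℝ} {x₀ x : M} {y₀ y : N} {t : ℝ}

local notation "E" => EuclideanSpace ℝ (Fin m)
local notation "V" => EuclideanSpace ℝ (Fin n)
local notation "cmp" => compMap (𝓡 n)
local notation "Ω" => familyDomain n I f T x₀ y₀
local notation "F" => localFamily n I f x₀ y₀

/-- The vector field dual to the `1`-form `⟨∇_t ∂_t f, df⟩`. -/
def accelerationField (f : M × ℝ → N) (t : ℝ) (x : M) : TangentSpace I x :=
  ∑ a, ∑ b, ((metricMatrix g x x)⁻¹ a b * h.inner (f (x, t)) (acceleration h f t x)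
    (mfderiv I (𝓡 n) (fun z => f (z, t)) x (coordVec I x x b))) • coordVec I x x a

/-- The components of `accelerationField` in charts. -/
def localAccelerationField (f : M × ℝ → N) (T : Set ℝ) (x₀ : M) (y₀ : N) (a : Fin m)
    (p : E × ℝ) : ℝ :=
  ∑ b, (metricMatrix g x₀ ((extChartAt I x₀).symm p.1))⁻¹ a b *
    chartMetric h y₀ (localFamily n I f x₀ y₀ p) (localAcceleration h I f T x₀ y₀ p)
      (localPartial n I f T x₀ y₀ b p)

variable (hT : IsOpen T) (hf : ContMDiffOn (I.prod 𝓘(ℝ, ℝ)) (𝓡 n) ∞ f (univ ×ˢ T))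

include hT hf in
theorem contDiffOn_localAccelerationField (a : Fin m) :
    ContDiffOn ℝ ∞ (localAccelerationField g h f T x₀ y₀ a) Ω :=
  ContDiffOn.sum fun b _ =>
    ((contDiffOn_inv_metricMatrix g x₀ a b).comp contDiff_fst.contDiffOn fun _ hp => hp.1).mul
      (contDiffOn_localInner h hT hf (contDiffOn_localAcceleration h hT hf)
        (contDiffOn_localPartial hT hf b))

include hT hf in
-- The `i`-th component is the metric trace of the bilinear form `Q u v = uⁱ θ(v)` with `θ = ⟨A,
-- df⟩`, so the frame independence of such traces carries it from the chart at `x` to the one at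
-- `x₀`.
theorem compMap_accelerationField (hx : x ∈ (chartAt H x₀).source) (ht : t ∈ T)
    (hy : f (x, t) ∈ (chartAt V y₀).source) (i : Fin m) :
    compMap I x₀ x (accelerationField g h f t x) i =
      localAccelerationField g h f T x₀ y₀ i (extChartAt I x₀ x, t) := by
  let θ : TangentSpace I x →L[ℝ] ℝ := (h.inner (f (x, t)) (acceleration h f t x)).comp
    (mfderiv I (𝓡 n) (fun z => f (z, t)) x)
  let Q : TangentSpace I x →ₗ[ℝ] TangentSpace I x →ₗ[ℝ] ℝ :=
    LinearMap.mk₂ ℝ (fun u v => compMap I x₀ x u i * θ v) (fun u u' v => by simp [add_mul])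
      (fun c u v => by simp [mul_assoc]) (fun u v v' => by simp [mul_add])
      (fun c u v => by simp [mul_left_comm])
  have h1 : compMap I x₀ x (accelerationField g h f t x) i =
      ∑ a, ∑ b, (metricMatrix g x x)⁻¹ a b * Q (coordVec I x x a) (coordVec I x x b) := by
    simp only [accelerationField, map_sum, map_smul]
    simp only [PiLp.smul_apply, WithLp.ofLp_sum, Finset.sum_apply, smul_eq_mul]
    refine Finset.sum_congr rfl fun a _ => Finset.sum_congr rfl fun b _ => ?_
    have : Q (coordVec I x x a) (coordVec I x x b) =
      compMap I x₀ x (coordVec I x x a) i * θ (coordVec I x x b) := rfl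
    rw [this]
    simp only [θ, ContinuousLinearMap.comp_apply]
    ring
  have h2 : ∀ a b, Q (coordVec I x₀ x a) (coordVec I x₀ x b) =
      (if a = i then 1 else 0) * chartMetric h y₀ (F (extChartAt I x₀ x, t))
        (localAcceleration h I f T x₀ y₀ (extChartAt I x₀ x, t))
        (localPartial n I f T x₀ y₀ b (extChartAt I x₀ x, t)) := fun a b => by
    have e : Q (coordVec I x₀ x a) (coordVec I x₀ x b) =
      compMap I x₀ x (coordVec I x₀ x a) i * h.inner (f (x, t)) (acceleration h f t x)
        (mfderiv I (𝓡 n) (fun z => f (z, t)) x (coordVec I x₀ x b)) := rfl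
    rw [e, ← frameMap_single hx, ← frameMap_single hx, compMap_frameMap hx,
      ← chartMetric_compMap h hy, compMap_mfderiv_family hT hf hx ht hy,
      compMap_acceleration h hT hf hx ht hy, localFamily_apply hx, localPartial]
    congr 1
    simp [eq_comm]
  rw [h1, sum_inv_metricMatrix_mul g hx (mem_chart_source H x) Q]
  simp only [h2, localAccelerationField, (extChartAt I x₀).left_inv
    (show x ∈ (extChartAt I x₀).source by simpa using hx)]
  rw [Finset.sum_eq_single i (fun a _ hai => by simp [hai]) (by simp)]
  simp

include hT hf in
theorem fieldComp_accelerationField {ξ : E} (hp : (ξ, t) ∈ Ω) (i : Fin m) :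
    fieldComp x₀ (accelerationField g h f t) ξ i =
      localAccelerationField g h f T x₀ y₀ i (ξ, t) := by
  have := compMap_accelerationField g h hT hf (symm_mem_source hp.1) hp.2.1 hp.2.2 i
  rwa [(extChartAt I x₀).right_inv hp.1] at this

include hT hf in
theorem isSmoothField_accelerationField (ht : t ∈ T) :
    IsSmoothField (accelerationField (I := I) g h f t) := fun x₀ => by
  refine contDiffOn_euclidean.2 fun i => ?_
  intro ξ hξ
  have hy := mem_chart_source V (f ((extChartAt I x₀).symm ξ, t))
  have hp : (ξ, t) ∈ familyDomain n I f T x₀ (f ((extChartAt I x₀).symm ξ, t)) := ⟨hξ, ht, hy⟩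
  have ev := eventually_mem_familyDomain_space hT hf hp
  have ev' := nhdsWithin_mono ξ (extChartAt_target_subset_range x₀) ev
  have h1 : ContDiffWithinAt ℝ ∞ (fun η : E => localAccelerationField g h f T x₀
      (f ((extChartAt I x₀).symm ξ, t)) i (η, t)) (extChartAt I x₀).target ξ := by
    refine ContDiffWithinAt.mono_of_mem_nhdsWithin ?_ ev'
    exact ContDiffWithinAt.comp (f := fun η : E => (η, t)) ξ
      (contDiffOn_localAccelerationField g h hT hf i _ hp)
      (contDiff_id.prodMk contDiff_const).contDiffWithinAt fun η hη => hη
  refine h1.congr_of_eventuallyEq ?_ (fieldComp_accelerationField g h hT hf hp i)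
  filter_upwards [ev'] with η hη
  exact fieldComp_accelerationField g h hT hf hη i

/-- The components of `√|g| g^{ab} ∂_b f` in charts. -/
def localFlux (n : ℕ) [ChartedSpace (EuclideanSpace ℝ (Fin n)) N] (f : M × ℝ → N) (T : Set ℝ)
    (x₀ : M) (y₀ : N) (a : Fin m) (p : E × ℝ) : EuclideanSpace ℝ (Fin n) :=
  ∑ b, (density g x₀ p.1 * (metricMatrix g x₀ ((extChartAt I x₀).symm p.1))⁻¹ a b) •
    localPartial n I f T x₀ y₀ b p

include hT hf in
theorem contDiffOn_localFlux (a : Fin m) : ContDiffOn ℝ ∞ (localFlux g n f T x₀ y₀ a) Ω :=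
  ContDiffOn.sum fun b _ =>
    ((((contDiffOn_density g x₀).mul (contDiffOn_inv_metricMatrix g x₀ a b)).comp
      contDiff_fst.contDiffOn fun _ hp => hp.1).smul (contDiffOn_localPartial hT hf b))

include hT hf in
theorem tensionTerm_eq (ht : t ∈ T) : tensionTerm h g f t x =
    (density g x (extChartAt I x x))⁻¹ * ∑ a, chartMetric h (f (x, t))
      (localFamily n I f x (f (x, t)) (extChartAt I x x, t))
      (localAcceleration h I f T x (f (x, t)) (extChartAt I x x, t))
      (localCovPartial h I f T x (f (x, t)) (localFlux g n f T x (f (x, t)) a) a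
        (extChartAt I x x, t)) := by
  have hx := mem_chart_source H x
  have hy := mem_chart_source V (f (x, t))
  have h1 : ∀ a, cmp (f (x, t)) (f (x, t)) (covDeriv h I (fun z => f (z, t))
      (fun q => ∑ b, (Real.sqrt (metricMatrix g x q).det * (metricMatrix g x q)⁻¹ a b) •
        mfderiv I (𝓡 n) (fun z => f (z, t)) q (coordVec I x q b)) x (coordVec I x x a)) =
      localCovPartial h I f T x (f (x, t)) (localFlux g n f T x (f (x, t)) a) a
        (extChartAt I x x, t) := fun a => by
    rw [← frameMap_single hx]
    refine compMap_covDeriv_space h hT hf hx ht hy (contDiffOn_localFlux g hT hf a)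
      (fun z hz hyz => ?_) _
    simp only [map_sum, map_smul, localFlux, density, (extChartAt I x).left_inv
      (show z ∈ (extChartAt I x).source by simpa using hz)]
    refine Finset.sum_congr rfl fun b _ => ?_
    rw [← frameMap_single hz, compMap_mfderiv_family hT hf hz ht hyz]
    rfl
  rw [tensionTerm, ← chartMetric_compMap h hy, tension, negCodiff, map_smul, map_sum, map_smul,
    map_sum, compMap_acceleration h hT hf hx ht hy, localFamily_apply hx, smul_eq_mul, density,
    (extChartAt I x).left_inv (mem_extChartAt_source x)]
  simp only [h1]

include hT hf in
-- Put `Z_a = ∑_b √|g| g^{ab} ∂_b f`. Then `√|g| Wᵃ = ⟨A, Z_a⟩`, and by metric compatibility `∂_a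
-- ⟨A, Z_a⟩ = ⟨∇_a A, Z_a⟩ + ⟨A, ∇_a Z_a⟩`. After summation over `a` and division by `√|g|` these
-- are the Hessian and the tension term.
theorem divergence_accelerationField (ht : t ∈ T) :
    divergence g (accelerationField g h f t) x = hessianTerm g h f t x + tensionTerm h g f t x := by
  have hx := mem_chart_source H x
  have hy := mem_chart_source V (f (x, t))
  have hp := mem_familyDomain (n := n) (I := I) hx ht hy
  have LC := isLeviCivita_chart h (f (x, t))
  set S := familyDomain n I f T x (f (x, t))
  set ξ := extChartAt I x x
  set A := localAcceleration h I f T x (f (x, t))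
  set Z := localFlux g n f T x (f (x, t))
  have hS := uniqueDiffOn_familyDomain hT hf x (f (x, t))
  have hρ : density g x ξ ≠ 0 := (density_pos g hp.1).ne'
  have hξ : UniqueDiffWithinAt ℝ (range I) ξ :=
    I.uniqueDiffOn _ (extChartAt_target_subset_range x hp.1)
  have dW : DifferentiableWithinAt ℝ
      (fun η => density g x η • fieldComp x (accelerationField g h f t) η) (range I) ξ := by
    have h1 := ((contDiffOn_density g x).smul
      (isSmoothField_accelerationField g h hT hf ht x)).differentiableOn (by simp) ξ hp.1
    exact h1.mono_of_mem_nhdsWithin (extChartAt_target_mem_nhdsWithin x)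
  have h2 : ∀ a, fderivWithin ℝ (fun η => density g x η •
      fieldComp x (accelerationField g h f t) η) (range I) ξ (EuclideanSpace.single a 1) a =
      chartMetric h (f (x, t)) (localFamily n I f x (f (x, t)) (ξ, t))
        (localCovPartial h I f T x (f (x, t)) A a (ξ, t)) (Z a (ξ, t)) +
      chartMetric h (f (x, t)) (localFamily n I f x (f (x, t)) (ξ, t)) (A (ξ, t))
        (localCovPartial h I f T x (f (x, t)) (Z a) a (ξ, t)) := fun a => by
    have sA : ContDiffOn ℝ ∞ A S := contDiffOn_localAcceleration h hT hf
    have sZ : ContDiffOn ℝ ∞ (Z a) S := contDiffOn_localFlux g hT hf a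
    have h3 := LC.dir_inner (hS _ hp)
      ((contDiffOn_localFamily hf x (f (x, t))).differentiableOn (by simp) _ hp)
      (mapsTo_localFamily x (f (x, t)) hp) (sA.differentiableOn (by simp) _ hp)
      (sZ.differentiableOn (by simp) _ hp) (EuclideanSpace.single a 1, 0)
    refine Eq.trans ?_ h3
    have h4 := hasFDerivWithinAt_slice (eventually_mem_familyDomain_space hT hf hp)
      ((contDiffOn_localInner h hT hf sA sZ).differentiableOn (by simp) _ hp)
    have h5 := HasFDerivAt.comp_hasFDerivWithinAt (g := fun z : E => z a)
      (g' := EuclideanSpace.proj (𝕜 := ℝ) a) ξ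
      (EuclideanSpace.proj (𝕜 := ℝ) a : E →L[ℝ] ℝ).hasFDerivAt dW.hasFDerivWithinAt
    have e : ∀ η, (η, t) ∈ S → ((fun z : E => z a) ∘ fun η => density g x η •
        fieldComp x (accelerationField g h f t) η) η =
        chartMetric h (f (x, t)) (localFamily n I f x (f (x, t)) (η, t)) (A (η, t))
          (Z a (η, t)) := fun η hη => by
      simp only [Function.comp_apply, PiLp.smul_apply, smul_eq_mul]
      rw [fieldComp_accelerationField g h hT hf hη]
      simp only [localAccelerationField, Z, localFlux, map_sum, map_smul, smul_eq_mul,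
        Finset.mul_sum]
      exact Finset.sum_congr rfl fun b _ => by ring
    have h6 := h4.congr_of_eventuallyEq
      ((eventually_mem_familyDomain_space hT hf hp).mono e) (e ξ hp)
    exact congrArg (fun L : E →L[ℝ] ℝ => L (EuclideanSpace.single a 1)) (hξ.eq h5 h6)
  rw [divergence, localDiv, trace_eq_sum, tensionTerm_eq g h hT hf ht,
    hessianTerm_eq g h hT hf hx ht hy]
  refine (congrArg _ (Finset.sum_congr rfl fun a _ => h2 a)).trans ?_
  rw [Finset.sum_add_distrib, mul_add]
  refine congrArg₂ _ ?_ rfl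
  simp only [localHomInner, Z, localFlux, map_sum, map_smul, smul_eq_mul, Finset.mul_sum]
  refine Finset.sum_congr rfl fun a _ => Finset.sum_congr rfl fun b _ => ?_
  rw [← mul_assoc, ← mul_assoc]
  refine congrArg₂ _ ?_ rfl
  exact (congrArg (· * _) (inv_mul_cancel₀ hρ)).trans (one_mul _)

end AccelerationField

/-! ### Differentiation under the integral sign. -/

noncomputable section ParametricIntegral

/-- Differentiation under the integral sign, for a derivative that is continuous and supported
in a fixed compact set. -/
theorem hasDerivAt_integral_of_compact {X : Type*} [TopologicalSpace X] [T2Space X]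
    [MeasurableSpace X] [BorelSpace X] {μ : Measure X} [IsFiniteMeasureOnCompacts μ]
    {φ φ' : X → ℝ → ℝ} {T : Set ℝ} (hT : IsOpen T) {K : Set X} (hK : IsCompact K)
    (hint : ∀ s ∈ T, Integrable (fun x => φ x s) μ)
    (hφ : ∀ x, ∀ s ∈ T, HasDerivAt (φ x) (φ' x s) s)
    (hφ' : ContinuousOn (fun p : X × ℝ => φ' p.1 p.2) (univ ×ˢ T))
    (hint' : ∀ s ∈ T, Integrable (fun x => φ' x s) μ)
    (h0 : ∀ x ∉ K, ∀ s ∈ T, φ' x s = 0) {t : ℝ} (ht : t ∈ T) :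
    HasDerivAt (fun s => ∫ x, φ x s ∂μ) (∫ x, φ' x t ∂μ) t := by
  -- On `K` times a closed time interval inside `T` the continuous derivative is bounded by a
  -- constant `C`; the dominating function is `C` on `K` and zero elsewhere.
  obtain ⟨δ, hδ, hδT⟩ := Metric.nhds_basis_closedBall.mem_iff.1 (hT.mem_nhds ht)
  obtain ⟨C, hC⟩ := (hK.prod (isCompact_closedBall t δ)).exists_bound_of_continuousOn
    (hφ'.mono (prod_mono (subset_univ K) hδT))
  refine (hasDerivAt_integral_of_dominated_loc_of_deriv_le (F := fun s x => φ x s)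
    (F' := fun s x => φ' x s) (bound := K.indicator fun _ => C)
    (Metric.closedBall_mem_nhds t hδ) ?_ (hint t ht) (hint' t ht).1 ?_ ?_ ?_).2
  · filter_upwards [hT.mem_nhds ht] with s hs using (hint s hs).1
  · refine ae_of_all _ fun x s hs => ?_
    by_cases hx : x ∈ K
    · rw [indicator_of_mem hx]
      exact hC (x, s) ⟨hx, hs⟩
    · rw [indicator_of_notMem hx, h0 x hx s (hδT hs), norm_zero]
  · rw [integrable_indicator_iff hK.measurableSet]
    exact integrableOn_const hK.measure_ne_top
  · exact ae_of_all _ fun x s hs => hφ x s (hδT hs)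

end ParametricIntegral

/-! ### Variations of compact support: vanishing, integrability, derivatives of the energy. -/

noncomputable section SupportedFamilies

variable {m n : ℕ} {H : Type*} [TopologicalSpace H]
  {I : ModelWithCorners ℝ (EuclideanSpace ℝ (Fin m)) H}
  {M : Type*} [TopologicalSpace M] [ChartedSpace H M] [IsManifold I ∞ M]
  {N : Type*} [TopologicalSpace N]
  [ChartedSpace (EuclideanSpace ℝ (Fin n)) N] [IsManifold (𝓡 n) ∞ N]
  (g : Bundle.ContMDiffRiemannianMetric I ∞ (EuclideanSpace ℝ (Fin m))
    (fun x : M => TangentSpace I x))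
  (h : Bundle.ContMDiffRiemannianMetric (𝓡 n) ∞ (EuclideanSpace ℝ (Fin n))
    (fun y : N => TangentSpace (𝓡 n) y))
  {f : M × ℝ → N} {T : Set ℝ} {x : M} {y : N} {t : ℝ}

local notation "E" => EuclideanSpace ℝ (Fin m)
local notation "V" => EuclideanSpace ℝ (Fin n)
local notation "cmp" => compMap (𝓡 n)

/-- The target fibre depends on `u x`; passing through `Q`, defined on the model spaces, permits
rewriting the point and the derivative separately. -/
theorem energyDensity_congr {u v : M → N} (huv : u =ᶠ[𝓝 x] v) :
    energyDensity h g u x = energyDensity h g v x := by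
  let Q : N → (E →L[ℝ] V) → ℝ := fun y A =>
    1 / 2 * homInner (I := I) (J := 𝓡 n) h g x y (fun w => A w) (fun w => A w)
  have h1 : ∀ u : M → N, energyDensity h g u x = Q (u x) (mfderiv I (𝓡 n) u x) := fun u => rfl
  have h2 : (mfderiv I (𝓡 n) u x : E →L[ℝ] V) = mfderiv I (𝓡 n) v x := huv.mfderiv_eq
  rw [h1, h1, huv.eq_of_nhds]
  exact congrArg (Q (v x)) h2

variable (hT : IsOpen T) (hf : ContMDiffOn (I.prod 𝓘(ℝ, ℝ)) (𝓡 n) ∞ f (univ ×ˢ T))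

theorem eq_zero_of_compMap {u : TangentSpace (𝓡 n) y} (hu : cmp y y u = 0) : u = 0 := by
  rw [← frameMap_compMap (I := 𝓡 n) (mem_chart_source V y) u, hu, map_zero]

include hT in
theorem variationField_eq_zero (ht : t ∈ T) (hx : ∀ s ∈ T, f (x, s) = f (x, t)) :
    variationField (J := 𝓡 n) f t x = 0 := by
  have h1 : (fun s => f (x, s)) =ᶠ[𝓝 t] fun _ => f (x, t) := by
    filter_upwards [hT.mem_nhds ht] with s hs using hx s hs
  have h2 : (mfderiv 𝓘(ℝ, ℝ) (𝓡 n) (fun s => f (x, s)) t : ℝ →L[ℝ] V) =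
      mfderiv 𝓘(ℝ, ℝ) (𝓡 n) (fun _ : ℝ => f (x, t)) t := h1.mfderiv_eq
  rw [mfderiv_const] at h2
  exact congrArg (fun L : ℝ →L[ℝ] V => L 1) h2

include hT hf in
theorem acceleration_eq_zero (ht : t ∈ T) (hx : ∀ s ∈ T, f (x, s) = f (x, t)) :
    acceleration h f t x = 0 := by
  refine eq_zero_of_compMap ?_
  refine (compMap_covDeriv_time h hT hf (mem_chart_source H x) ht (mem_chart_source V (f (x, t)))
    (X := fun _ => 0) contDiffOn_const fun s hs _ => ?_).trans ?_
  · rw [variationField_eq_zero hT hs fun r hr => (hx r hr).trans (hx s hs).symm, map_zero]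
  · simp [covDir]

include hT hf in
theorem curvatureTerm_eq_zero (ht : t ∈ T) (hx : ∀ s ∈ T, f (x, s) = f (x, t)) :
    curvatureTerm h g f t x = 0 := by
  have h1 : localVelocity n I f T x (f (x, t)) (extChartAt I x x, t) = 0 := by
    rw [← compMap_variationField hT hf (mem_chart_source H x) ht (mem_chart_source V (f (x, t))),
      variationField_eq_zero hT ht hx, map_zero]
  rw [curvatureTerm_eq g h hT hf ht, h1]
  simp [localCurvature]

theorem tensionTerm_eq_zero (hx : acceleration h f t x = 0) : tensionTerm h g f t x = 0 := by
  rw [tensionTerm, hx, map_zero]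
  rfl

theorem accelerationField_eq_zero (hx : acceleration h f t x = 0) :
    accelerationField g h f t x = 0 := by
  simp only [accelerationField, hx, map_zero]
  refine Finset.sum_eq_zero fun a _ => Finset.sum_eq_zero fun b _ => ?_
  have : (0 : TangentSpace (𝓡 n) (f (x, t)) →L[ℝ] ℝ)
    (mfderiv I (𝓡 n) (fun z => f (z, t)) x (coordVec I x x b)) = 0 := rfl
  rw [this, mul_zero, zero_smul]

theorem continuous_slice {Z : Type*} [TopologicalSpace Z] {φ : M × ℝ → Z}
    (hφ : ContinuousOn φ (univ ×ˢ T)) (ht : t ∈ T) : Continuous fun x => φ (x, t) :=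
  hφ.comp_continuous (Continuous.prodMk_left t) fun _ => ⟨mem_univ _, ht⟩

variable [T2Space M] [MeasurableSpace M] [BorelSpace M] {K : Set M} (hK : IsCompact K)
  (hfK : ∀ x ∉ K, ∀ s ∈ T, ∀ t ∈ T, f (x, s) = f (x, t))

include hK in
theorem integrable_of_continuous {φ : M → ℝ} (hφ : Continuous φ) (h0 : ∀ x ∉ K, φ x = 0) :
    Integrable φ (riemannianVolume g) :=
  hφ.integrable_of_hasCompactSupport (HasCompactSupport.intro hK h0)

include hK hfK in
theorem energyDensity_eq_of_notMem (hx : x ∉ K) {s : ℝ} (hs : s ∈ T) (ht : t ∈ T) :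
    energyDensity h g (fun z => f (z, s)) x = energyDensity h g (fun z => f (z, t)) x := by
  refine energyDensity_congr g h ?_
  filter_upwards [hK.isClosed.isOpen_compl.mem_nhds hx] with z hz using hfK z hz s hs t ht

include hT hK hfK in
theorem deriv_energyDensity_eq_zero (hx : x ∉ K) (ht : t ∈ T) :
    deriv (fun s => energyDensity h g (fun z => f (z, s)) x) t = 0 := by
  have : (fun s => energyDensity h g (fun z => f (z, s)) x) =ᶠ[𝓝 t]
      fun _ => energyDensity h g (fun z => f (z, t)) x := by
    filter_upwards [hT.mem_nhds ht] with s hs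
    exact energyDensity_eq_of_notMem g h hK hfK hx hs ht
  rw [this.deriv_eq, deriv_const]

include hT hK hfK in
theorem deriv_deriv_energyDensity_eq_zero (hx : x ∉ K) (ht : t ∈ T) :
    deriv (deriv fun s => energyDensity h g (fun z => f (z, s)) x) t = 0 := by
  have : (deriv fun s => energyDensity h g (fun z => f (z, s)) x) =ᶠ[𝓝 t] fun _ => 0 := by
    filter_upwards [hT.mem_nhds ht] with s hs
    exact deriv_energyDensity_eq_zero g h hT hK hfK hx hs
  rw [this.deriv_eq, deriv_const]

include hT hf hK hfK in
theorem acceleration_eq_zero_of_notMem (ht : t ∈ T) {x : M} (hx : x ∉ K) :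
    acceleration h f t x = 0 :=
  acceleration_eq_zero h hT hf ht fun s hs => hfK x hx s hs t ht

include hT hf hK hfK in
-- The acceleration vanishes on the open complement of `K`, so the divergence and the tension term
-- vanish there, and `divergence_accelerationField` leaves this term.
theorem hessianTerm_eq_zero (hx : x ∉ K) (ht : t ∈ T) : hessianTerm g h f t x = 0 := by
  have h1 := divergence_accelerationField (x := x) g h hT hf ht
  rw [divergence_eq_zero g hK.isClosed (fun z hz => accelerationField_eq_zero g h
      (acceleration_eq_zero_of_notMem h hT hf hK hfK ht hz)) hx,
    tensionTerm_eq_zero g h (acceleration_eq_zero_of_notMem h hT hf hK hfK ht hx), add_zero] at h1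
  exact h1.symm

include hT hf hK hfK in
theorem integrable_hessianTerm (ht : t ∈ T) :
    Integrable (hessianTerm g h f t) (riemannianVolume g) :=
  integrable_of_continuous g hK (continuous_slice (continuousOn_hessianTerm g h hT hf) ht)
    fun _ hx => hessianTerm_eq_zero g h hT hf hK hfK hx ht

include hT hf hK hfK in
theorem integrable_deriv_energyDensity (ht : t ∈ T) :
    Integrable (fun x => deriv (fun s => energyDensity h g (fun z => f (z, s)) x) t)
      (riemannianVolume g) :=
  integrable_of_continuous g hK (continuous_slice (continuousOn_deriv_energyDensity g h hT hf) ht)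
    fun _ hx => deriv_energyDensity_eq_zero g h hT hK hfK hx ht

include hT hf hK hfK in
theorem integrable_deriv_deriv_energyDensity (ht : t ∈ T) :
    Integrable (fun x => deriv (deriv fun s => energyDensity h g (fun z => f (z, s)) x) t)
      (riemannianVolume g) :=
  integrable_of_continuous g hK
    (continuous_slice (continuousOn_deriv_deriv_energyDensity g h hT hf) ht)
    fun _ hx => deriv_deriv_energyDensity_eq_zero g h hT hK hfK hx ht

include hT hf hK hfK in
theorem integrable_normSqCovVariation (ht : t ∈ T) :
    Integrable (normSqCovVariation h g f t) (riemannianVolume g) := by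
  refine integrable_of_continuous g hK
    (continuous_slice (continuousOn_normSqCovVariation g h hT hf) ht) fun x hx => ?_
  -- Vanishing outside `K` is read off from the pointwise formula, whose other terms are already
  -- known to vanish there.
  have h1 := deriv_deriv_energyDensity (x := x) g h hT hf ht
  rw [deriv_deriv_energyDensity_eq_zero g h hT hK hfK hx ht,
    hessianTerm_eq_zero g h hT hf hK hfK hx ht,
    curvatureTerm_eq_zero g h hT hf ht fun s hs => hfK x hx s hs t ht] at h1
  simpa using h1.symm

include hT hf hK hfK in
-- Obtained by difference from the pointwise formula, without any continuity of the curvature term;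
-- the tension term is treated likewise through the divergence identity.
theorem integrable_curvatureTerm (ht : t ∈ T) :
    Integrable (curvatureTerm h g f t) (riemannianVolume g) := by
  refine (((integrable_normSqCovVariation g h hT hf hK hfK ht).add
    (integrable_hessianTerm g h hT hf hK hfK ht)).sub
    (integrable_deriv_deriv_energyDensity g h hT hf hK hfK ht)).congr (ae_of_all _ fun x => ?_)
  simp only [Pi.add_apply, Pi.sub_apply, deriv_deriv_energyDensity g h hT hf ht]
  ring

include hT hf hK hfK in
theorem integrable_divergence_accelerationField (ht : t ∈ T) :
    Integrable (divergence g (accelerationField g h f t)) (riemannianVolume g) :=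
  integrable_of_continuous g hK
    (continuous_divergence g (isSmoothField_accelerationField g h hT hf ht)) fun _ hx =>
      divergence_eq_zero g hK.isClosed (fun _ hz => accelerationField_eq_zero g h
        (acceleration_eq_zero_of_notMem h hT hf hK hfK ht hz)) hx

include hT hf hK hfK in
theorem integrable_tensionTerm (ht : t ∈ T) :
    Integrable (tensionTerm h g f t) (riemannianVolume g) := by
  refine ((integrable_divergence_accelerationField g h hT hf hK hfK ht).sub
    (integrable_hessianTerm g h hT hf hK hfK ht)).congr (ae_of_all _ fun x => ?_)
  simp only [Pi.sub_apply, divergence_accelerationField g h hT hf ht]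
  ring

include hT hf hK hfK in
-- The energy density itself need not have compact support, but the difference of two times does,
-- and it is continuous.
theorem integrable_energyDensity {s : ℝ} (hs : s ∈ T) (ht : t ∈ T)
    (hE : Integrable (energyDensity h g fun x => f (x, t)) (riemannianVolume g)) :
    Integrable (energyDensity h g fun x => f (x, s)) (riemannianVolume g) := by
  have hc := continuousOn_energyDensity g h hT hf
  have h1 : Integrable (fun x => energyDensity h g (fun x => f (x, s)) x -
      energyDensity h g (fun x => f (x, t)) x) (riemannianVolume g) :=
    integrable_of_continuous g hK ((continuous_slice hc hs).sub (continuous_slice hc ht))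
      fun x hx => sub_eq_zero.2 (energyDensity_eq_of_notMem g h hK hfK hx hs ht)
  refine (h1.add hE).congr (ae_of_all _ fun x => ?_)
  simp

include hT hf hK hfK in
theorem hasDerivAt_energy (hE : ∀ s ∈ T, Integrable (energyDensity h g fun x => f (x, s))
    (riemannianVolume g)) (ht : t ∈ T) :
    HasDerivAt (fun s => energy h g fun x => f (x, s))
      (∫ x, deriv (fun s => energyDensity h g (fun z => f (z, s)) x) t ∂riemannianVolume g) t :=
  hasDerivAt_integral_of_compact hT hK (fun s hs => hE s hs)
    (φ := fun x s => energyDensity h g (fun z => f (z, s)) x)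
    (φ' := fun x => deriv fun s => energyDensity h g (fun z => f (z, s)) x)
    (fun x _ hs => (hasDerivAt_energyDensity g h hT hf (mem_chart_source H x) hs
      (mem_chart_source V _)).differentiableAt.hasDerivAt)
    (continuousOn_deriv_energyDensity g h hT hf)
    (fun _ hs => integrable_deriv_energyDensity g h hT hf hK hfK hs)
    (fun _ hx _ hs => deriv_energyDensity_eq_zero g h hT hK hfK hx hs) ht

include hT hf hK hfK in
theorem hasDerivAt_deriv_energy (hE : ∀ s ∈ T, Integrable (energyDensity h g fun x => f (x, s))
    (riemannianVolume g)) (ht : t ∈ T) :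
    HasDerivAt (deriv fun s => energy h g fun x => f (x, s))
      (∫ x, deriv (deriv fun s => energyDensity h g (fun z => f (z, s)) x) t
        ∂riemannianVolume g) t := by
  have h1 := hasDerivAt_integral_of_compact hT hK
    (φ := fun x => deriv fun s => energyDensity h g (fun z => f (z, s)) x)
    (φ' := fun x => deriv (deriv fun s => energyDensity h g (fun z => f (z, s)) x))
    (fun _ hs => integrable_deriv_energyDensity g h hT hf hK hfK hs)
    (fun x _ hs => (hasDerivAt_deriv_energyDensity g h hT hf (mem_chart_source H x) hs
      (mem_chart_source V _)).differentiableAt.hasDerivAt)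
    (continuousOn_deriv_deriv_energyDensity g h hT hf)
    (fun _ hs => integrable_deriv_deriv_energyDensity g h hT hf hK hfK hs)
    (fun _ hx _ hs => deriv_deriv_energyDensity_eq_zero g h hT hK hfK hx hs) ht
  refine h1.congr_of_eventuallyEq ?_
  filter_upwards [hT.mem_nhds ht] with s hs
  exact (hasDerivAt_energy g h hT hf hK hfK hE hs).deriv

include hT hf hK hfK in
theorem integral_deriv_deriv_energyDensity [SecondCountableTopology M] (ht : t ∈ T)
    (hb : ∀ x ∈ I.boundary M, acceleration h f t x = 0) :
    ∫ x, deriv (deriv fun s => energyDensity h g (fun z => f (z, s)) x) t ∂riemannianVolume g =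
      (∫ x, normSqCovVariation h g f t x ∂riemannianVolume g)
        - (∫ x, curvatureTerm h g f t x ∂riemannianVolume g)
        - ∫ x, tensionTerm h g f t x ∂riemannianVolume g := by
  have i1 := integrable_normSqCovVariation g h hT hf hK hfK ht
  have i2 := integrable_hessianTerm g h hT hf hK hfK ht
  have i3 := integrable_curvatureTerm g h hT hf hK hfK ht
  have i4 := integrable_tensionTerm g h hT hf hK hfK ht
  have h1 := integral_divergence_eq_zero g (isSmoothField_accelerationField g h hT hf ht) hK
    (fun z hz => accelerationField_eq_zero g h
      (acceleration_eq_zero_of_notMem h hT hf hK hfK ht hz))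
    fun x hx => accelerationField_eq_zero g h (hb x hx)
  simp only [divergence_accelerationField g h hT hf ht] at h1
  -- This says that the integrals of the Hessian and the tension term are opposite, which is all
  -- that is used of the divergence theorem.
  rw [integral_add i2 i4] at h1
  simp only [deriv_deriv_energyDensity g h hT hf ht]
  have h2 := integral_sub (i1.add i2) i3
  simp only [Pi.add_apply] at h2
  rw [h2, integral_add i1 i2]
  linarith

end SupportedFamilies

end SecondVariation

/-! ### The second variation formula. -/

theorem mainTheorem10
    {m n : ℕ} {H : Type*} [TopologicalSpace H]
    (I : ModelWithCorners ℝ (EuclideanSpace ℝ (Fin m)) H)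
    {M : Type*} [TopologicalSpace M] [T2Space M] [SecondCountableTopology M]
    [ChartedSpace H M] [IsManifold I ∞ M] [MeasurableSpace M] [BorelSpace M]
    {N : Type*} [TopologicalSpace N] [T2Space N] [SecondCountableTopology N]
    [ChartedSpace (EuclideanSpace ℝ (Fin n)) N] [IsManifold (𝓡 n) ∞ N]
    (g : Bundle.ContMDiffRiemannianMetric I ∞ (EuclideanSpace ℝ (Fin m))
      (fun x : M => TangentSpace I x))
    (h : Bundle.ContMDiffRiemannianMetric (𝓡 n) ∞ (EuclideanSpace ℝ (Fin n))
      (fun y : N => TangentSpace (𝓡 n) y))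
    (ε : ℝ) (hε : 0 < ε) (f : M × ℝ → N)
    (hf : ContMDiffOn (I.prod 𝓘(ℝ, ℝ)) (𝓡 n) ∞ f (univ ×ˢ Ioo (-ε) ε))
    -- the variation is supported in a compact set (automatic when `M` is compact)
    (hK : ∃ K : Set M, IsCompact K ∧ ∀ x ∉ K, ∀ t ∈ Ioo (-ε) ε, f (x, t) = f (x, 0))
    -- finite energy (automatic when `M` is compact)
    (hE : Integrable (SecondVariation.energyDensity h g (fun x : M => f (x, 0)))
      (SecondVariation.riemannianVolume g)) :
    (∀ s ∈ Ioo (-ε) ε,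
      Integrable (SecondVariation.energyDensity h g (fun x : M => f (x, s)))
        (SecondVariation.riemannianVolume g) ∧
      DifferentiableAt ℝ (fun r : ℝ => SecondVariation.energy h g (fun x : M => f (x, r))) s) ∧
    -- for every `t` with zero acceleration on `∂M` (void when `∂M = ∅`)
    ∀ t ∈ Ioo (-ε) ε, (∀ x ∈ I.boundary M, SecondVariation.acceleration h f t x = 0) →
    Integrable (SecondVariation.normSqCovVariation h g f t)
      (SecondVariation.riemannianVolume g) ∧
    Integrable (SecondVariation.curvatureTerm h g f t) (SecondVariation.riemannianVolume g) ∧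
    Integrable (SecondVariation.tensionTerm h g f t) (SecondVariation.riemannianVolume g) ∧
    HasDerivAt (deriv fun r : ℝ => SecondVariation.energy h g (fun x : M => f (x, r)))
      ((∫ x, SecondVariation.normSqCovVariation h g f t x ∂(SecondVariation.riemannianVolume g))
        - (∫ x, SecondVariation.curvatureTerm h g f t x ∂(SecondVariation.riemannianVolume g))
        - ∫ x, SecondVariation.tensionTerm h g f t x ∂(SecondVariation.riemannianVolume g))
      t := by
  obtain ⟨K, hK, hfK⟩ := hK
  have h0 : (0 : ℝ) ∈ Ioo (-ε) ε := ⟨neg_lt_zero.2 hε, hε⟩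
  have hfK' : ∀ x ∉ K, ∀ s ∈ Ioo (-ε) ε, ∀ t ∈ Ioo (-ε) ε, f (x, s) = f (x, t) :=
    fun x hx s hs t ht => (hfK x hx s hs).trans (hfK x hx t ht).symm
  have hEs : ∀ s ∈ Ioo (-ε) ε,
      Integrable (SecondVariation.energyDensity h g (fun x : M => f (x, s)))
        (SecondVariation.riemannianVolume g) := fun s hs =>
    SecondVariation.integrable_energyDensity g h isOpen_Ioo hf hK hfK' hs h0 hE
  refine ⟨fun s hs => ⟨hEs s hs, (SecondVariation.hasDerivAt_energy g h isOpen_Ioo hf hK hfK' hEs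
    hs).differentiableAt⟩, fun t ht hb =>
    ⟨SecondVariation.integrable_normSqCovVariation g h isOpen_Ioo hf hK hfK' ht,
    SecondVariation.integrable_curvatureTerm g h isOpen_Ioo hf hK hfK' ht,
    SecondVariation.integrable_tensionTerm g h isOpen_Ioo hf hK hfK' ht, ?_⟩⟩
  rw [← SecondVariation.integral_deriv_deriv_energyDensity g h isOpen_Ioo hf hK hfK' ht hb]
  exact SecondVariation.hasDerivAt_deriv_energy g h isOpen_Ioo hf hK hfK' hEs ht
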